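/- Let $K$ be a field complete with respect to a non-trivial nonarchimedean absolute value. A seminorm $q$ on a $K$-algebra $A$ is an algebra seminorm if it is nonarchimedean and $q(ab)\le c\,q(a)q(b)$ for some constant $c>0$; let $A_q$ denote the Hausdorff completion of $A$ with respect to $q$. Let $A$ be a two-sided $K$-Fréchet–Stein algebra, given by a sequence $q_0\le q_1\le\dots$: that is, $A$ is a Hausdorff complete topological $K$-algebra whose topology is defined by the increasing sequence of algebra seminorms $(q_n)_{n\ge 0}$, such that each $A_{q_n}$ is left and right noetherian and is flat both as a left and as a right $A_{q_{n+1}}$-module. For a ring $R$ and a left or right $R$-module $N$, let $j_R(N)=\min\{l\ge 0:\mathrm{Ext}^l_R(N,R)\neq 0\}\in\mathbb N\cup\{\infty\}$ (with $\min\emptyset=\infty$) be the grade of $N$; here $\mathrm{Ext}^l_R(N,R)$ is regarded as a module on the other side through the second argument $R$. The module $N$ is pure if $\mathrm{Ext}^l_R(\mathrm{Ext}^l_R(N,R),R)=0$ for all $l\ne j_R(N)$. A left and right noetherian ring $R$ is Auslander regular if every finitely generated left or right $R$-module $N$ has finite projective dimension and satisfies $j_R(L)\ge l$ for all $l\ge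 0$ and all submodules $L\subseteq\mathrm{Ext}^l_R(N,R)$. For a finitely generated module $N$ over an Auslander regular ring $R$, let $\Delta^l(N)$ be the largest submodule of $N$ of grade $\geq l$ (the sum of all submodules of grade $\ge l$). Assume (DIM): there is an integer $d\ge 0$ such that each $A_{q_n}$ is Auslander regular of global dimension $\le d$. A left $A$-module $M$ is coadmissible if it is isomorphic to $\varprojlim_n M_n$ for finitely generated left $A_{q_n}$-modules $M_n$ together with isomorphisms $A_{q_n}\otimes_{A_{q_{n+1}}}M_{n+1}\cong M_n$ of $A_{q_n}$-modules. For such $M$ and $l\ge 0$, let $\Delta^l(M)$ be the set of all $m\in M$ with $1\otimes m\in\Delta^l(A_{q_n}\otimes_A M)$ for every $n$. Let $M$ be a coadmissible $A$-module. Then $M=\Delta^0(M)\supseteq\Delta^1(M)\supseteq\dots\supseteq\Delta^{d+1}(M)=0$ is a filtration of $M$ by coadmissible submodules such that, for all $l$ and $n$, the map $A_{q_n}\otimes_A\Delta^l(M)\to A_{q_n}\otimes_A M$ is injective with image $\Delta^l(A_{q_n}\otimes_A M)$ (the dimension filtration of $M$), and moreover: (i) a coadmissible submodule $N\subseteq M$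 has grade $j_A(N)\ge l$ if and only if $N\subseteq\Delta^l(M)$; (ii) $j_A(M)=\sup\{l\ge 0:\Delta^l(M)=M\}$; (iii) if $M$ is pure and $j_A(M)<\infty$ (that is, $M\neq 0$), then $M=\Delta^{j_A(M)}(M)\supseteq\Delta^{j_A(M)+1}(M)=0$; (iv) for every $l\ge 0$, the module $\Delta^l(M)/\Delta^{l+1}(M)$ is zero or pure of grade $l$. -/

import Mathlib

open CategoryTheory Abelian
open scoped TensorProduct

universe w u

noncomputable section

/-! ### Extension of scalars, flatness -/

section BaseChange

variable {R S : Type u} [Ring R] [Ring S] (φ : R →+* S)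

/-- The relations `(s * φ r) ⊗ n = s ⊗ (r • n)` inside `S ⊗[ℤ] N`
(this set is stable under left multiplication by `S`). -/
def baseChangeRel (N : Type u) [AddCommGroup N] [Module R N] : Submodule S (S ⊗[ℤ] N) :=
  Submodule.span S
    {x | ∃ (s : S) (r : R) (n : N), x = (s * φ r) ⊗ₜ[ℤ] n - s ⊗ₜ[ℤ] (r • n)}

/-- The left `S`-module `S ⊗_R N`, where `N` is a left module over the possibly noncommutative
ring `R`, and `S` is a right `R`-module via `φ : R → S`. -/
def BaseChange (N : Type u) [AddCommGroup N] [Module R N] : Type u :=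
  (S ⊗[ℤ] N) ⧸ baseChangeRel φ N

variable (N : Type u) [AddCommGroup N] [Module R N]
variable (N' : Type u) [AddCommGroup N'] [Module R N']

instance : AddCommGroup (BaseChange φ N) :=
  inferInstanceAs (AddCommGroup ((S ⊗[ℤ] N) ⧸ baseChangeRel φ N))

instance : Module S (BaseChange φ N) :=
  inferInstanceAs (Module S ((S ⊗[ℤ] N) ⧸ baseChangeRel φ N))

variable {N N'}

/-- The pure tensor `s ⊗ n` in `S ⊗_R N`. -/
def BaseChange.tmul (s : S) (n : N) : BaseChange φ N :=
  (baseChangeRel φ N).mkQ (s ⊗ₜ[ℤ] n)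

theorem BaseChange.tmul_add (s : S) (n n' : N) :
    BaseChange.tmul φ s (n + n') = BaseChange.tmul φ s n + BaseChange.tmul φ s n' := by
  simp only [BaseChange.tmul, TensorProduct.tmul_add]
  exact map_add _ _ _

theorem BaseChange.tmul_zero (s : S) : BaseChange.tmul φ s (0 : N) = 0 := by
  simp only [BaseChange.tmul, TensorProduct.tmul_zero]
  exact map_zero _

theorem BaseChange.smul_tmul (s t : S) (n : N) :
    s • BaseChange.tmul φ t n = BaseChange.tmul φ (s * t) n :=
  rfl

theorem BaseChange.tmul_smul (s : S) (r : R) (n : N) :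
    BaseChange.tmul φ s (r • n) = BaseChange.tmul φ (s * φ r) n := by
  symm
  rw [BaseChange.tmul, BaseChange.tmul]
  exact (Submodule.Quotient.eq _).2 (Submodule.subset_span ⟨s, r, n, rfl⟩)

/-- The `S`-linear map `S ⊗ f : S ⊗_R N → S ⊗_R N'` induced by an `R`-linear map `f`. -/
def BaseChange.map (f : N →ₗ[R] N') : BaseChange φ N →ₗ[S] BaseChange φ N' :=
  Submodule.mapQ (baseChangeRel φ N) (baseChangeRel φ N')
    (TensorProduct.AlgebraTensorModule.map (LinearMap.id : S →ₗ[S] S) (f.restrictScalars ℤ))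
    (by
      refine Submodule.span_le.2 ?_
      rintro _ ⟨s, r, n, rfl⟩
      refine Submodule.subset_span ⟨s, r, f n, ?_⟩
      simp)

theorem BaseChange.map_tmul (f : N →ₗ[R] N') (s : S) (n : N) :
    BaseChange.map φ f (BaseChange.tmul φ s n) = BaseChange.tmul φ s (f n) :=
  rfl

/-- `S` is flat as a right `R`-module via `φ`: the functor `S ⊗_R -` on left `R`-modules preserves
injections. -/
def FlatAsRightModule : Prop :=
  ∀ (N N' : Type u) [AddCommGroup N] [Module R N] [AddCommGroup N'] [Module R N']
    (f : N →ₗ[R] N'), Function.Injective f → Function.Injective (BaseChange.map φ f)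

/-- `S` is flat as a left `R`-module via `φ`: the functor `- ⊗_R S` on right `R`-modules preserves
injections. Right modules are left modules over the opposite ring, and `N ⊗_R S` is
`Sᵐᵒᵖ ⊗_{Rᵐᵒᵖ} N`. -/
def FlatAsLeftModule : Prop := FlatAsRightModule φ.op

end BaseChange

/-! ### Grade, purity, dimension filtration and Auslander regularity

All modules are left modules; right `R`-modules are (left) `Rᵐᵒᵖ`-modules. -/

section Auslander

variable (R : Type u) [Ring R]

/-- Right multiplication by `r`, as an endomorphism of the left `R`-module `R`. -/
def rightMulHom (r : R) : ModuleCat.of R R ⟶ ModuleCat.of R R :=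
  ModuleCat.ofHom (LinearMap.toSpanSingleton R R r)

variable (N : Type u) [AddCommGroup N] [Module R N]

/-- The group `Ext^l_R(N, R)`. -/
def ExtDual (l : ℕ) : Type u :=
  Abelian.Ext.{u} (ModuleCat.of R N) (ModuleCat.of R R) l

instance (l : ℕ) : AddCommGroup (ExtDual R N l) :=
  inferInstanceAs (AddCommGroup (Abelian.Ext.{u} (ModuleCat.of R N) (ModuleCat.of R R) l))

/-- The right `R`-module structure on `Ext^l_R(N, R)`, induced by right multiplication on the
second argument `R`. -/
@[reducible] def extDualModule (l : ℕ) :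
    Module Rᵐᵒᵖ (Abelian.Ext.{u} (ModuleCat.of R N) (ModuleCat.of R R) l) where
  smul r x := x.comp (Abelian.Ext.mk₀ (rightMulHom R r.unop)) (add_zero l)
  one_smul x := by
    change x.comp (Abelian.Ext.mk₀ (rightMulHom R 1)) (add_zero l) = x
    have : rightMulHom R 1 = 𝟙 _ := by
      ext; simp [rightMulHom]
    rw [this]
    exact Abelian.Ext.comp_mk₀_id _
  mul_smul r s x := by
    change x.comp (Abelian.Ext.mk₀ (rightMulHom R (s.unop * r.unop))) (add_zero l) =
      (x.comp (Abelian.Ext.mk₀ (rightMulHom R s.unop)) (add_zero l)).comp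
        (Abelian.Ext.mk₀ (rightMulHom R r.unop)) (add_zero l)
    have : rightMulHom R (s.unop * r.unop) = rightMulHom R s.unop ≫ rightMulHom R r.unop := by
      ext; simp [rightMulHom]
    rw [this, Abelian.Ext.comp_assoc_of_third_deg_zero, Abelian.Ext.mk₀_comp_mk₀]
  smul_zero r := by
    change (0 : Abelian.Ext.{u} (ModuleCat.of R N) (ModuleCat.of R R) l).comp
      (Abelian.Ext.mk₀ (rightMulHom R r.unop)) (add_zero l) = 0
    simp
  smul_add r x y := Abelian.Ext.add_comp _ _ _ _
  add_smul r s x := by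
    change x.comp (Abelian.Ext.mk₀ (rightMulHom R (r.unop + s.unop))) (add_zero l) =
      x.comp (Abelian.Ext.mk₀ (rightMulHom R r.unop)) (add_zero l) +
        x.comp (Abelian.Ext.mk₀ (rightMulHom R s.unop)) (add_zero l)
    have : rightMulHom R (r.unop + s.unop) = rightMulHom R r.unop + rightMulHom R s.unop := by
      ext; simp [rightMulHom]
    rw [this, Abelian.Ext.mk₀_add, Abelian.Ext.comp_add]
  zero_smul x := by
    change x.comp (Abelian.Ext.mk₀ (rightMulHom R 0)) (add_zero l) = 0
    have : rightMulHom R 0 = 0 := by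
      ext; simp [rightMulHom]
    rw [this, Abelian.Ext.mk₀_zero]
    exact Abelian.Ext.comp_zero _ _ _ _ _

instance (l : ℕ) : Module Rᵐᵒᵖ (ExtDual R N l) := extDualModule R N l

/-- The grade `j_R(N) = min {l ≥ 0 : Ext^l_R(N, R) ≠ 0}`, which is `∞` if there is no such `l`. -/
def moduleGrade : ℕ∞ := ⨅ (l : ℕ) (_ : Nontrivial (ExtDual R N l)), (l : ℕ∞)

/-- `N` is pure: `Ext^l_R(Ext^l_R(N, R), R) = 0` for all `l ≠ j_R(N)`. -/
def IsPureModule : Prop :=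
  ∀ l : ℕ, (l : ℕ∞) ≠ moduleGrade R N → Subsingleton (ExtDual Rᵐᵒᵖ (ExtDual R N l) l)

/-- The step `Δ^l(N)` of the dimension filtration of `N`: the largest submodule of
grade at least `l` (the sum of all submodules of grade at least `l`). -/
def dimFiltration (l : ℕ) : Submodule R N :=
  sSup {L : Submodule R N | (l : ℕ∞) ≤ moduleGrade R L}

/-- The Auslander condition for `N`: each submodule of `Ext^l_R(N, R)` has grade at least `l`. -/
def AuslanderCondition : Prop :=
  ∀ (l : ℕ) (L : Submodule Rᵐᵒᵖ (ExtDual R N l)), (l : ℕ∞) ≤ moduleGrade Rᵐᵒᵖ L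

/-- Every finitely generated left `R`-module has finite projective dimension and satisfies the
Auslander condition. -/
def AuslanderRegularLeft : Prop :=
  ∀ (N : Type u) [AddCommGroup N] [Module R N] [Module.Finite R N],
    (∃ m : ℕ, HasProjectiveDimensionLE (ModuleCat.of R N) m) ∧ AuslanderCondition R N

/-- `R` is (left and right) noetherian and Auslander regular. -/
structure IsAuslanderRegular : Prop where
  noetherian_left : IsNoetherianRing R
  noetherian_right : IsNoetherianRing Rᵐᵒᵖ
  regular_left : AuslanderRegularLeft R
  regular_right : AuslanderRegularLeft Rᵐᵒᵖ

/-- `R` has (left and right) global dimension at most `d`. -/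
def GlobalDimensionLE (d : ℕ) : Prop :=
  (∀ X : ModuleCat.{u} R, HasProjectiveDimensionLE X d) ∧
    ∀ X : ModuleCat.{u} Rᵐᵒᵖ, HasProjectiveDimensionLE X d

end Auslander

/-! ### Fréchet–Stein algebras -/

section FrechetStein

variable (K : Type w) [NontriviallyNormedField K] (A : Type u) [Ring A] [Algebra K A]

/-- A (nonarchimedean) algebra seminorm: `q(ab) ≤ c q(a) q(b)` for some constant `c > 0`. -/
structure AlgSeminorm extends Seminorm K A where
  nonarch : ∀ a b : A, toFun (a + b) ≤ max (toFun a) (toFun b)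
  exists_mul_le : ∃ c : ℝ, 0 < c ∧ ∀ a b : A, toFun (a * b) ≤ c * (toFun a * toFun b)

variable {K A}

/-- The ring `A`, with the topology and the uniform structure given by the seminorm `q`. -/
def AlgSeminorm.Source (_q : AlgSeminorm K A) : Type u := A

instance (q : AlgSeminorm K A) : Ring q.Source := inferInstanceAs (Ring A)

/-- The seminorm `q`, on `q.Source`. -/
def AlgSeminorm.sourceSeminorm (q : AlgSeminorm K A) : AddGroupSeminorm q.Source :=
  q.toSeminorm.toAddGroupSeminorm

instance (q : AlgSeminorm K A) : SeminormedAddCommGroup q.Source :=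
  q.sourceSeminorm.toSeminormedAddCommGroup

theorem AlgSeminorm.norm_def (q : AlgSeminorm K A) (a : q.Source) : ‖a‖ = q.toSeminorm a := rfl

theorem AlgSeminorm.continuous_mul_source (q : AlgSeminorm K A) :
    Continuous fun p : q.Source × q.Source => p.1 * p.2 := by
  obtain ⟨c, hc, h⟩ := q.exists_mul_le
  have h' : ∀ a b : q.Source, ‖a * b‖ ≤ c * (‖a‖ * ‖b‖) := h
  rw [continuous_iff_continuousAt]
  rintro ⟨a, b⟩
  rw [ContinuousAt, tendsto_iff_norm_sub_tendsto_zero]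
  have key : Filter.Tendsto
      (fun p : q.Source × q.Source => c * (‖p.1 - a‖ * ‖p.2‖) + c * (‖a‖ * ‖p.2 - b‖))
      (nhds (a, b)) (nhds (c * (‖a - a‖ * ‖b‖) + c * (‖a‖ * ‖b - b‖))) := by
    refine Continuous.tendsto (f := fun p : q.Source × q.Source =>
      c * (‖p.1 - a‖ * ‖p.2‖) + c * (‖a‖ * ‖p.2 - b‖)) ?_ (a, b)
    fun_prop
  have h0 : c * (‖a - a‖ * ‖b‖) + c * (‖a‖ * ‖b - b‖) = 0 := by simp
  rw [h0] at key
  refine squeeze_zero (fun _ => norm_nonneg _) (fun p => ?_) key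
  change ‖p.1 * p.2 - a * b‖ ≤ _
  have e : p.1 * p.2 - a * b = (p.1 - a) * p.2 + a * (p.2 - b) := by noncomm_ring
  rw [e]
  exact (norm_add_le _ _).trans (add_le_add (h' _ _) (h' _ _))

instance (q : AlgSeminorm K A) : IsTopologicalRing q.Source where
  continuous_mul := q.continuous_mul_source
  continuous_add := continuous_add
  continuous_neg := continuous_neg

/-- The Banach algebra `A_q`: the completion of `A / {q = 0}` with respect to `q`, i.e. the
Hausdorff completion of `A` for `q`. -/
abbrev AlgSeminorm.Compl (q : AlgSeminorm K A) : Type u := UniformSpace.Completion q.Source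

/-- The natural map `A → A_q`. -/
def AlgSeminorm.toCompl (q : AlgSeminorm K A) : A →+* q.Compl :=
  (UniformSpace.Completion.coeRingHom : q.Source →+* UniformSpace.Completion q.Source)

/-- The identity of `A`, as a ring homomorphism from `(A, q)` to `(A, q')`. -/
def AlgSeminorm.idHom (q q' : AlgSeminorm K A) : q.Source →+* q'.Source := RingHom.id A

theorem AlgSeminorm.continuous_idHom (q q' : AlgSeminorm K A)
    (h : ∀ a : A, q'.toSeminorm a ≤ q.toSeminorm a) :
    Continuous (AlgSeminorm.idHom q q') :=
  AddMonoidHomClass.continuous_of_bound (AlgSeminorm.idHom q q') 1 fun a => by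
    rw [one_mul]
    exact h a

/-- The transition map `A_q → A_{q'}` for `q' ≤ q`, extending the identity of `A`. -/
def AlgSeminorm.transition (q q' : AlgSeminorm K A)
    (h : ∀ a : A, q'.toSeminorm a ≤ q.toSeminorm a) : q.Compl →+* q'.Compl :=
  UniformSpace.Completion.mapRingHom (AlgSeminorm.idHom q q') (q.continuous_idHom q' h)

variable (K A) in
/-- An increasing sequence `q_0 ≤ q_1 ≤ ...` of algebra seminorms on `A`. -/
structure AlgSeminormSeq where
  q : ℕ → AlgSeminorm K A
  le_succ : ∀ (n : ℕ) (a : A), (q n).toSeminorm a ≤ (q (n + 1)).toSeminorm a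

namespace AlgSeminormSeq

variable (Q : AlgSeminormSeq K A)

/-- The Banach algebra `A_{q_n}`. -/
abbrev alg (n : ℕ) : Type u := (Q.q n).Compl

/-- The natural map `A → A_{q_n}`. -/
def ι (n : ℕ) : A →+* Q.alg n := (Q.q n).toCompl

/-- The transition map `A_{q_{n+1}} → A_{q_n}`. -/
def φ (n : ℕ) : Q.alg (n + 1) →+* Q.alg n := (Q.q (n + 1)).transition (Q.q n) (Q.le_succ n)

/-- A coherent sheaf for `(A, (q_n))`: finitely generated `A_{q_n}`-modules `M_n` together with
isomorphisms `A_{q_n} ⊗_{A_{q_{n+1}}} M_{n+1} ≅ M_n` of `A_{q_n}`-modules. -/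
structure CoherentSheaf where
  obj : ℕ → Type u
  [addCommGroup : ∀ n, AddCommGroup (obj n)]
  [module : ∀ n, Module (Q.alg n) (obj n)]
  [finite : ∀ n, Module.Finite (Q.alg n) (obj n)]
  iso : ∀ n, BaseChange (Q.φ n) (obj (n + 1)) ≃ₗ[Q.alg n] obj n

attribute [instance] CoherentSheaf.addCommGroup CoherentSheaf.module CoherentSheaf.finite

variable {Q}

/-- The transition map `M_{n+1} → M_n`, `m ↦ 1 ⊗ m`, of a coherent sheaf. -/
def CoherentSheaf.res (F : Q.CoherentSheaf) (n : ℕ) (m : F.obj (n + 1)) : F.obj n :=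
  F.iso n (BaseChange.tmul (Q.φ n) 1 m)

theorem φ_ι (n : ℕ) (a : A) : Q.φ n (Q.ι (n + 1) a) = Q.ι n a :=
  UniformSpace.Completion.mapRingHom_coe
    (AlgSeminorm.continuous_idHom (Q.q (n + 1)) (Q.q n) (Q.le_succ n)) a

theorem CoherentSheaf.res_smul (F : Q.CoherentSheaf) (n : ℕ) (a : A) (m : F.obj (n + 1)) :
    F.res n (Q.ι (n + 1) a • m) = Q.ι n a • F.res n m := by
  rw [res, res, BaseChange.tmul_smul, φ_ι, ← map_smul, BaseChange.smul_tmul, one_mul, mul_one]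

/-- The global sections `Γ(M_n) = lim M_n` of a coherent sheaf. -/
def CoherentSheaf.globalSections (F : Q.CoherentSheaf) : AddSubgroup (∀ n, F.obj n) where
  carrier := {x | ∀ n, F.res n (x (n + 1)) = x n}
  zero_mem' n := by
    simp [res, BaseChange.tmul_zero]
  add_mem' {x y} hx hy n := by
    have h1 := hx n
    have h2 := hy n
    simp only [res] at h1 h2
    simp only [res, Pi.add_apply, BaseChange.tmul_add, map_add, h1, h2]
  neg_mem' {x} hx n := by
    have h : F.res n (x (n + 1)) + F.res n ((-x) (n + 1)) = 0 := by
      simp only [res, ← map_add, ← BaseChange.tmul_add, Pi.neg_apply, add_neg_cancel,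
        BaseChange.tmul_zero, map_zero]
    rw [hx n] at h
    exact (neg_eq_of_add_eq_zero_right h).symm

/-- `A` acts on the global sections through the maps `A → A_{q_n}`. -/
instance (F : Q.CoherentSheaf) : Module A F.globalSections where
  smul a x := ⟨fun n => Q.ι n a • x.1 n, fun n => by rw [F.res_smul, x.2 n]⟩
  one_smul x := Subtype.ext <| funext fun n =>
    show Q.ι n 1 • x.1 n = x.1 n by rw [map_one, one_smul]
  mul_smul a b x := Subtype.ext <| funext fun n =>
    show Q.ι n (a * b) • x.1 n = Q.ι n a • Q.ι n b • x.1 n by rw [map_mul, mul_smul]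
  smul_zero a := Subtype.ext <| funext fun n => smul_zero (Q.ι n a)
  smul_add a x y := Subtype.ext <| funext fun n => smul_add (Q.ι n a) (x.1 n) (y.1 n)
  add_smul a b x := Subtype.ext <| funext fun n =>
    show Q.ι n (a + b) • x.1 n = Q.ι n a • x.1 n + Q.ι n b • x.1 n by rw [map_add, add_smul]
  zero_smul x := Subtype.ext <| funext fun n =>
    show Q.ι n 0 • x.1 n = 0 by rw [map_zero, zero_smul]

variable (Q)

/-- A left `A`-module is coadmissible if it is isomorphic to the module of global sections of a
coherent sheaf for `(A, (q_n))`. -/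
def IsCoadmissible (M : Type u) [AddCommGroup M] [Module A M] : Prop :=
  ∃ F : Q.CoherentSheaf, Nonempty (M ≃ₗ[A] F.globalSections)

/-- The step `Δ^l(M)` of the dimension filtration of an `A`-module `M`: the
submodule of all `m` such that `1 ⊗ m` lies in `Δ^l(A_{q_n} ⊗_A M)` for every `n`. -/
def dimFil (M : Type u) [AddCommGroup M] [Module A M] (l : ℕ) : Submodule A M where
  carrier := {m | ∀ n, BaseChange.tmul (Q.ι n) 1 m ∈
    dimFiltration (Q.alg n) (BaseChange (Q.ι n) M) l}
  zero_mem' n := by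
    rw [BaseChange.tmul_zero]
    exact zero_mem _
  add_mem' hx hy n := by
    rw [BaseChange.tmul_add]
    exact add_mem (hx n) (hy n)
  smul_mem' a x hx n := by
    rw [BaseChange.tmul_smul, one_mul, ← mul_one (Q.ι n a), ← BaseChange.smul_tmul]
    exact Submodule.smul_mem _ _ (hx n)

/-- `(q_n)` exhibits the topological algebra `A` as a two-sided `K`-Fréchet–Stein algebra:
`A` is Hausdorff and complete, its topology is defined by the `q_n`, each `A_{q_n}` is left and
right noetherian, and flat as a left and as a right `A_{q_{n+1}}`-module. -/
structure IsTwoSidedFrechetStein [UniformSpace A] : Prop where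
  t2 : T2Space A
  complete : CompleteSpace A
  withSeminorms : WithSeminorms (fun n => (Q.q n).toSeminorm)
  noetherian_left : ∀ n, IsNoetherianRing (Q.alg n)
  noetherian_right : ∀ n, IsNoetherianRing (Q.alg n)ᵐᵒᵖ
  flat_left : ∀ n, FlatAsLeftModule (Q.φ n)
  flat_right : ∀ n, FlatAsRightModule (Q.φ n)

end AlgSeminormSeq

end FrechetStein

end

/-! The theorem is proved over each noetherian Banach algebra `R n = A_{q_n}` and then glued along
the tower.

Over a single Auslander regular ring `R`, resolve a finite module `N` by finite projectives,
dualise, and let `C k` be the cokernel of the `k`-th dual differential. The modules `Ext^{k+1}(C k,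
R)` form a decreasing chain of submodules of `N`. The quotient of `N` by the first one embeds into
the bidual, and later successive quotients embed into `Ext^k(Ext^k(N, R), R)`
(`FinRes.exists_zero_step`, `FinRes.exists_succ_step`). This is an elementary form of the biduality
spectral sequence. By the Auslander condition the term `Ext^{k+1}(C k, R)` has grade at least `k +
1`, and it is zero once `k` reaches the global dimension. Hence grade bounds pass to submodules
(`gradeGE_of_injective`). Moreover, in finite global dimension, `N` has no nonzero submodule of
grade at least `l` exactly when `Ext^i(Ext^i(N, R), R) = 0` for all `i ≥ l`
(`subsingleton_of_extExt`, `extExt_subsingleton`). The latter condition is stable under flat base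
change, and therefore so is `Δ^l` (`range_baseChange_dimFiltration`).

Along the tower, a Mittag-Leffler argument yields Theorems A and B from completeness and dense
transition maps (`theoremsAB_of_denseRange`). Together with flatness and noetherianity of the tower
they show that each `R n` is flat over `A`, that a coherent sheaf is recovered from its global
sections, and that coherent subsheaves have coadmissible sections and quotients. So the `Δ^l(R n ⊗
M)` glue to a coadmissible `Δ^l(M)`.

For `Ext`, use `0 → A → ∏ R n → ∏ R n → 0`, whose second map is identity minus shift. Theorem B for
right modules makes the induced map on `∏ Ext^l_A(M, R n)` surjective, so `Ext^l_A(M, A)` is the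
limit of the `Ext^l_{R n}(R n ⊗ M, R n)` and is again coadmissible (`extDual_isLimit`). Grade bounds
and vanishing of double `Ext` can then be tested at every level `n`, and (i)-(iv) follow from the
noetherian case.

Since right modules are modules over the opposite ring, double `Ext` lives over the double opposite.
The properties of the tower are therefore needed for `R n`, its opposite and its double opposite. -/

noncomputable section

/-! ### `Ext` groups of modules -/

section ExtM

variable (R : Type u) [Ring R]

/-- The group `Ext^l_R(N, B)`. -/
abbrev ExtM (N B : Type u) [AddCommGroup N] [Module R N] [AddCommGroup B] [Module R B] (l : ℕ) :
    Type u :=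
  Abelian.Ext.{u} (ModuleCat.of R N) (ModuleCat.of R B) l

variable {R}
variable {N N' N'' : Type u} [AddCommGroup N] [Module R N] [AddCommGroup N'] [Module R N']
  [AddCommGroup N''] [Module R N'']
variable {B B' B'' : Type u} [AddCommGroup B] [Module R B] [AddCommGroup B'] [Module R B']
  [AddCommGroup B''] [Module R B'']

namespace ExtM

/-- Functoriality of `Ext` in the first variable. -/
def pre (B : Type u) [AddCommGroup B] [Module R B] (l : ℕ) (f : N →ₗ[R] N') :
    ExtM R N' B l →+ ExtM R N B l where
  toFun x := (Ext.mk₀ (ModuleCat.ofHom f)).comp x (zero_add l)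
  map_zero' := by simp
  map_add' := by simp

/-- Functoriality of `Ext` in the second variable. -/
def post (N : Type u) [AddCommGroup N] [Module R N] (l : ℕ) (g : B →ₗ[R] B') :
    ExtM R N B l →+ ExtM R N B' l where
  toFun x := x.comp (Ext.mk₀ (ModuleCat.ofHom g)) (add_zero l)
  map_zero' := by simp
  map_add' := by simp

theorem post_pre (l : ℕ) (f : N →ₗ[R] N') (g : B →ₗ[R] B') (x : ExtM R N' B l) :
    post N l g (pre B l f x) = pre B' l f (post N' l g x) := by
  simp [pre, post]

theorem pre_comp (l : ℕ) (f : N →ₗ[R] N') (g : N' →ₗ[R] N'') (x : ExtM R N'' B l) :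
    pre B l (g ∘ₗ f) x = pre B l f (pre B l g x) := by
  simp [pre, ModuleCat.ofHom_comp]

theorem pre_id (l : ℕ) (x : ExtM R N B l) : pre B l LinearMap.id x = x := by
  simp [pre]

theorem pre_zero (l : ℕ) (x : ExtM R N' B l) : pre B l (0 : N →ₗ[R] N') x = 0 := by
  have : ModuleCat.ofHom (0 : N →ₗ[R] N') = 0 := rfl
  simp [pre, this]

theorem post_comp (l : ℕ) (f : B →ₗ[R] B') (g : B' →ₗ[R] B'') (x : ExtM R N B l) :
    post N l (g ∘ₗ f) x = post N l g (post N l f x) := by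
  simp [post, ModuleCat.ofHom_comp, ← Ext.mk₀_comp_mk₀]

theorem post_id (l : ℕ) (x : ExtM R N B l) : post N l LinearMap.id x = x := by
  simp [post]

theorem post_zero (l : ℕ) (x : ExtM R N B l) : post N l (0 : B →ₗ[R] B') x = 0 := by
  have : ModuleCat.ofHom (0 : B →ₗ[R] B') = 0 := rfl
  simp [post, this]

theorem post_add (l : ℕ) (f g : B →ₗ[R] B') (x : ExtM R N B l) :
    post N l (f + g) x = post N l f x + post N l g x := by
  have : ModuleCat.ofHom (f + g) = ModuleCat.ofHom f + ModuleCat.ofHom g := rfl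
  simp only [post, AddMonoidHom.coe_mk, ZeroHom.coe_mk, this, Ext.mk₀_add, Ext.comp_add]

/-- `Ext` in degree zero is `Hom`. -/
def homEquiv : ExtM R N B 0 ≃+ (N →ₗ[R] B) :=
  Ext.addEquiv₀.trans ModuleCat.homAddEquiv

theorem mk₀_homEquiv (x : ExtM R N B 0) : Ext.mk₀ (ModuleCat.ofHom (homEquiv x)) = x := by
  change Ext.mk₀ (Ext.addEquiv₀ x) = x
  simp

theorem homEquiv_mk₀ (f : ModuleCat.of R N ⟶ ModuleCat.of R B) :
    homEquiv (Ext.mk₀ f) = f.hom := by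
  apply homEquiv.symm.injective
  rw [AddEquiv.symm_apply_apply]
  rfl

theorem homEquiv_pre (f : N →ₗ[R] N') (x : ExtM R N' B 0) :
    homEquiv (pre B 0 f x) = homEquiv x ∘ₗ f := by
  conv_lhs => rw [← mk₀_homEquiv x]
  simp [pre, homEquiv_mk₀]

theorem homEquiv_post (g : B →ₗ[R] B') (x : ExtM R N B 0) :
    homEquiv (post N 0 g x) = g ∘ₗ homEquiv x := by
  conv_lhs => rw [← mk₀_homEquiv x]
  simp [post, homEquiv_mk₀]

theorem subsingleton_of_projective [Module.Projective R N] (l : ℕ) :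
    Subsingleton (ExtM R N B (l + 1)) :=
  haveI : Projective (ModuleCat.of R N) := by
    rw [IsProjective.iff_projective] at *; assumption
  Ext.subsingleton_of_projective _ _ _

theorem subsingleton_of_projectiveDimensionLE {m : ℕ}
    (h : HasProjectiveDimensionLE (ModuleCat.of R N) m) {l : ℕ} (hl : m < l) :
    Subsingleton (ExtM R N B l) := by
  have : HasProjectiveDimensionLT (ModuleCat.of R N) (m + 1) := h
  exact HasProjectiveDimensionLT.subsingleton _ (m + 1) _ hl _

section LES

variable {f : N →ₗ[R] N'} {g : N' →ₗ[R] N''} (hf : Function.Injective f)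
  (hg : Function.Surjective g) (hfg : Function.Exact f g)

/-- The short complex attached to an exact pair of linear maps. -/
abbrev shortComplex (hfg : Function.Exact f g) : ShortComplex (ModuleCat.{u} R) :=
  ShortComplex.mk (ModuleCat.ofHom f) (ModuleCat.ofHom g) (by
    ext x; exact hfg.apply_apply_eq_zero x)

include hf hg hfg in
theorem shortExact : (shortComplex hfg).ShortExact :=
  ModuleCat.shortComplex_shortExact _ hfg hf hg

/-- The connecting homomorphism of the contravariant long exact sequence. -/
def δ (B : Type u) [AddCommGroup B] [Module R B] (l : ℕ) : ExtM R N B l →+ ExtM R N'' B (l + 1) where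
  toFun x := (shortExact hf hg hfg).extClass.comp x (add_comm 1 l)
  map_zero' := by simp
  map_add' := by simp

include hf hg hfg in
theorem exact_pre_pre (l : ℕ) : Function.Exact (pre B l g) (pre B l f) := by
  intro x
  constructor
  · exact Ext.contravariant_sequence_exact₂ (shortExact hf hg hfg) _ x
  · rintro ⟨y, rfl⟩
    rw [← pre_comp, hfg.linearMap_comp_eq_zero, pre_zero]

theorem exact_pre_δ (l : ℕ) : Function.Exact (pre B l f) (δ hf hg hfg B l) := by
  intro x
  constructor
  · exact Ext.contravariant_sequence_exact₁ (shortExact hf hg hfg) _ x (add_comm 1 l)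
  · rintro ⟨y, rfl⟩
    exact (shortExact hf hg hfg).extClass_comp_assoc y (h := add_comm 1 l)

theorem exact_δ_pre (l : ℕ) : Function.Exact (δ hf hg hfg B l) (pre B (l + 1) g) := by
  intro x
  constructor
  · intro hx
    exact Ext.contravariant_sequence_exact₃ (shortExact hf hg hfg) _ x hx (add_comm 1 l)
  · rintro ⟨y, rfl⟩
    exact (shortExact hf hg hfg).comp_extClass_assoc y (add_comm 1 l)

theorem pre_injective_of_surjective (hg : Function.Surjective g) :
    Function.Injective (pre B 0 g) := by
  intro x y hxy
  apply homEquiv.injective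
  have := congrArg homEquiv hxy
  rw [homEquiv_pre, homEquiv_pre] at this
  exact LinearMap.cancel_right hg |>.1 this

theorem δ_post (l : ℕ) (b : B →ₗ[R] B') (x : ExtM R N B l) :
    δ hf hg hfg B' l (post N l b x) = post N'' (l + 1) b (δ hf hg hfg B l x) := by
  simp only [δ, post, AddMonoidHom.coe_mk, ZeroHom.coe_mk]
  rw [Ext.comp_assoc_of_third_deg_zero]

end LES

section CovLES

variable {f : B →ₗ[R] B'} {g : B' →ₗ[R] B''} (hf : Function.Injective f)
  (hg : Function.Surjective g) (hfg : Function.Exact f g)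

/-- The connecting homomorphism of the covariant long exact sequence. -/
def δ' (N : Type u) [AddCommGroup N] [Module R N] (l : ℕ) :
    ExtM R N B'' l →+ ExtM R N B (l + 1) where
  toFun x := x.comp (shortExact hf hg hfg).extClass rfl
  map_zero' := by simp
  map_add' := by simp

include hf hg hfg in
theorem exact_post_post (l : ℕ) : Function.Exact (post N l f) (post N l g) := by
  intro x
  constructor
  · exact Ext.covariant_sequence_exact₂ _ (shortExact hf hg hfg) x
  · rintro ⟨y, rfl⟩
    rw [← post_comp, hfg.linearMap_comp_eq_zero, post_zero]

theorem exact_post_δ' (l : ℕ) : Function.Exact (post N l g) (δ' hf hg hfg N l) := by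
  intro x
  constructor
  · exact fun hx => Ext.covariant_sequence_exact₃ _ (shortExact hf hg hfg) x rfl hx
  · rintro ⟨y, rfl⟩
    simp only [δ', post, AddMonoidHom.coe_mk, ZeroHom.coe_mk]
    rw [Ext.comp_assoc _ _ _ (add_zero l) (zero_add 1) (by omega)]
    erw [(shortExact hf hg hfg).comp_extClass]
    simp

theorem exact_δ'_post (l : ℕ) : Function.Exact (δ' hf hg hfg N l) (post N (l + 1) f) := by
  intro x
  constructor
  · exact fun hx => Ext.covariant_sequence_exact₁ _ (shortExact hf hg hfg) x hx rfl
  · rintro ⟨y, rfl⟩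
    simp only [δ', post, AddMonoidHom.coe_mk, ZeroHom.coe_mk]
    rw [Ext.comp_assoc _ _ _ rfl (add_zero 1) (by omega)]
    erw [(shortExact hf hg hfg).extClass_comp]
    simp

theorem post_injective_of_injective (hf : Function.Injective f) :
    Function.Injective (post N 0 f) := by
  intro x y hxy
  apply homEquiv.injective
  have := congrArg homEquiv hxy
  rw [homEquiv_post, homEquiv_post] at this
  exact LinearMap.cancel_left hf |>.1 this

end CovLES

end ExtM

end ExtM

/-! ### The functors `Ext^l_R(-, R)` -/

section ExtDual

variable {R : Type u} [Ring R]
variable {N N' N'' : Type u} [AddCommGroup N] [Module R N] [AddCommGroup N'] [Module R N']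
  [AddCommGroup N''] [Module R N'']

namespace ExtDual

/-- Contravariant functoriality of `Ext^l_R(-, R)`. -/
def pre (l : ℕ) (f : N →ₗ[R] N') : ExtDual R N' l →ₗ[Rᵐᵒᵖ] ExtDual R N l where
  toFun := ExtM.pre R l f
  map_add' := map_add _
  map_smul' r x := (ExtM.post_pre (B' := R) l f (LinearMap.toSpanSingleton R R r.unop) x).symm

theorem pre_comp (l : ℕ) (f : N →ₗ[R] N') (g : N' →ₗ[R] N'') (x : ExtDual R N'' l) :
    pre l (g ∘ₗ f) x = pre l f (pre l g x) := ExtM.pre_comp l f g x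

theorem pre_id (l : ℕ) (x : ExtDual R N l) : pre l LinearMap.id x = x := ExtM.pre_id l x

theorem pre_zero (l : ℕ) (x : ExtDual R N' l) : pre l (0 : N →ₗ[R] N') x = 0 := ExtM.pre_zero l x

/-- `Ext^l_R(-, R)` of an isomorphism. -/
def congr (l : ℕ) (e : N ≃ₗ[R] N') : ExtDual R N' l ≃ₗ[Rᵐᵒᵖ] ExtDual R N l :=
  LinearEquiv.ofLinearMap (pre l e.toLinearMap) (pre l e.symm.toLinearMap)
    (by ext x; simp [← pre_comp, pre_id]) (by ext x; simp [← pre_comp, pre_id])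

/-- `Ext^0_R(N, R)` is the dual of `N`. -/
def homEquiv : ExtDual R N 0 ≃+ (N →ₗ[R] R) := ExtM.homEquiv

theorem homEquiv_pre (f : N →ₗ[R] N') (x : ExtDual R N' 0) :
    homEquiv (pre 0 f x) = homEquiv x ∘ₗ f := ExtM.homEquiv_pre f x

theorem homEquiv_smul (r : Rᵐᵒᵖ) (x : ExtDual R N 0) (n : N) :
    homEquiv (r • x) n = homEquiv x n * r.unop :=
  LinearMap.congr_fun (ExtM.homEquiv_post (LinearMap.toSpanSingleton R R r.unop) x) n

theorem subsingleton_of_projective [Module.Projective R N] (l : ℕ) :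
    Subsingleton (ExtDual R N (l + 1)) := ExtM.subsingleton_of_projective l

section LES

variable {f : N →ₗ[R] N'} {g : N' →ₗ[R] N''} (hf : Function.Injective f)
  (hg : Function.Surjective g) (hfg : Function.Exact f g)

/-- The connecting homomorphism of the long exact sequence of `Ext^l_R(-, R)`. -/
def δ (l : ℕ) : ExtDual R N l →ₗ[Rᵐᵒᵖ] ExtDual R N'' (l + 1) where
  toFun := ExtM.δ hf hg hfg R l
  map_add' := map_add _
  map_smul' r x :=
    ExtM.δ_post (B' := R) hf hg hfg l (LinearMap.toSpanSingleton R R r.unop) x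

include hf hg hfg in
theorem exact_pre_pre (l : ℕ) :
    Function.Exact (pre l g : ExtDual R N'' l →ₗ[Rᵐᵒᵖ] _) (pre l f) :=
  ExtM.exact_pre_pre hf hg hfg l

theorem exact_pre_δ (l : ℕ) : Function.Exact (pre l f) (δ hf hg hfg l) :=
  ExtM.exact_pre_δ hf hg hfg l

theorem exact_δ_pre (l : ℕ) : Function.Exact (δ hf hg hfg l) (pre (l + 1) g) :=
  ExtM.exact_δ_pre hf hg hfg l

theorem pre_injective_of_surjective (hg : Function.Surjective g) :
    Function.Injective (pre 0 g) := ExtM.pre_injective_of_surjective hg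

end LES

end ExtDual

end ExtDual

/-! ### Extension of scalars -/

namespace BaseChange

section

variable {R S : Type u} [Ring R] [Ring S] (φ : R →+* S)
variable {N N' N'' : Type u} [AddCommGroup N] [Module R N] [AddCommGroup N'] [Module R N']
  [AddCommGroup N''] [Module R N'']
variable {X : Type*} [AddCommGroup X] [Module S X]

/-- The universal semilinear map `n ↦ 1 ⊗ n`. -/
def mk (N : Type u) [AddCommGroup N] [Module R N] : N →ₛₗ[φ] BaseChange φ N where
  toFun n := tmul φ 1 n
  map_add' := tmul_add φ 1
  map_smul' r n := by rw [tmul_smul, one_mul, smul_tmul, mul_one]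

theorem mk_apply (n : N) : mk φ N n = tmul φ 1 n := rfl

theorem smul_mk (s : S) (n : N) : s • mk φ N n = tmul φ s n := by
  rw [mk_apply, smul_tmul, mul_one]

theorem zero_tmul (n : N) : tmul φ 0 n = 0 := by
  simp only [← smul_mk, zero_smul]

theorem map_mk (f : N →ₗ[R] N') (n : N) : map φ f (mk φ N n) = mk φ N' (f n) := rfl

@[elab_as_elim]
theorem induction {p : BaseChange φ N → Prop} (tmul : ∀ s n, p (tmul φ s n))
    (add : ∀ x y, p x → p y → p (x + y)) (x : BaseChange φ N) : p x := by
  obtain ⟨t, rfl⟩ := Submodule.Quotient.mk_surjective _ x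
  induction t using TensorProduct.induction_on with
  | zero =>
    have := tmul 0 0
    rwa [zero_tmul] at this
  | tmul s n => exact tmul s n
  | add a b ha hb => exact add _ _ ha hb

theorem exists_sum (x : BaseChange φ N) :
    ∃ (k : ℕ) (s : Fin k → S) (n : Fin k → N), x = ∑ i, tmul φ (s i) (n i) := by
  induction x using induction with
  | tmul s n => exact ⟨1, fun _ => s, fun _ => n, by simp⟩
  | add x y hx hy =>
    obtain ⟨k, s, n, rfl⟩ := hx
    obtain ⟨l, t, m, rfl⟩ := hy
    exact ⟨k + l, Fin.append s t, Fin.append n m, by simp [Fin.sum_univ_add]⟩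

theorem span_range_mk : Submodule.span S (Set.range (mk φ N)) = ⊤ := by
  rw [eq_top_iff]
  rintro x -
  induction x using induction with
  | tmul s n =>
    rw [← smul_mk]
    exact Submodule.smul_mem _ _ (Submodule.subset_span ⟨n, rfl⟩)
  | add x y hx hy => exact add_mem hx hy

variable {φ} in
theorem hom_ext {f g : BaseChange φ N →ₗ[S] X} (h : ∀ n, f (mk φ N n) = g (mk φ N n)) : f = g := by
  ext x
  induction x using induction with
  | tmul s n => rw [← smul_mk, map_smul, map_smul, h]
  | add x y hx hy => rw [map_add, map_add, hx, hy]

variable {φ} in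
/-- The linear map `S ⊗_R N → X` attached to a semilinear map `N → X`. -/
def lift (f : N →ₛₗ[φ] X) : BaseChange φ N →ₗ[S] X :=
  Submodule.liftQ (baseChangeRel φ N)
    (TensorProduct.AlgebraTensorModule.lift
      (LinearMap.toSpanSingleton S (N →ₗ[ℤ] X) f.toAddMonoidHom.toIntLinearMap))
    (by
      refine Submodule.span_le.2 ?_
      rintro _ ⟨s, r, n, rfl⟩
      simp [mul_smul])

variable {φ} in
theorem lift_tmul (f : N →ₛₗ[φ] X) (s : S) (n : N) : lift f (tmul φ s n) = s • f n := rfl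

variable {φ} in
theorem lift_mk (f : N →ₛₗ[φ] X) (n : N) : lift f (mk φ N n) = f n := by
  rw [mk_apply, lift_tmul, one_smul]

variable {φ} in
theorem range_lift (f : N →ₛₗ[φ] X) :
    LinearMap.range (lift f) = Submodule.span S (Set.range f) := by
  rw [LinearMap.range_eq_map, ← span_range_mk, Submodule.map_span, ← Set.range_comp]
  congr 2
  ext n
  exact lift_mk f n

theorem map_comp (f : N →ₗ[R] N') (g : N' →ₗ[R] N'') (x : BaseChange φ N) :
    map φ (g ∘ₗ f) x = map φ g (map φ f x) := by
  have : map φ (g ∘ₗ f) = (map φ g).comp (map φ f) := hom_ext fun n => rfl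
  exact LinearMap.congr_fun this x

theorem map_id (x : BaseChange φ N) : map φ LinearMap.id x = x := by
  have : map φ LinearMap.id = (LinearMap.id : BaseChange φ N →ₗ[S] _) := hom_ext fun n => rfl
  exact LinearMap.congr_fun this x

theorem map_zero (x : BaseChange φ N) : map φ (0 : N →ₗ[R] N') x = 0 := by
  have : map φ (0 : N →ₗ[R] N') = 0 := hom_ext fun n => by
    rw [map_mk, LinearMap.zero_apply, LinearMap.zero_apply, _root_.map_zero]
  rw [this, LinearMap.zero_apply]

/-- Extension of scalars of an isomorphism. -/
def congr (e : N ≃ₗ[R] N') : BaseChange φ N ≃ₗ[S] BaseChange φ N' :=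
  LinearEquiv.ofLinearMap (map φ e.toLinearMap) (map φ e.symm.toLinearMap)
    (by ext x; simp [← map_comp, map_id]) (by ext x; simp [← map_comp, map_id])

instance [Subsingleton N] : Subsingleton (BaseChange φ N) := by
  refine ⟨fun x y => ?_⟩
  have : LinearMap.id = (0 : N →ₗ[R] N) := Subsingleton.elim _ _
  rw [← map_id φ x, ← map_id φ y, this, map_zero, map_zero]

theorem map_surjective {g : N →ₗ[R] N'} (hg : Function.Surjective g) :
    Function.Surjective (map φ g) := by
  intro y
  induction y using induction with
  | tmul s n =>
    obtain ⟨m, rfl⟩ := hg n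
    exact ⟨tmul φ s m, map_tmul φ g s m⟩
  | add x y hx hy =>
    obtain ⟨a, rfl⟩ := hx
    obtain ⟨b, rfl⟩ := hy
    exact ⟨a + b, map_add _ _ _⟩

/-- Extension of scalars is right exact. -/
theorem map_exact {f : N →ₗ[R] N'} {g : N' →ₗ[R] N''} (hfg : Function.Exact f g)
    (hg : Function.Surjective g) : Function.Exact (map φ f) (map φ g) := by
  intro x
  constructor
  · intro hx
    let q := (LinearMap.range (map φ f)).mkQ
    have key : ∀ a b : N', g a = g b → q (mk φ N' a) = q (mk φ N' b) := by
      intro a b hab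
      have h0 : g (a - b) = 0 := by rw [map_sub, hab, sub_self]
      obtain ⟨c, hc⟩ := (hfg _).1 h0
      rw [← sub_eq_zero, ← map_sub, ← map_sub, ← hc, ← map_mk]
      exact (Submodule.Quotient.mk_eq_zero _).2 ⟨_, rfl⟩
    -- By `key`, choosing preimages under `g` is additive and semilinear modulo the image of `map φ
    -- f`. Lifting `s` factors the projection `q` through `map φ g`, which bounds the kernel of `map
    -- φ g`.
    let s : N'' →ₛₗ[φ] (BaseChange φ N' ⧸ LinearMap.range (map φ f)) :=
      { toFun := fun n => q (mk φ N' (Function.surjInv hg n))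
        map_add' := fun a b => by
          rw [← map_add, ← map_add]
          apply key
          simp [Function.surjInv_eq hg]
        map_smul' := fun r a => by
          rw [← map_smul, ← (mk φ N').map_smulₛₗ]
          apply key
          simp [Function.surjInv_eq hg] }
    have hs : (lift s).comp (map φ g) = q := hom_ext fun n => by
      rw [LinearMap.comp_apply, map_mk, lift_mk]
      exact key _ _ (Function.surjInv_eq hg _)
    have : q x = 0 := by rw [← hs, LinearMap.comp_apply, hx, _root_.map_zero]
    exact (Submodule.Quotient.mk_eq_zero _).1 this
  · rintro ⟨y, rfl⟩
    rw [← map_comp, hfg.linearMap_comp_eq_zero, map_zero]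

theorem _root_.FlatAsRightModule.map_injective {φ : R →+* S} (hφ : FlatAsRightModule φ)
    {f : N →ₗ[R] N'} (hf : Function.Injective f) : Function.Injective (map φ f) :=
  hφ N N' f hf

/-- Extension of scalars along a flat ring homomorphism is exact. -/
theorem map_exact_of_flat (hφ : FlatAsRightModule φ) {f : N →ₗ[R] N'} {g : N' →ₗ[R] N''}
    (hfg : Function.Exact f g) : Function.Exact (map φ f) (map φ g) := by
  intro x
  constructor
  · intro hx
    -- Factor `g` through its range: flatness handles the inclusion of the range, right exactness
    -- the surjection onto it.
    have h1 : map φ (LinearMap.range g).subtype (map φ g.rangeRestrict x) = 0 := by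
      rw [← map_comp]
      exact hx
    have h2 : map φ g.rangeRestrict x = 0 :=
      hφ _ _ _ (LinearMap.range g).injective_subtype (h1.trans (_root_.map_zero _).symm)
    refine (map_exact φ ?_ g.surjective_rangeRestrict x).1 h2
    intro y
    rw [← hfg y, ← Subtype.coe_inj]
    rfl
  · rintro ⟨y, rfl⟩
    rw [← map_comp, hfg.linearMap_comp_eq_zero, map_zero]

instance [Module.Finite R N] : Module.Finite S (BaseChange φ N) := by
  obtain ⟨t, ht⟩ := (inferInstance : Module.Finite R N).fg_top
  classical
  refine ⟨⟨t.image (mk φ N), ?_⟩⟩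
  rw [eq_top_iff, ← span_range_mk, Submodule.span_le]
  rintro _ ⟨n, rfl⟩
  have hn : n ∈ Submodule.span R (t : Set N) := by rw [ht]; trivial
  rw [SetLike.mem_coe]
  induction hn using Submodule.span_induction with
  | mem x hx => exact Submodule.subset_span (by simpa using ⟨x, hx, rfl⟩)
  | zero => rw [_root_.map_zero]; exact zero_mem _
  | add x y _ _ hx hy => rw [map_add]; exact add_mem hx hy
  | smul r x _ hx => rw [(mk φ N).map_smulₛₗ]; exact Submodule.smul_mem _ _ hx

/-- A splitting `N → (N →₀ R)` of the free cover extends coefficientwise to `S`, so the base change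
is a direct summand of `N →₀ S`. -/
instance projective [Module.Projective R N] : Module.Projective S (BaseChange φ N) := by
  obtain ⟨s, hs⟩ := (Module.projective_def' (R := R) (P := N)).1 inferInstance
  let b : N →ₛₗ[φ] (N →₀ S) :=
    { toFun := fun n => (s n).mapRange φ (_root_.map_zero φ)
      map_add' := fun x y => by ext; simp
      map_smul' := fun r x => by ext; simp }
  refine Module.Projective.of_split (M := N →₀ S) (lift b)
    (Finsupp.linearCombination S (mk φ N)) ?_
  refine hom_ext fun n => ?_
  rw [LinearMap.comp_apply, lift_mk, LinearMap.id_apply]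
  conv_rhs => rw [← LinearMap.id_apply (R := R) n, ← hs]
  simp only [b, LinearMap.coe_mk, AddHom.coe_mk, LinearMap.comp_apply,
    Finsupp.linearCombination_apply]
  rw [Finsupp.sum_mapRange_index (by simp), Finsupp.sum, Finsupp.sum, map_sum]
  simp

end

section Transfer

variable {R S : Type u} [Ring R] [Ring S] {φ : R →+* S}
variable {N N₁ : Type u} [AddCommGroup N] [Module R N] [AddCommGroup N₁] [Module R N₁]
variable {X X₁ : Type*} [AddCommGroup X] [Module S X] [AddCommGroup X₁] [Module S X₁]

/-- Bijectivity of `lift` is invariant under isomorphism. -/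
theorem lift_bijective_congr {f : N →ₛₗ[φ] X} {f₁ : N₁ →ₛₗ[φ] X₁} (e : N ≃ₗ[R] N₁) (e' : X ≃ₗ[S] X₁)
    (h : ∀ n, f₁ (e n) = e' (f n)) (hf : Function.Bijective (lift f)) :
    Function.Bijective (lift f₁) := by
  have : lift f₁ = (e'.toLinearMap.comp (lift f)).comp (congr φ e).symm.toLinearMap := by
    refine hom_ext fun n => ?_
    obtain ⟨m, rfl⟩ := e.surjective n
    have : (congr φ e).symm (mk φ N₁ (e m)) = mk φ N m := by
      rw [LinearEquiv.symm_apply_eq]; rfl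
    simp [lift_mk, h, this]
  rw [this]
  exact (e'.bijective.comp hf).comp (congr φ e).symm.bijective

end Transfer

section OpOp

variable {R S : Type u} [Ring R] [Ring S] (φ : R →+* S)

/-- Right flatness of `φ` passes to `φ.op.op`. -/
theorem flat_op_op (hφ : FlatAsRightModule φ) :
    FlatAsRightModule (RingHom.op (RingHom.op φ)) := by
  intro N N' _ _ _ _ f hf
  -- Modules over the double opposite are viewed as modules over the original ring, so that flatness
  -- of `φ` itself applies.
  let : Module R N := Module.compHom N (RingEquiv.opOp R).toRingHom
  let : Module R N' := Module.compHom N' (RingEquiv.opOp R).toRingHom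
  let m : Module S (BaseChange (RingHom.op (RingHom.op φ)) N) :=
    Module.compHom _ (RingEquiv.opOp S).toRingHom
  let m' (Y : Type u) [AddCommGroup Y] [Module R Y] : Module Sᵐᵒᵖᵐᵒᵖ (BaseChange φ Y) :=
    Module.compHom _ (RingEquiv.opOp S).symm.toRingHom
  let f₀ : N →ₗ[R] N' := { toFun := f, map_add' := map_add f, map_smul' := fun r x => f.map_smul _ x }
  let a : N →ₛₗ[RingHom.op (RingHom.op φ)] BaseChange φ N :=
    { toFun := mk φ N, map_add' := map_add _, map_smul' := fun r x => (mk φ N).map_smulₛₗ _ x }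
  let a' : N' →ₛₗ[RingHom.op (RingHom.op φ)] BaseChange φ N' :=
    { toFun := mk φ N', map_add' := map_add _, map_smul' := fun r x => (mk φ N').map_smulₛₗ _ x }
  let b : N →ₛₗ[φ] BaseChange (RingHom.op (RingHom.op φ)) N :=
    { toFun := mk _ N, map_add' := map_add _
      map_smul' := fun r x => (mk (RingHom.op (RingHom.op φ)) N).map_smulₛₗ _ x }
  have hb : ∀ x, lift b (lift a x) = x := by
    intro x
    induction x using induction with
    | tmul s n =>
      rw [lift_tmul, ← smul_mk]
      change lift b (s.unop.unop • mk φ N n) = _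
      rw [map_smul, lift_mk]
      rfl
    | add x y hx hy => rw [map_add, map_add, hx, hy]
  have hc : ∀ x, lift a' (map _ f x) = map φ f₀ (lift a x) := by
    intro x
    induction x using induction with
    | tmul s n =>
      rw [map_tmul, lift_tmul, lift_tmul]
      exact ((map φ f₀).map_smul s.unop.unop (mk φ N n)).symm
    | add x y hx hy => simp only [map_add, hx, hy]
  intro x y hxy
  have := congrArg (lift a') hxy
  rw [hc, hc] at this
  rw [← hb x, ← hb y, hφ _ _ f₀ hf this]

end OpOp

section Trans

variable {A R S : Type u} [Ring A] [Ring R] [Ring S] {φ : R →+* S} {ι' : A →+* R} {ι : A →+* S}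
  (h : ∀ a, φ (ι' a) = ι a) (M : Type u) [AddCommGroup M] [Module A M]

/-- The semilinear transition map `R ⊗_A M → S ⊗_A M`. -/
def trans : BaseChange ι' M →ₛₗ[φ] BaseChange ι M :=
  letI : Module R (BaseChange ι M) := Module.compHom _ φ
  let g : M →ₛₗ[ι'] BaseChange ι M :=
    { toFun := mk ι M, map_add' := map_add _
      map_smul' := fun a m => by
        rw [(mk ι M).map_smulₛₗ, ← h]; rfl }
  { toFun := lift g
    map_add' := map_add _
    map_smul' := fun r x => (lift g).map_smul r x }

theorem trans_tmul (r : R) (m : M) : trans h M (tmul ι' r m) = tmul ι (φ r) m := by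
  rw [← smul_mk ι]
  rfl

theorem trans_mk (m : M) : trans h M (mk ι' M m) = mk ι M m := by
  rw [mk_apply, trans_tmul, map_one, mk_apply]

theorem trans_map {M' : Type u} [AddCommGroup M'] [Module A M'] (f : M →ₗ[A] M')
    (x : BaseChange ι' M) : trans h M' (map ι' f x) = map ι f (trans h M x) := by
  induction x using induction with
  | tmul r m => rw [map_tmul, trans_tmul, trans_tmul, map_tmul]
  | add x y hx hy => simp only [map_add, hx, hy]

/-- Transitivity of extension of scalars. -/
theorem lift_trans_bijective : Function.Bijective (lift (trans h M)) := by
  let g : M →ₛₗ[ι] BaseChange φ (BaseChange ι' M) :=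
    { toFun := fun m => mk φ _ (mk ι' M m), map_add' := by simp
      map_smul' := fun a m => by
        rw [(mk ι' M).map_smulₛₗ, (mk φ _).map_smulₛₗ, h] }
  refine Function.bijective_iff_has_inverse.2 ⟨lift g, fun x => ?_, fun x => ?_⟩
  · induction x using induction with
    | tmul s y =>
      rw [lift_tmul, map_smul, ← smul_mk]
      congr 1
      induction y using induction with
      | tmul r m =>
        rw [trans_tmul, lift_tmul, ← smul_mk ι', (mk φ _).map_smulₛₗ]
        rfl
      | add x y hx hy => simp only [map_add, hx, hy]
    | add x y hx hy => simp only [map_add, hx, hy]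
  · induction x using induction with
    | tmul s y =>
      rw [lift_tmul, map_smul]
      change s • lift (trans h M) (mk φ _ (mk ι' M y)) = _
      rw [lift_mk, trans_mk, smul_mk]
    | add x y hx hy => simp only [map_add, hx, hy]

end Trans

end BaseChange

/-! ### Restriction of scalars on `Ext` groups -/

/-- Two right exact rows with the same comparison maps on the first two terms have the same
comparison map on the cokernels. -/
theorem bijective_of_exact_rows {A₁ A₂ A₃ B₁ B₂ B₃ : Type*} [AddCommGroup A₁] [AddCommGroup A₂]
    [AddCommGroup A₃] [AddCommGroup B₁] [AddCommGroup B₂] [AddCommGroup B₃]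
    {f₁ : A₁ → A₂} {f₂ : A₂ → A₃} {g₁ : B₁ → B₂} {g₂ : B₂ → B₃}
    {a : A₁ → B₁} {b : A₂ → B₂} (c : A₃ →+ B₃)
    (hf : Function.Exact f₁ f₂) (hf₂ : Function.Surjective f₂)
    (hg : Function.Exact g₁ g₂) (hg₂ : Function.Surjective g₂)
    (ha : Function.Surjective a) (hb : Function.Bijective b)
    (h₁ : ∀ x, b (f₁ x) = g₁ (a x)) (h₂ : ∀ x, c (f₂ x) = g₂ (b x)) : Function.Bijective c := by
  constructor
  · refine (injective_iff_map_eq_zero c).2 fun x hx => ?_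
    obtain ⟨y, rfl⟩ := hf₂ x
    rw [h₂] at hx
    obtain ⟨z, hz⟩ := (hg _).1 hx
    obtain ⟨t, rfl⟩ := ha z
    rw [← h₁] at hz
    exact (hf _).2 ⟨t, hb.1 hz⟩
  · intro y
    obtain ⟨z, rfl⟩ := hg₂ y
    obtain ⟨t, rfl⟩ := hb.2 z
    exact ⟨f₂ t, h₂ t⟩

/-- Every module has a projective cover with a kernel. -/
theorem exists_projective_presentation (R : Type u) [Ring R] (N : Type u) [AddCommGroup N]
    [Module R N] : ∃ (K P : Type u) (_ : AddCommGroup K) (_ : Module R K) (_ : AddCommGroup P)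
      (_ : Module R P) (i : K →ₗ[R] P) (p : P →ₗ[R] N), Module.Projective R P ∧
      Function.Injective i ∧ Function.Surjective p ∧ Function.Exact i p :=
  ⟨LinearMap.ker (Finsupp.linearCombination R (id : N → N)), N →₀ R, inferInstance, inferInstance,
    inferInstance, inferInstance, Submodule.subtype _, Finsupp.linearCombination R (id : N → N),
    inferInstance, Submodule.injective_subtype _, Finsupp.linearCombination_id_surjective R N,
    LinearMap.exact_subtype_ker_map _⟩

section Rest

variable {R S : Type u} [Ring R] [Ring S] (φ : R →+* S)

/-- Restriction of scalars of an `S`-module along `φ : R → S`. -/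
def Rest (_φ : R →+* S) (B : Type u) : Type u := B

variable (B B' : Type u) [AddCommGroup B] [Module S B] [AddCommGroup B'] [Module S B']

instance : AddCommGroup (Rest φ B) := inferInstanceAs (AddCommGroup B)

instance : Module R (Rest φ B) := Module.compHom B φ

variable {B B'}

/-- Restriction of scalars of a linear map. -/
def Rest.map (f : B →ₗ[S] B') : Rest φ B →ₗ[R] Rest φ B' where
  toFun := f
  map_add' := map_add f
  map_smul' r x := f.map_smul (φ r) x

theorem restrictScalars_map_exact (T : ShortComplex (ModuleCat.{u} S)) (h : T.Exact) :
    (T.map (ModuleCat.restrictScalars.{u} φ)).Exact := by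
  rw [CategoryTheory.ShortComplex.ShortExact.moduleCat_exact_iff_function_exact] at h ⊢
  exact h

instance : Limits.PreservesFiniteLimits (ModuleCat.restrictScalars.{u} φ) := by
  have := ((CategoryTheory.Functor.exact_tfae (ModuleCat.restrictScalars.{u} φ)).out 1 3).mp
    (restrictScalars_map_exact φ)
  exact this.1

instance : Limits.PreservesFiniteColimits (ModuleCat.restrictScalars.{u} φ) := by
  have := ((CategoryTheory.Functor.exact_tfae (ModuleCat.restrictScalars.{u} φ)).out 1 3).mp
    (restrictScalars_map_exact φ)
  exact this.2

instance : (ModuleCat.restrictScalars.{u} φ).Additive where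
  map_add := rfl

namespace ExtM

/-- The map induced by restriction of scalars on `Ext` groups. -/
def rest (Y B : Type u) [AddCommGroup Y] [Module S Y] [AddCommGroup B] [Module S B] (l : ℕ) :
    ExtM S Y B l →+ ExtM R (Rest φ Y) (Rest φ B) l :=
  (ModuleCat.restrictScalars.{u} φ).mapExtAddHom (ModuleCat.of S Y) (ModuleCat.of S B) l

variable {Y Y' Y'' : Type u} [AddCommGroup Y] [Module S Y] [AddCommGroup Y'] [Module S Y']
  [AddCommGroup Y''] [Module S Y'']

theorem rest_mk₀ (f : Y →ₗ[S] B) :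
    rest φ Y B 0 (Ext.mk₀ (ModuleCat.ofHom f)) = Ext.mk₀ (ModuleCat.ofHom (Rest.map φ f)) :=
  Ext.mapExactFunctor_mk₀ (ModuleCat.restrictScalars.{u} φ) (ModuleCat.ofHom f)

theorem rest_pre (l : ℕ) (f : Y →ₗ[S] Y') (x : ExtM S Y' B l) :
    rest φ Y B l (pre B l f x) = pre _ l (Rest.map φ f) (rest φ Y' B l x) := by
  have := Ext.mapExactFunctor_comp (ModuleCat.restrictScalars.{u} φ)
    (Ext.mk₀ (ModuleCat.ofHom f)) x (zero_add l)
  refine this.trans ?_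
  rw [Ext.mapExactFunctor_mk₀]
  rfl

theorem rest_post (l : ℕ) (f : B →ₗ[S] B') (x : ExtM S Y B l) :
    rest φ Y B' l (post Y l f x) = post _ l (Rest.map φ f) (rest φ Y B l x) := by
  have := Ext.mapExactFunctor_comp (ModuleCat.restrictScalars.{u} φ)
    x (Ext.mk₀ (ModuleCat.ofHom f)) (add_zero l)
  refine this.trans ?_
  rw [Ext.mapExactFunctor_mk₀]
  rfl

theorem homEquiv_rest (x : ExtM S Y B 0) :
    homEquiv (rest φ Y B 0 x) = Rest.map φ (homEquiv x) := by
  conv_lhs => rw [← mk₀_homEquiv x, rest_mk₀, homEquiv_mk₀]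
  rfl

theorem rest_δ {f : Y →ₗ[S] Y'} {g : Y' →ₗ[S] Y''} (hf : Function.Injective f)
    (hg : Function.Surjective g) (hfg : Function.Exact f g) (l : ℕ) (x : ExtM S Y B l) :
    rest φ Y'' B (l + 1) (δ hf hg hfg B l x) =
      δ (f := Rest.map φ f) (g := Rest.map φ g) hf hg hfg _ l (rest φ Y B l x) := by
  have := Ext.mapExactFunctor_comp (ModuleCat.restrictScalars.{u} φ)
    (shortExact hf hg hfg).extClass x (add_comm 1 l)
  refine this.trans ?_
  rw [Ext.mapExactFunctor_extClass]
  rfl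

end ExtM

end Rest

section Naturality

variable {R : Type u} [Ring R]
variable {N₁ N₂ N₃ M₁ M₂ M₃ : Type u} [AddCommGroup N₁] [Module R N₁] [AddCommGroup N₂]
  [Module R N₂] [AddCommGroup N₃] [Module R N₃] [AddCommGroup M₁] [Module R M₁] [AddCommGroup M₂]
  [Module R M₂] [AddCommGroup M₃] [Module R M₃]
  {f : N₁ →ₗ[R] N₂} {g : N₂ →ₗ[R] N₃} (hf : Function.Injective f)
  (hg : Function.Surjective g) (hfg : Function.Exact f g)
  {f' : M₁ →ₗ[R] M₂} {g' : M₂ →ₗ[R] M₃} (hf' : Function.Injective f')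
  (hg' : Function.Surjective g') (hfg' : Function.Exact f' g')
  (B : Type u) [AddCommGroup B] [Module R B]

/-- Naturality of the connecting homomorphism. -/
theorem ExtM.δ_pre (a : N₁ →ₗ[R] M₁) (b : N₂ →ₗ[R] M₂) (c : N₃ →ₗ[R] M₃)
    (h₁ : f' ∘ₗ a = b ∘ₗ f) (h₂ : g' ∘ₗ b = c ∘ₗ g) (l : ℕ) (x : ExtM R M₁ B l) :
    δ hf hg hfg B l (pre B l a x) = pre B (l + 1) c (δ hf' hg' hfg' B l x) := by
  let t : shortComplex hfg ⟶ shortComplex hfg' :=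
    { τ₁ := ModuleCat.ofHom a, τ₂ := ModuleCat.ofHom b, τ₃ := ModuleCat.ofHom c
      comm₁₂ := by
        change ModuleCat.ofHom (f' ∘ₗ a) = ModuleCat.ofHom (b ∘ₗ f); rw [h₁]
      comm₂₃ := by
        change ModuleCat.ofHom (g' ∘ₗ b) = ModuleCat.ofHom (c ∘ₗ g); rw [h₂] }
  have := ShortComplex.ShortExact.extClass_naturality (shortExact hf hg hfg)
    (shortExact hf' hg' hfg') t
  simp only [δ, pre, AddMonoidHom.coe_mk, ZeroHom.coe_mk]
  have e1 := Ext.comp_assoc (shortExact hf hg hfg).extClass (Ext.mk₀ (ModuleCat.ofHom a)) x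
    (add_zero 1) (zero_add l) (show 1 + 0 + l = l + 1 by omega)
  have e2 := Ext.comp_assoc (Ext.mk₀ (ModuleCat.ofHom c)) (shortExact hf' hg' hfg').extClass x
    (zero_add 1) (add_comm 1 l) (show 0 + 1 + l = l + 1 by omega)
  exact e1.symm.trans ((congrArg (fun z => Ext.comp z x (add_comm 1 l)) this).trans e2)

end Naturality

/-! ### Extension of scalars is adjoint to restriction on `Ext` -/

section Adjunction

variable {R S : Type u} [Ring R] [Ring S] (φ : R →+* S)
variable {N N' N'' : Type u} [AddCommGroup N] [Module R N] [AddCommGroup N'] [Module R N']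
  [AddCommGroup N''] [Module R N'']

/-- The unit `N → S ⊗_R N`, as an `R`-linear map. -/
def BaseChange.unit (N : Type u) [AddCommGroup N] [Module R N] :
    N →ₗ[R] Rest φ (BaseChange φ N) where
  toFun := mk φ N
  map_add' := map_add _
  map_smul' r n := (mk φ N).map_smulₛₗ r n

namespace ExtM

variable (N) (B : Type u) [AddCommGroup B] [Module S B]

/-- The comparison map `Ext^l_S(S ⊗_R N, B) → Ext^l_R(N, B)`. -/
def adj (l : ℕ) : ExtM S (BaseChange φ N) B l →+ ExtM R N (Rest φ B) l :=
  (pre _ l (BaseChange.unit φ N)).comp (rest φ _ _ l)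

variable {N B}

theorem adj_post {B' : Type u} [AddCommGroup B'] [Module S B'] (l : ℕ) (f : B →ₗ[S] B')
    (x : ExtM S (BaseChange φ N) B l) :
    adj φ N B' l (post _ l f x) = post _ l (Rest.map φ f) (adj φ N B l x) := by
  simp only [adj, AddMonoidHom.comp_apply, rest_post, post_pre]

theorem adj_pre (l : ℕ) (f : N →ₗ[R] N') (x : ExtM S (BaseChange φ N') B l) :
    adj φ N B l (pre _ l (BaseChange.map φ f) x) = pre _ l f (adj φ N' B l x) := by
  simp only [adj, AddMonoidHom.comp_apply, rest_pre, ← pre_comp]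
  rfl

theorem homEquiv_adj (x : ExtM S (BaseChange φ N) B 0) (n : N) :
    homEquiv (adj φ N B 0 x) n = homEquiv x (BaseChange.mk φ N n) := by
  rw [adj, AddMonoidHom.comp_apply, homEquiv_pre, homEquiv_rest]
  rfl

/-- Restriction of scalars respects extension classes, and the unit `N → S ⊗ N` is a map of short
exact sequences. This is the square needed for dimension shifting in `adj_bijective`. -/
theorem adj_δ {f : N →ₗ[R] N'} {g : N' →ₗ[R] N''} (hf : Function.Injective f)
    (hg : Function.Surjective g) (hfg : Function.Exact f g)
    (hf' : Function.Injective (BaseChange.map φ f))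
    (hg' : Function.Surjective (BaseChange.map φ g))
    (hfg' : Function.Exact (BaseChange.map φ f) (BaseChange.map φ g))
    (l : ℕ) (x : ExtM S (BaseChange φ N) B l) :
    adj φ N'' B (l + 1) (δ hf' hg' hfg' B l x) = δ hf hg hfg _ l (adj φ N B l x) := by
  simp only [adj, AddMonoidHom.comp_apply, rest_δ]
  rw [δ_pre hf hg hfg (f' := Rest.map φ (BaseChange.map φ f))
    (g' := Rest.map φ (BaseChange.map φ g)) hf' hg' hfg' _ _ (BaseChange.unit φ N')
    (BaseChange.unit φ N'')]
  · rfl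
  · rfl

/-- `Ext^l_S(S ⊗_R N, B) = Ext^l_R(N, B)` if `S` is right flat over `R`. -/
theorem adj_bijective (hφ : FlatAsRightModule φ) (l : ℕ) (N : Type u) [AddCommGroup N]
    [Module R N] : Function.Bijective (adj φ N B l) := by
  induction l generalizing N with
  | zero =>
    constructor
    · refine (injective_iff_map_eq_zero _).2 fun x hx => ?_
      apply homEquiv.injective
      rw [map_zero]
      refine BaseChange.hom_ext fun n => ?_
      rw [← homEquiv_adj, hx, map_zero]
      rfl
    · intro y
      let f : N →ₛₗ[φ] B :=
        { toFun := homEquiv y, map_add' := map_add (homEquiv y)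
          map_smul' := (homEquiv y).map_smul }
      refine ⟨homEquiv.symm (BaseChange.lift f), ?_⟩
      apply homEquiv.injective
      ext n
      rw [homEquiv_adj, AddEquiv.apply_symm_apply, BaseChange.lift_mk]
      rfl
  | succ l ih =>
    -- Dimension shifting: by flatness the base-changed presentation stays exact, with projective
    -- middle term. So on both sides `Ext^{l+1}` is the cokernel of `Ext^l` of `P` mapping to
    -- `Ext^l` of `K`.
    obtain ⟨K, P, _, _, _, _, i, p, _, hi, hp, hip⟩ := exists_projective_presentation R N
    have hi' : Function.Injective (BaseChange.map φ i) := hφ.map_injective hi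
    have hp' := BaseChange.map_surjective φ hp
    have hip' := BaseChange.map_exact φ hip hp
    have s₁ : Subsingleton (ExtM S (BaseChange φ P) B (l + 1)) :=
      subsingleton_of_projective l
    have s₂ : Subsingleton (ExtM R P (Rest φ B) (l + 1)) := subsingleton_of_projective l
    exact bijective_of_exact_rows (adj φ N B (l + 1))
      (exact_pre_δ hi' hp' hip' l)
      (fun y => (exact_δ_pre hi' hp' hip' l y).1 (Subsingleton.elim _ _))
      (exact_pre_δ hi hp hip l)
      (fun y => (exact_δ_pre hi hp hip l y).1 (Subsingleton.elim _ _))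
      (ih P).2 (ih K) (adj_pre φ l i)
      (adj_δ φ hi hp hip hi' hp' hip' l)

end ExtM

end Adjunction

/-! ### `Ext` and countable products -/

section Product

variable {R : Type u} [Ring R]

namespace ExtM

variable (B : ℕ → Type u) [∀ n, AddCommGroup (B n)] [∀ n, Module R (B n)]

/-- The comparison map `Ext^l_R(N, ∏ B_n) → ∏ Ext^l_R(N, B_n)`. -/
def piMap (N : Type u) [AddCommGroup N] [Module R N] (l : ℕ) :
    ExtM R N (∀ n, B n) l →+ ∀ n, ExtM R N (B n) l :=
  AddMonoidHom.mk' (fun x n => post N l (LinearMap.proj (R := R) (φ := B) n) x) fun x y => by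
    ext n; simp

theorem piMap_apply (N : Type u) [AddCommGroup N] [Module R N] (l : ℕ)
    (x : ExtM R N (∀ n, B n) l) (n : ℕ) :
    piMap (R := R) B N l x n = post N l (LinearMap.proj (R := R) (φ := B) n) x := rfl

/-- `Ext` commutes with products in the second variable. -/
theorem piMap_bijective (l : ℕ) (N : Type u) [AddCommGroup N] [Module R N] :
    Function.Bijective (piMap (R := R) B N l) := by
  induction l generalizing N with
  | zero =>
    constructor
    · refine (injective_iff_map_eq_zero _).2 fun x hx => ?_
      apply homEquiv.injective
      ext m n
      have := LinearMap.congr_fun (congrArg homEquiv (congrFun hx n)) m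
      simp only [piMap_apply, homEquiv_post] at this
      simpa using this
    · intro y
      refine ⟨homEquiv.symm (LinearMap.pi fun n => homEquiv (y n)), ?_⟩
      ext n : 1
      apply homEquiv.injective
      rw [piMap_apply, homEquiv_post, AddEquiv.apply_symm_apply]
      rfl
  | succ l ih =>
    obtain ⟨K, P, _, _, _, _, i, p, _, hi, hp, hip⟩ := exists_projective_presentation R N
    have s₁ : Subsingleton (ExtM R P (∀ n, B n) (l + 1)) := subsingleton_of_projective l
    have s₂ (n) : Subsingleton (ExtM R P (B n) (l + 1)) := subsingleton_of_projective l
    refine bijective_of_exact_rows (piMap (R := R) B N (l + 1))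
      (g₁ := fun x n => pre (B n) l i (x n)) (g₂ := fun x n => δ hi hp hip (B n) l (x n))
      (exact_pre_δ hi hp hip l)
      (fun y => (exact_δ_pre hi hp hip l y).1 (Subsingleton.elim _ _)) ?_ ?_
      (ih P).2 (ih K) ?_ ?_
    · intro x
      constructor
      · intro hx
        choose y hy using fun n => (exact_pre_δ hi hp hip l (x n)).1 (congrFun hx n)
        exact ⟨y, funext hy⟩
      · rintro ⟨y, rfl⟩
        funext n
        exact (exact_pre_δ hi hp hip l _).2 ⟨_, rfl⟩
    · intro y
      choose z hz using fun n => (exact_δ_pre hi hp hip l (y n)).1 (Subsingleton.elim _ _)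
      exact ⟨z, funext hz⟩
    · intro x
      funext n
      simp only [piMap_apply, post_pre]
    · intro x
      funext n
      simp only [piMap_apply, δ_post]

end ExtM

end Product

/-! ### The groups `Ext^l_R(N, S)` for a ring homomorphism `R → S` -/

section ExtB

variable {R S : Type u} [Ring R] [Ring S] (φ : R →+* S)

/-- The group `Ext^l_R(N, S)`, which is a right `S`-module. -/
def ExtB (N : Type u) [AddCommGroup N] [Module R N] (l : ℕ) : Type u := ExtM R N (Rest φ S) l

/-- Right multiplication on `S`, as an `R`-linear map. -/
def Rest.mulRight (s : S) : Rest φ S →ₗ[R] Rest φ S :=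
  Rest.map φ (LinearMap.toSpanSingleton S S s)

theorem Rest.mulRight_one : Rest.mulRight φ 1 = LinearMap.id :=
  LinearMap.ext fun x => mul_one (M := S) x

theorem Rest.mulRight_zero : Rest.mulRight φ 0 = 0 :=
  LinearMap.ext fun x => mul_zero (M₀ := S) x

theorem Rest.mulRight_add (s t : S) :
    Rest.mulRight φ (s + t) = Rest.mulRight φ s + Rest.mulRight φ t :=
  LinearMap.ext fun x => mul_add (R := S) x s t

theorem Rest.mulRight_mul (s t : S) :
    Rest.mulRight φ (s * t) = Rest.mulRight φ t ∘ₗ Rest.mulRight φ s :=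
  LinearMap.ext fun x => (mul_assoc (G := S) x s t).symm

variable (N N' N'' : Type u) [AddCommGroup N] [Module R N] [AddCommGroup N'] [Module R N']
  [AddCommGroup N''] [Module R N'']

instance (l : ℕ) : AddCommGroup (ExtB φ N l) := inferInstanceAs (AddCommGroup (ExtM R N _ l))

/-- The right `S`-module structure on `Ext^l_R(N, S)`. -/
@[reducible] def extBModule (l : ℕ) : Module Sᵐᵒᵖ (ExtM R N (Rest φ S) l) where
  smul s x := ExtM.post N l (Rest.mulRight φ s.unop) x
  one_smul x := by
    change ExtM.post N l (Rest.mulRight φ 1) x = x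
    rw [Rest.mulRight_one, ExtM.post_id]
  mul_smul s t x := by
    change ExtM.post N l (Rest.mulRight φ (t.unop * s.unop)) x =
      ExtM.post N l (Rest.mulRight φ s.unop) (ExtM.post N l (Rest.mulRight φ t.unop) x)
    rw [← ExtM.post_comp, Rest.mulRight_mul]
  smul_zero s := map_zero (ExtM.post N l (Rest.mulRight φ s.unop))
  smul_add s := map_add (ExtM.post N l (Rest.mulRight φ s.unop))
  add_smul s t x := by
    change ExtM.post N l (Rest.mulRight φ (s.unop + t.unop)) x =
      ExtM.post N l (Rest.mulRight φ s.unop) x + ExtM.post N l (Rest.mulRight φ t.unop) x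
    rw [← ExtM.post_add, Rest.mulRight_add]
  zero_smul x := by
    change ExtM.post N l (Rest.mulRight φ 0) x = 0
    rw [Rest.mulRight_zero, ExtM.post_zero]

instance (l : ℕ) : Module Sᵐᵒᵖ (ExtB φ N l) := extBModule φ N l

namespace ExtB

variable {N N' N''}

/-- Contravariant functoriality of `Ext^l_R(-, S)`. -/
def pre (l : ℕ) (f : N →ₗ[R] N') : ExtB φ N' l →ₗ[Sᵐᵒᵖ] ExtB φ N l where
  toFun := ExtM.pre _ l f
  map_add' := map_add _
  map_smul' _ x := (ExtM.post_pre l f _ x).symm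

/-- Semilinear maps to `S` are linear maps to the restriction of scalars of `S`. -/
def semilinearEquiv : (N →ₗ[R] Rest φ S) ≃+ (N →ₛₗ[φ] S) where
  toFun f := { toFun := f, map_add' := map_add f, map_smul' := f.map_smul }
  invFun f := { toFun := f, map_add' := map_add f, map_smul' := f.map_smulₛₗ }
  left_inv _ := rfl
  right_inv _ := rfl
  map_add' _ _ := rfl

/-- `Ext^0_R(N, S)` consists of the semilinear maps `N → S`. -/
def homEquiv : ExtB φ N 0 ≃+ (N →ₛₗ[φ] S) :=
  (ExtM.homEquiv : ExtM R N (Rest φ S) 0 ≃+ _).trans (semilinearEquiv φ)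

theorem homEquiv_smul (s : Sᵐᵒᵖ) (x : ExtB φ N 0) (n : N) :
    homEquiv φ (s • x) n = homEquiv φ x n * s.unop :=
  LinearMap.congr_fun (ExtM.homEquiv_post (Rest.mulRight φ s.unop) x) n

variable (N) in
/-- The comparison `Ext^l_S(S ⊗_R N, S) → Ext^l_R(N, S)`, as a linear map. -/
def adj (l : ℕ) : ExtDual S (BaseChange φ N) l →ₗ[Sᵐᵒᵖ] ExtB φ N l where
  toFun := ExtM.adj φ N S l
  map_add' := map_add _
  map_smul' r x := ExtM.adj_post φ l (LinearMap.toSpanSingleton S S r.unop) x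

variable (N) in
/-- `Ext^l_S(S ⊗_R N, S) = Ext^l_R(N, S)` if `S` is right flat over `R`. -/
def adjEquiv (hφ : FlatAsRightModule φ) (l : ℕ) :
    ExtDual S (BaseChange φ N) l ≃ₗ[Sᵐᵒᵖ] ExtB φ N l :=
  LinearEquiv.ofBijective (adj φ N l) (ExtM.adj_bijective φ hφ l N)

/-- `φ` as an `R`-linear map. -/
def restHom : R →ₗ[R] Rest φ S where
  toFun := φ
  map_add' := map_add φ
  map_smul' := map_mul φ

variable (N) in
/-- The semilinear map `Ext^l_R(N, R) → Ext^l_R(N, S)` induced by `φ`. -/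
def ofDual (l : ℕ) : ExtDual R N l →ₛₗ[RingHom.op φ] ExtB φ N l where
  toFun := ExtM.post N l (restHom φ)
  map_add' := map_add _
  map_smul' r x := by
    have e : restHom φ ∘ₗ LinearMap.toSpanSingleton R R r.unop =
        Rest.mulRight φ (φ r.unop) ∘ₗ restHom φ := LinearMap.ext fun x => φ.map_mul x _
    exact (ExtM.post_comp (B' := R) l _ _ x).symm.trans
      ((congrArg (fun f => ExtM.post N l f x) e).trans (ExtM.post_comp l _ _ x))

theorem ofDual_pre (l : ℕ) (f : N →ₗ[R] N') (x : ExtDual R N' l) :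
    ofDual φ N l (ExtDual.pre l f x) = pre φ l f (ofDual φ N' l x) :=
  ExtM.post_pre l f (restHom φ) x

theorem homEquiv_ofDual (x : ExtDual R N 0) (n : N) :
    homEquiv φ (ofDual φ N 0 x) n = φ (ExtDual.homEquiv x n) :=
  LinearMap.congr_fun (ExtM.homEquiv_post (restHom φ) x) n

section Trans

variable {A : Type u} [Ring A] {ι' : A →+* R} {ι : A →+* S} {φ} (h : ∀ a, φ (ι' a) = ι a)
variable (M : Type u) [AddCommGroup M] [Module A M]

include h in
theorem map_mul_of_comp (a : A) (x : R) : φ (ι' a * x) = ι a * φ x := by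
  rw [map_mul, h]

/-- `φ : R → S` as an `A`-linear map. -/
def transHom : Rest ι' R →ₗ[A] Rest ι S where
  toFun := φ
  map_add' := map_add φ
  map_smul' := @map_mul_of_comp R S _ _ φ A _ ι' ι h

/-- The semilinear map `Ext^l_A(M, R) → Ext^l_A(M, S)` induced by `R → S`. -/
def trans (l : ℕ) : ExtB ι' M l →ₛₗ[RingHom.op φ] ExtB ι M l where
  toFun := ExtM.post M l (transHom h)
  map_add' := map_add _
  map_smul' r x := by
    have e : transHom h ∘ₗ Rest.mulRight ι' r.unop =
        Rest.mulRight ι (φ r.unop) ∘ₗ transHom h := LinearMap.ext fun x => φ.map_mul x _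
    exact (ExtM.post_comp l _ _ x).symm.trans
      ((congrArg (fun f => ExtM.post M l f x) e).trans (ExtM.post_comp l _ _ x))

/-- The identity of `S`, as an `A`-linear map between iterated and direct restrictions. -/
def restRest : Rest ι' (Rest φ S) →ₗ[A] Rest ι S where
  toFun := id
  map_add' _ _ := rfl
  map_smul' a (x : S) := congrArg (· * x) (h a)

/-- The inverse of `restRest`. -/
def restRestSymm : Rest ι S →ₗ[A] Rest ι' (Rest φ S) where
  toFun := id
  map_add' _ _ := rfl
  map_smul' a (x : S) := congrArg (· * x) (h a).symm

/-- The comparison map `Ext^l_R(R ⊗_A M, S) → Ext^l_A(M, S)`. -/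
def adjTransHom (l : ℕ) : ExtM R (BaseChange ι' M) (Rest φ S) l →+ ExtM A M (Rest ι S) l :=
  (ExtM.post M l (restRest h)).comp (ExtM.adj ι' M (Rest φ S) l)

theorem adjTransHom_smul (l : ℕ) (s : S) (x : ExtM R (BaseChange ι' M) (Rest φ S) l) :
    adjTransHom h M l (ExtM.post _ l (Rest.mulRight φ s) x) =
      ExtM.post M l (Rest.mulRight ι s) (adjTransHom h M l x) := by
  simp only [adjTransHom, AddMonoidHom.comp_apply]
  rw [ExtM.adj_post, ← ExtM.post_comp, ← ExtM.post_comp]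
  rfl

theorem adjTransHom_bijective (hι : FlatAsRightModule ι') (l : ℕ) :
    Function.Bijective (adjTransHom h M l) := by
  refine Function.Bijective.comp (g := ExtM.post M l (restRest h)) ?_
    (ExtM.adj_bijective ι' hι l M)
  refine Function.bijective_iff_has_inverse.2 ⟨ExtM.post M l (restRestSymm h), ?_, ?_⟩
  · intro x
    rw [← ExtM.post_comp]
    exact ExtM.post_id l x
  · intro x
    rw [← ExtM.post_comp]
    exact ExtM.post_id l x

/-- The comparison map `Ext^l_R(R ⊗_A M, S) → Ext^l_A(M, S)`, as a linear map. -/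
def adjTransLin (l : ℕ) : ExtB φ (BaseChange ι' M) l →ₗ[Sᵐᵒᵖ] ExtB ι M l where
  toFun := adjTransHom h M l
  map_add' := map_add (adjTransHom h M l)
  map_smul' s x := by
    have := adjTransHom_smul h M l s.unop x
    exact this

/-- The isomorphism `Ext^l_R(R ⊗_A M, S) = Ext^l_A(M, S)`. -/
def adjTrans (hι : FlatAsRightModule ι') (l : ℕ) :
    ExtB φ (BaseChange ι' M) l ≃ₗ[Sᵐᵒᵖ] ExtB ι M l :=
  LinearEquiv.ofBijective (adjTransLin h M l) (adjTransHom_bijective h M hι l)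

theorem post_transHom_adj (l : ℕ) (x : ExtM R (BaseChange ι' M) R l) :
    ExtM.post M l (transHom h) (ExtM.adj ι' M R l x) =
      adjTransHom h M l (ExtM.post _ l (restHom φ) x) := by
  rw [adjTransHom, AddMonoidHom.comp_apply, ExtM.adj_post, ← ExtM.post_comp]
  rfl

/-- Identifies the transition map between the groups `Ext^l_A(M, -)` with the base change map
`ofDual` over `R`, whose bijectivity after `lift` is ordinary flat base change. -/
theorem trans_adj (hι : FlatAsRightModule ι') (l : ℕ) (x : ExtDual R (BaseChange ι' M) l) :
    trans h M l (adjEquiv ι' M hι l x) = adjTrans h M hι l (ofDual φ _ l x) :=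
  post_transHom_adj h M l x

end Trans

end ExtB

end ExtB

/-! ### Dual bases and finite presentations -/

section Finite

variable {R : Type u} [Ring R]

/-- The dual basis lemma. -/
theorem exists_dual_basis (P : Type u) [AddCommGroup P] [Module R P] [Module.Finite R P]
    [Module.Projective R P] : ∃ (k : ℕ) (x : Fin k → P) (f : Fin k → P →ₗ[R] R),
      ∀ p, ∑ i, f i p • x i = p := by
  obtain ⟨k, π, hπ⟩ := Module.Finite.exists_fin' R P
  obtain ⟨s, hs⟩ := Module.projective_lifting_property π LinearMap.id hπ
  refine ⟨k, fun i => π (Pi.single i 1), fun i => LinearMap.proj i ∘ₗ s, fun p => ?_⟩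
  conv_rhs => rw [← LinearMap.id_apply (R := R) p, ← hs]
  rw [LinearMap.comp_apply, pi_eq_sum_univ' (s p), map_sum]
  refine Finset.sum_congr rfl fun i _ => ?_
  simp only [LinearMap.comp_apply, LinearMap.proj_apply, map_smul]

/-- The same data also gives a dual basis of the dual: a functional is expanded by its values on the
`x i`, acting on the right. -/
theorem ExtDual.exists_dual_basis (P : Type u) [AddCommGroup P] [Module R P] [Module.Finite R P]
    [Module.Projective R P] : ∃ (k : ℕ) (x : Fin k → P) (e : Fin k → ExtDual R P 0),
      (∀ p, ∑ i, ExtDual.homEquiv (e i) p • x i = p) ∧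
      ∀ g, g = ∑ i, MulOpposite.op (ExtDual.homEquiv g (x i)) • e i := by
  obtain ⟨k, x, f, hf⟩ := _root_.exists_dual_basis (R := R) P
  refine ⟨k, x, fun i => ExtDual.homEquiv.symm (f i), by simpa using hf, fun g => ?_⟩
  apply ExtDual.homEquiv.injective
  ext p
  rw [map_sum, LinearMap.sum_apply]
  conv_lhs => rw [← hf p, map_sum]
  refine Finset.sum_congr rfl fun i _ => ?_
  rw [ExtDual.homEquiv_smul, map_smul]
  simp

/-- Over a noetherian ring, finite modules have presentations by finite modules. -/
theorem exists_finite_presentation [IsNoetherianRing R] (N : Type u) [AddCommGroup N] [Module R N]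
    [Module.Finite R N] : ∃ (K P : Type u) (_ : AddCommGroup K) (_ : Module R K)
      (_ : AddCommGroup P) (_ : Module R P) (i : K →ₗ[R] P) (p : P →ₗ[R] N),
      Module.Projective R P ∧ Module.Finite R P ∧ Module.Finite R K ∧
      Function.Injective i ∧ Function.Surjective p ∧ Function.Exact i p := by
  obtain ⟨k, p, hp⟩ := Module.Finite.exists_fin' R N
  exact ⟨LinearMap.ker p, Fin k → R, inferInstance, inferInstance, inferInstance, inferInstance,
    Submodule.subtype _, p, inferInstance, inferInstance, inferInstance,
    Submodule.injective_subtype _, hp, LinearMap.exact_subtype_ker_map p⟩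

end Finite

/-! ### Flat base change for `Ext^l_R(N, R)` with `N` finite -/

section FlatBaseChange

variable {R S : Type u} [Ring R] [Ring S] (φ : R →+* S)

namespace ExtB

open BaseChange

theorem lift_ofDual_map {N N' : Type u} [AddCommGroup N] [Module R N] [AddCommGroup N']
    [Module R N'] (l : ℕ) (f : N →ₗ[R] N') (x : BaseChange (RingHom.op φ) (ExtDual R N' l)) :
    lift (ofDual φ N l) (map _ (ExtDual.pre l f) x) = pre φ l f (lift (ofDual φ N' l) x) := by
  have : (lift (ofDual φ N l)).comp (map _ (ExtDual.pre l f)) =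
      (pre φ l f).comp (lift (ofDual φ N' l)) := hom_ext fun n => by
    simp only [LinearMap.comp_apply, map_mk, lift_mk]
    exact ofDual_pre φ l f n
  exact LinearMap.congr_fun this x

/-- With a dual basis, elements on both sides are determined by their values on the `x i`, which
gives an explicit inverse. -/
theorem lift_ofDual_bijective_of_projective (P : Type u) [AddCommGroup P] [Module R P]
    [Module.Finite R P] [Module.Projective R P] :
    Function.Bijective (lift (ofDual φ P 0)) := by
  obtain ⟨k, x, e, hf, he⟩ := ExtDual.exists_dual_basis (R := R) P
  constructor
  · have key : ∀ y : BaseChange (RingHom.op φ) (ExtDual R P 0), y =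
        ∑ i, MulOpposite.op (α := S) (homEquiv φ (lift (ofDual φ P 0) y) (x i)) •
          mk (RingHom.op φ) _ (e i) := by
      intro y
      induction y using BaseChange.induction with
      | tmul s g =>
        rw [← smul_mk]
        conv_lhs => rw [he g, map_sum, Finset.smul_sum]
        refine Finset.sum_congr rfl fun i _ => ?_
        rw [(lift _).map_smul, homEquiv_smul, lift_mk, homEquiv_ofDual, (mk _ _).map_smulₛₗ,
          smul_smul]
        rfl
      | add a b ha hb =>
        conv_lhs => rw [ha, hb, ← Finset.sum_add_distrib]
        refine Finset.sum_congr rfl fun i _ => ?_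
        rw [← add_smul, map_add, map_add]
        rfl
    refine (injective_iff_map_eq_zero _).2 fun y hy => ?_
    rw [key y, hy, _root_.map_zero]
    refine Finset.sum_eq_zero fun i _ => ?_
    exact zero_smul Sᵐᵒᵖ _
  · intro y
    refine ⟨∑ i, MulOpposite.op (α := S) (homEquiv φ y (x i)) • mk (RingHom.op φ) _ (e i), ?_⟩
    apply (homEquiv φ).injective
    ext p
    rw [map_sum, map_sum, LinearMap.sum_apply]
    conv_rhs => rw [← hf p, map_sum]
    refine Finset.sum_congr rfl fun i _ => ?_
    rw [(lift _).map_smul, homEquiv_smul, lift_mk, homEquiv_ofDual, (homEquiv φ y).map_smulₛₗ]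
    rfl

/-- The dual of `N` embeds into the dual of a finite projective cover, flatness preserves the
embedding, and the projective case applies. This must precede surjectivity, which uses it for the
kernel of the cover. -/
theorem lift_ofDual_zero_injective [IsNoetherianRing R]
    (hφ : FlatAsRightModule (RingHom.op φ)) (N : Type u) [AddCommGroup N] [Module R N]
    [Module.Finite R N] : Function.Injective (lift (ofDual φ N 0)) := by
  obtain ⟨K, P, _, _, _, _, i, p, _, _, _, hi, hp, hip⟩ := exists_finite_presentation (R := R) N
  refine (injective_iff_map_eq_zero _).2 fun x hx => ?_
  have h1 := lift_ofDual_map φ 0 p x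
  rw [hx, _root_.map_zero] at h1
  have h2 := (injective_iff_map_eq_zero _).1 (lift_ofDual_bijective_of_projective φ P).1 _ h1
  exact (injective_iff_map_eq_zero _).1
    (hφ.map_injective (ExtDual.pre_injective_of_surjective hp)) _ h2

/-- `Ext^l_R(N, R) ⊗_R S = Ext^l_R(N, S)` for a finite module `N` over a noetherian ring `R`, if
`S` is left flat over `R`. -/
theorem lift_ofDual_bijective [IsNoetherianRing R] (hφ : FlatAsRightModule (RingHom.op φ)) (l : ℕ)
    (N : Type u) [AddCommGroup N] [Module R N] [Module.Finite R N] :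
    Function.Bijective (lift (ofDual φ N l)) := by
  induction l generalizing N with
  | zero =>
    refine ⟨lift_ofDual_zero_injective φ hφ N, fun y => ?_⟩
    obtain ⟨K, P, _, _, _, _, i, p, _, _, _, hi, hp, hip⟩ := exists_finite_presentation (R := R) N
    -- The preimage `z` found over `P` restricts to zero on `K` by injectivity there, so it comes
    -- from `N`.
    obtain ⟨z, hz⟩ := (lift_ofDual_bijective_of_projective φ P).2 (pre φ 0 p y)
    have hi0 : pre φ 0 i (pre φ 0 p y) = 0 := (ExtM.exact_pre_pre hi hp hip 0).apply_apply_eq_zero y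
    have h1 := lift_ofDual_map φ 0 i z
    rw [hz, hi0] at h1
    have h2 := (injective_iff_map_eq_zero _).1 (lift_ofDual_zero_injective φ hφ K) _ h1
    obtain ⟨t, rfl⟩ := (map_exact_of_flat _ hφ (ExtDual.exact_pre_pre hi hp hip 0) z).1 h2
    refine ⟨t, ?_⟩
    rw [lift_ofDual_map] at hz
    exact ExtM.pre_injective_of_surjective hp hz
  | succ l ih =>
    obtain ⟨K, P, _, _, _, _, i, p, _, _, _, hi, hp, hip⟩ := exists_finite_presentation (R := R) N
    have s₁ : Subsingleton (ExtDual R P (l + 1)) := ExtDual.subsingleton_of_projective l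
    have s₂ : Subsingleton (ExtM R P (Rest φ S) (l + 1)) := ExtM.subsingleton_of_projective l
    -- Higher degrees are cokernels of degree `l` maps. The induction can be applied to `K` because
    -- it is finite over the noetherian ring `R`.
    have hδ : Function.Surjective (ExtDual.δ hi hp hip l) := fun y =>
      (ExtDual.exact_δ_pre hi hp hip l y).1 (Subsingleton.elim _ _)
    refine bijective_of_exact_rows (lift (ofDual φ N (l + 1))).toAddMonoidHom
      (map_exact (RingHom.op φ) (ExtDual.exact_pre_δ hi hp hip l) hδ) (map_surjective _ hδ)
      (ExtM.exact_pre_δ hi hp hip l)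
      (fun y => (ExtM.exact_δ_pre hi hp hip l y).1 (Subsingleton.elim _ _))
      (ih P).2 (ih K) (lift_ofDual_map φ l i) fun x => ?_
    change lift (ofDual φ N (l + 1)) _ = _
    induction x using BaseChange.induction with
    | tmul s n =>
      rw [map_tmul, lift_tmul, lift_tmul]
      refine Eq.trans ?_ (ExtM.δ_post hi hp hip l
        (Rest.mulRight φ s.unop) _).symm
      refine congrArg (ExtM.post N (l + 1) (Rest.mulRight φ s.unop)) ?_
      exact (ExtM.δ_post hi hp hip l (restHom φ) n).symm
    | add a b ha hb =>
      rw [map_add, map_add, map_add, ha, hb]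
      exact (map_add (ExtM.δ hi hp hip (Rest φ S) l) _ _).symm

/-- The transition map `Ext^l_A(M, R) ⊗_R S → Ext^l_A(M, S)` is bijective if `R` is right flat
over `A`, `S` is left flat over the noetherian ring `R`, and `R ⊗_A M` is finite. -/
theorem lift_trans_bijective {A : Type u} [Ring A] {ι' : A →+* R} {ι : A →+* S} {φ : R →+* S}
    (h : ∀ a, φ (ι' a) = ι a) (M : Type u) [AddCommGroup M] [Module A M] [IsNoetherianRing R]
    (hι : FlatAsRightModule ι') (hφ : FlatAsRightModule (RingHom.op φ))
    [Module.Finite R (BaseChange ι' M)] (l : ℕ) : Function.Bijective (lift (trans h M l)) :=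
  lift_bijective_congr (adjEquiv ι' M hι l) (adjTrans h M hι l) (trans_adj h M hι l)
    (lift_ofDual_bijective φ hφ l _)

/-- Flat base change for `Ext^l_R(N, R)`. -/
def baseChangeEquiv [IsNoetherianRing R] (hφ : FlatAsRightModule φ)
    (hφ' : FlatAsRightModule (RingHom.op φ)) (N : Type u) [AddCommGroup N] [Module R N]
    [Module.Finite R N] (l : ℕ) :
    BaseChange (RingHom.op φ) (ExtDual R N l) ≃ₗ[Sᵐᵒᵖ] ExtDual S (BaseChange φ N) l :=
  (LinearEquiv.ofBijective _ (lift_ofDual_bijective φ hφ' l N)).trans (adjEquiv φ N hφ l).symm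

end ExtB

end FlatBaseChange

/-! ### Grades -/

theorem Function.Exact.subsingleton {A B C : Type*} [Zero C] {f : A → B} {g : B → C}
    (h : Function.Exact f g) [Subsingleton A] [Subsingleton C] : Subsingleton B :=
  ⟨fun x y => by
    obtain ⟨a, rfl⟩ := (h x).1 (Subsingleton.elim _ _)
    obtain ⟨b, rfl⟩ := (h y).1 (Subsingleton.elim _ _)
    rw [Subsingleton.elim a b]⟩

theorem LinearMap.exists_factor {R M N Q : Type*} [Ring R] [AddCommGroup M] [Module R M]
    [AddCommGroup N] [Module R N] [AddCommGroup Q] [Module R Q] {g : M →ₗ[R] N} {f : M →ₗ[R] Q}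
    (hg : Function.Surjective g) (h : ∀ x, g x = 0 → f x = 0) :
    ∃ t : N →ₗ[R] Q, ∀ x, t (g x) = f x :=
  ⟨(Submodule.liftQ (LinearMap.ker g) f h).comp
    (g.quotKerEquivOfSurjective hg).symm.toLinearMap, fun x => by
    have : (g.quotKerEquivOfSurjective hg).symm (g x) = Submodule.Quotient.mk x := by
      rw [LinearEquiv.symm_apply_eq]; rfl
    simp only [LinearMap.comp_apply, LinearEquiv.coe_coe, this]
    exact Submodule.liftQ_apply _ _ _⟩

section Grade

variable (R : Type u) [Ring R]

/-- The grade of `N` is at least `l`. -/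
def GradeGE (N : Type u) [AddCommGroup N] [Module R N] (l : ℕ) : Prop :=
  ∀ i < l, Subsingleton (ExtDual R N i)

variable {R}
variable {N N' N'' : Type u} [AddCommGroup N] [Module R N] [AddCommGroup N'] [Module R N']
  [AddCommGroup N''] [Module R N'']

theorem le_moduleGrade_iff {l : ℕ} : (l : ℕ∞) ≤ moduleGrade R N ↔ GradeGE R N l := by
  rw [moduleGrade]
  simp only [le_iInf_iff, Nat.cast_le, GradeGE]
  refine forall_congr' fun i => ?_
  rw [← not_subsingleton_iff_nontrivial, ← not_lt]
  tauto

theorem GradeGE.mono {l m : ℕ} (h : GradeGE R N m) (hl : l ≤ m) : GradeGE R N l :=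
  fun i hi => h i (hi.trans_le hl)

theorem GradeGE.congr {l : ℕ} (h : GradeGE R N l) (e : N ≃ₗ[R] N') : GradeGE R N' l := fun i hi =>
  have := h i hi
  (ExtDual.congr i e).toEquiv.subsingleton

theorem gradeGE_of_subsingleton [Subsingleton N] (l : ℕ) : GradeGE R N l := fun i _ =>
  ⟨fun x y => by
    have : (LinearMap.id : N →ₗ[R] N) = 0 := Subsingleton.elim _ _
    rw [← ExtDual.pre_id i x, ← ExtDual.pre_id i y, this, ExtDual.pre_zero, ExtDual.pre_zero]⟩

section SES

variable {f : N →ₗ[R] N'} {g : N' →ₗ[R] N''}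

theorem GradeGE.extension (hf : Function.Injective f) (hg : Function.Surjective g)
    (hfg : Function.Exact f g) {l : ℕ} (h : GradeGE R N l) (h' : GradeGE R N'' l) :
    GradeGE R N' l := fun i hi =>
  have := h i hi
  have := h' i hi
  (ExtDual.exact_pre_pre hf hg hfg i).subsingleton

theorem GradeGE.quotient (hf : Function.Injective f) (hg : Function.Surjective g)
    (hfg : Function.Exact f g) {l : ℕ} (h : GradeGE R N l) (h' : GradeGE R N' l) :
    GradeGE R N'' l := fun i hi => by
  have := h' i hi
  cases i with
  | zero => exact (ExtDual.pre_injective_of_surjective hg).subsingleton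
  | succ i =>
    have := h i (by omega)
    exact (ExtDual.exact_δ_pre hf hg hfg i).subsingleton

end SES

end Grade

/-! ### Invariance under ring isomorphisms, for comparing `R` with its double opposite -/

section RingIso

variable {R R' : Type u} [Ring R] [Ring R'] (σ : R ≃+* R')

/-- A ring isomorphism identifies `R' ⊗_R N` with `N`. -/
def BaseChange.restEquiv (N : Type u) [AddCommGroup N] [Module R' N] :
    BaseChange (σ : R →+* R') (Rest (σ : R →+* R') N) ≃ₗ[R'] N :=
  let f : Rest (σ : R →+* R') N →ₛₗ[(σ : R →+* R')] N :=
    { toFun := id, map_add' := fun _ _ => rfl, map_smul' := fun _ _ => rfl }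
  let g : N →+ BaseChange (σ : R →+* R') (Rest (σ : R →+* R') N) :=
    (mk (σ : R →+* R') (Rest (σ : R →+* R') N)).toAddMonoidHom
  have hg : ∀ (r : R) (n : N), g (σ r • n) = σ r • g n :=
    (mk (σ : R →+* R') (Rest (σ : R →+* R') N)).map_smulₛₗ
  LinearEquiv.ofBijective (lift f) (by
    refine Function.bijective_iff_has_inverse.2 ⟨g, fun x => ?_, fun n => lift_mk f n⟩
    induction x using BaseChange.induction with
    | tmul s n =>
      obtain ⟨r, rfl⟩ := σ.surjective s
      rw [lift_tmul, hg]
      exact smul_mk _ _ _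
    | add x y hx hy => rw [map_add, map_add, hx, hy])

/-- Along an isomorphism the unit `mk` is bijective, so base change does not alter the underlying
map. -/
theorem flat_of_ringEquiv : FlatAsRightModule (σ : R →+* R') := by
  intro N N' _ _ _ _ f hf
  have key : ∀ (M : Type u) [AddCommGroup M] [Module R M],
      Function.Bijective (BaseChange.mk (σ : R →+* R') M) := by
    intro M _ _
    let : Module R' M := Module.compHom M (σ.symm : R' →+* R)
    let t : M →ₛₗ[(σ : R →+* R')] M :=
      { toFun := id, map_add' := fun _ _ => rfl
        map_smul' := fun r m => congrArg (· • m) (σ.symm_apply_apply r).symm }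
    refine Function.bijective_iff_has_inverse.2 ⟨BaseChange.lift t, BaseChange.lift_mk t, fun x => ?_⟩
    induction x using BaseChange.induction with
    | tmul s n =>
      rw [BaseChange.lift_tmul]
      refine ((BaseChange.mk (σ : R →+* R') M).map_smulₛₗ (σ.symm s) n).trans ?_
      rw [← BaseChange.smul_mk]
      exact congrArg (· • BaseChange.mk (σ : R →+* R') M n) (σ.apply_symm_apply s)
    | add x y hx hy => rw [map_add, map_add, hx, hy]
  intro x y hxy
  obtain ⟨a, rfl⟩ := (key N).2 x
  obtain ⟨b, rfl⟩ := (key N).2 y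
  rw [BaseChange.map_mk, BaseChange.map_mk] at hxy
  rw [hf ((key N').1 hxy)]

/-- `Ext^l_R(N, R)` is invariant under isomorphisms of the base ring. -/
theorem subsingleton_extDual_rest_iff (N : Type u) [AddCommGroup N] [Module R' N] (l : ℕ) :
    Subsingleton (ExtDual R (Rest (σ : R →+* R') N) l) ↔ Subsingleton (ExtDual R' N l) := by
  let s : R →ₗ[R] Rest (σ : R →+* R') R' := ExtB.restHom (σ : R →+* R')
  let e₁ : R ≃ₗ[R] Rest (σ : R →+* R') R' := LinearEquiv.ofBijective s σ.bijective
  have h₁ : Function.Bijective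
      (ExtM.post (Rest (σ : R →+* R') N) l s) := by
    refine Function.bijective_iff_has_inverse.2
      ⟨ExtM.post _ l e₁.symm.toLinearMap, fun x => ?_, fun x => ?_⟩
    · rw [← ExtM.post_comp]
      have : e₁.symm.toLinearMap ∘ₗ s = LinearMap.id :=
        LinearMap.ext fun y => e₁.symm_apply_apply y
      rw [this, ExtM.post_id]
    · rw [← ExtM.post_comp]
      have : s ∘ₗ e₁.symm.toLinearMap = LinearMap.id :=
        LinearMap.ext fun y => e₁.apply_symm_apply y
      rw [this, ExtM.post_id]
  have e₂ := ExtB.adjEquiv (σ : R →+* R') (Rest (σ : R →+* R') N) (flat_of_ringEquiv σ) l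
  have e₃ := ExtDual.congr l (BaseChange.restEquiv σ N)
  have e₄ : ExtDual R' N l ≃ ExtM R (Rest (σ : R →+* R') N) (Rest (σ : R →+* R') R') l :=
    (e₃.trans e₂).toEquiv
  exact ((Equiv.ofBijective _ h₁).trans e₄.symm).subsingleton_congr

theorem gradeGE_rest_iff (N : Type u) [AddCommGroup N] [Module R' N] (l : ℕ) :
    GradeGE R (Rest (σ : R →+* R') N) l ↔ GradeGE R' N l :=
  forall₂_congr fun i _ => subsingleton_extDual_rest_iff σ N i

end RingIso

/-! ### Duals of finite projective modules -/

section Bidual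

variable {R : Type u} [Ring R]

instance ExtDual.finite_of_projective (P : Type u) [AddCommGroup P] [Module R P]
    [Module.Finite R P] [Module.Projective R P] : Module.Finite Rᵐᵒᵖ (ExtDual R P 0) := by
  obtain ⟨k, x, e, -, he⟩ := ExtDual.exists_dual_basis (R := R) P
  refine Module.Finite.of_surjective (Fintype.linearCombination Rᵐᵒᵖ e) fun g => ?_
  exact ⟨fun i => MulOpposite.op (ExtDual.homEquiv g (x i)), (he g).symm⟩

instance ExtDual.projective (P : Type u) [AddCommGroup P] [Module R P]
    [Module.Finite R P] [Module.Projective R P] : Module.Projective Rᵐᵒᵖ (ExtDual R P 0) := by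
  obtain ⟨k, x, e, -, he⟩ := ExtDual.exists_dual_basis (R := R) P
  let s : ExtDual R P 0 →ₗ[Rᵐᵒᵖ] (Fin k → Rᵐᵒᵖ) :=
    { toFun := fun g i => MulOpposite.op (ExtDual.homEquiv g (x i))
      map_add' := fun g h => by ext i; simp
      map_smul' := fun r g => by
        ext i
        rw [ExtDual.homEquiv_smul]
        rfl }
  exact Module.Projective.of_split s (Fintype.linearCombination Rᵐᵒᵖ e)
    (LinearMap.ext fun g => (he g).symm)

/-- `Ext^l_R(N, R)` is finite if `N` is finite and `R` is noetherian. -/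
instance ExtDual.finite [IsNoetherianRing R] [IsNoetherianRing Rᵐᵒᵖ] (N : Type u) [AddCommGroup N]
    [Module R N] [Module.Finite R N] (l : ℕ) : Module.Finite Rᵐᵒᵖ (ExtDual R N l) := by
  induction l generalizing N with
  | zero =>
    obtain ⟨k, p, hp⟩ := Module.Finite.exists_fin' R N
    have := pre_injective_of_surjective hp
    exact Module.Finite.of_injective _ this
  | succ l ih =>
    obtain ⟨K, P, _, _, _, _, i, p, _, _, _, hi, hp, hip⟩ := exists_finite_presentation (R := R) N
    have := ih K
    have s : Subsingleton (ExtDual R P (l + 1)) := ExtDual.subsingleton_of_projective l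
    exact Module.Finite.of_surjective (ExtDual.δ hi hp hip l) fun y =>
      (ExtDual.exact_δ_pre hi hp hip l y).1 (Subsingleton.elim _ _)

variable (R) in
/-- The isomorphism of `R` with its double opposite. -/
abbrev opOpHom : R →+* Rᵐᵒᵖᵐᵒᵖ := (RingEquiv.opOp R : R →+* Rᵐᵒᵖᵐᵒᵖ)

/-- The double `Ext` module `Ext^l(Ext^l(N, R), R)`. -/
abbrev ExtExt (R : Type u) [Ring R] (N : Type u) [AddCommGroup N] [Module R N] (l : ℕ) : Type u :=
  ExtDual Rᵐᵒᵖ (ExtDual R N l) l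

/-- Evaluation at `n`. -/
def evalHom {N : Type u} [AddCommGroup N] [Module R N] (n : N) : ExtDual R N 0 →ₗ[Rᵐᵒᵖ] Rᵐᵒᵖ where
  toFun x := MulOpposite.op (ExtDual.homEquiv x n)
  map_add' x y := by simp
  map_smul' r x := by rw [ExtDual.homEquiv_smul]; rfl

theorem evalHom_apply {N : Type u} [AddCommGroup N] [Module R N] (n : N) (x : ExtDual R N 0) :
    evalHom n x = MulOpposite.op (ExtDual.homEquiv x n) := rfl

/-- The biduality map. -/
def bidual (N : Type u) [AddCommGroup N] [Module R N] : N →ₛₗ[opOpHom R] ExtExt R N 0 where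
  toFun n := ExtDual.homEquiv.symm (evalHom n)
  map_add' m n := by
    rw [← map_add]
    congr 1
    ext1 x
    simp [evalHom_apply]
  map_smul' r n := by
    apply ExtDual.homEquiv.injective
    ext1 x
    rw [ExtDual.homEquiv_smul]
    simp [evalHom_apply]

theorem bidual_apply {N : Type u} [AddCommGroup N] [Module R N] (n : N) :
    bidual N n = ExtDual.homEquiv.symm (evalHom (R := R) n) := rfl

theorem homEquiv_bidual {N : Type u} [AddCommGroup N] [Module R N] (n : N) (x : ExtDual R N 0) :
    ExtDual.homEquiv (bidual N n) x = MulOpposite.op (ExtDual.homEquiv x n) := by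
  rw [bidual_apply, AddEquiv.apply_symm_apply, evalHom_apply]

theorem bidual_natural {N N' : Type u} [AddCommGroup N] [Module R N] [AddCommGroup N']
    [Module R N'] (f : N →ₗ[R] N') (n : N) :
    ExtDual.pre 0 (ExtDual.pre 0 f) (bidual N n) = bidual N' (f n) := by
  apply ExtDual.homEquiv.injective
  ext1 x
  rw [ExtDual.homEquiv_pre, LinearMap.comp_apply, homEquiv_bidual, homEquiv_bidual,
    ExtDual.homEquiv_pre, LinearMap.comp_apply]

/-- The coordinates of a dual basis detect `p`, and a functional `y` on the dual is evaluation at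
the sum of the `y (e i) • x i`. -/
theorem bidual_bijective (P : Type u) [AddCommGroup P] [Module R P] [Module.Finite R P]
    [Module.Projective R P] : Function.Bijective (bidual (R := R) P) := by
  obtain ⟨k, x, e, hf, he⟩ := ExtDual.exists_dual_basis (R := R) P
  constructor
  · refine (injective_iff_map_eq_zero _).2 fun p hp => ?_
    rw [← hf p]
    refine Finset.sum_eq_zero fun i _ => ?_
    have h1 := homEquiv_bidual p (e i)
    rw [hp, map_zero, LinearMap.zero_apply, eq_comm, MulOpposite.op_eq_zero_iff] at h1
    rw [h1, zero_smul]
  · intro y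
    refine ⟨∑ i, (ExtDual.homEquiv y (e i)).unop • x i, ?_⟩
    apply ExtDual.homEquiv.injective
    ext1 g
    rw [homEquiv_bidual]
    conv_rhs => rw [he g]
    rw [map_sum, map_sum, Finset.op_sum]
    refine Finset.sum_congr rfl fun i _ => ?_
    rw [map_smul, map_smul]
    rfl

end Bidual

/-! ### Finite projective resolutions -/

/-- A resolution by finite projective modules, cut into short exact sequences
`0 → X (n + 1) → P n → X n → 0`. -/
structure FinRes (R : Type u) [Ring R] where
  X : ℕ → Type u
  P : ℕ → Type u
  [acgX : ∀ n, AddCommGroup (X n)]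
  [modX : ∀ n, Module R (X n)]
  [acgP : ∀ n, AddCommGroup (P n)]
  [modP : ∀ n, Module R (P n)]
  [finX : ∀ n, Module.Finite R (X n)]
  [finP : ∀ n, Module.Finite R (P n)]
  [projP : ∀ n, Module.Projective R (P n)]
  i : ∀ n, X (n + 1) →ₗ[R] P n
  p : ∀ n, P n →ₗ[R] X n
  hi : ∀ n, Function.Injective (i n)
  hp : ∀ n, Function.Surjective (p n)
  hip : ∀ n, Function.Exact (i n) (p n)

attribute [instance] FinRes.acgX FinRes.modX FinRes.acgP FinRes.modP FinRes.finX FinRes.finP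
  FinRes.projP

/-- Iterates the finite presentation on successive kernels, which stay finite by noetherianity.
Finiteness is bundled with the module so that the recursion can carry it. -/
theorem exists_finRes {R : Type u} [Ring R] [IsNoetherianRing R] (N : Type u) [AddCommGroup N]
    [Module R N] [Module.Finite R N] : ∃ F : FinRes R, Nonempty (F.X 0 ≃ₗ[R] N) := by
  choose K P a b c d i p h₁ h₂ h₃ h₄ h₅ h₆ using
    fun M : {M : ModuleCat.{u} R // Module.Finite R M} =>
      haveI := M.2
      exists_finite_presentation (R := R) M.1
  let T : ℕ → {M : ModuleCat.{u} R // Module.Finite R M} := fun n =>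
    Nat.rec ⟨ModuleCat.of R N, inferInstance⟩ (fun _ M => ⟨@ModuleCat.of R _ (K M) (a M) (b M), h₃ M⟩) n
  exact ⟨@FinRes.mk R _ (fun n => (T n).1) (fun n => P (T n)) (fun n => inferInstance)
    (fun n => inferInstance) (fun n => c (T n)) (fun n => d (T n)) (fun n => (T n).2)
    (fun n => h₂ (T n)) (fun n => h₁ (T n)) (fun n => i (T n)) (fun n => p (T n))
    (fun n => h₄ (T n)) (fun n => h₅ (T n)) (fun n => h₆ (T n)), ⟨LinearEquiv.refl R N⟩⟩

namespace ExtDual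

variable {R : Type u} [Ring R]
variable {N N' N'' : Type u} [AddCommGroup N] [Module R N] [AddCommGroup N'] [Module R N']
  [AddCommGroup N''] [Module R N'']
variable {f : N →ₗ[R] N'} {g : N' →ₗ[R] N''} (hf : Function.Injective f)
  (hg : Function.Surjective g) (hfg : Function.Exact f g)

theorem δ_surjective_of_projective [Module.Projective R N'] (l : ℕ) :
    Function.Surjective (δ hf hg hfg l) := fun y =>
  haveI := subsingleton_of_projective (R := R) (N := N') l
  (exact_δ_pre hf hg hfg l y).1 (Subsingleton.elim _ _)

theorem δ_injective_of_projective [Module.Projective R N'] (l : ℕ) :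
    Function.Injective (δ hf hg hfg (l + 1)) := by
  have := subsingleton_of_projective (R := R) (N := N') l
  refine (injective_iff_map_eq_zero _).2 fun x hx => ?_
  obtain ⟨y, rfl⟩ := (exact_pre_δ hf hg hfg (l + 1) x).1 hx
  rw [Subsingleton.elim y 0, map_zero]

/-- Dimension shifting. -/
def shift [Module.Projective R N'] (l : ℕ) : ExtDual R N (l + 1) ≃ₗ[Rᵐᵒᵖ] ExtDual R N'' (l + 2) :=
  LinearEquiv.ofBijective (δ hf hg hfg (l + 1))
    ⟨δ_injective_of_projective hf hg hfg l, δ_surjective_of_projective hf hg hfg (l + 1)⟩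

end ExtDual

/-! ### Vanishing of homomorphisms into `Ext^i_R(Y, R)` -/

section ExtVanishing

variable {T : Type u} [Ring T] {L : Type u} [AddCommGroup L] [Module T L]

theorem ExtM.post_sum {B B' : Type u} [AddCommGroup B] [Module T B] [AddCommGroup B'] [Module T B']
    {k : ℕ} (f : Fin k → B →ₗ[T] B') (l : ℕ) (x : ExtM T L B l) :
    post L l (∑ i, f i) x = ∑ i, post L l (f i) x :=
  map_sum (AddMonoidHom.mk' (fun g : B →ₗ[T] B' => post L l g x) fun _ _ => post_add l _ _ x)
    f Finset.univ

/-- A dual basis writes the identity of `P` as a sum of maps factoring through `T`. -/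
theorem ExtM.subsingleton_of_finite_projective {k : ℕ} (h : Subsingleton (ExtM T L T k))
    (P : Type u) [AddCommGroup P] [Module T P] [Module.Finite T P] [Module.Projective T P] :
    Subsingleton (ExtM T L P k) := by
  obtain ⟨n, x, f, hf⟩ := exists_dual_basis (R := T) P
  have e : ∑ i, (LinearMap.toSpanSingleton T P (x i)) ∘ₗ f i = LinearMap.id := by
    ext p
    simp [hf]
  refine subsingleton_of_forall_eq 0 fun y => ?_
  rw [← ExtM.post_id k y, ← e, ExtM.post_sum]
  refine Finset.sum_eq_zero fun i _ => ?_
  rw [ExtM.post_comp, Subsingleton.elim (ExtM.post L k (f i) y) 0, map_zero]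

end ExtVanishing

namespace FinRes

variable {R : Type u} [Ring R] (F : FinRes R)

/-- Dimension shifting along a resolution. -/
theorem nonempty_shift (k m n : ℕ) (h : n = m + k) :
    Nonempty (ExtDual R (F.X k) (m + 1) ≃ₗ[Rᵐᵒᵖ] ExtDual R (F.X 0) (n + 1)) := by
  induction k generalizing m with
  | zero => obtain rfl : n = m := h; exact ⟨LinearEquiv.refl _ _⟩
  | succ k ih =>
    obtain ⟨e⟩ := ih (m + 1) (by omega)
    exact ⟨(ExtDual.shift (F.hi k) (F.hp k) (F.hip k) m).trans e⟩

/-- There is no nonzero map from a module of grade at least `i + 1` to `Ext^i_R(Y, R)` if `Y` has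
grade at least `i`. -/
theorem hom_eq_zero (i : ℕ) (hY : GradeGE R (F.X 0) i) {L : Type u} [AddCommGroup L]
    [Module Rᵐᵒᵖ L] (hL : GradeGE Rᵐᵒᵖ L (i + 1)) (f : L →ₗ[Rᵐᵒᵖ] ExtDual R (F.X 0) i) : f = 0 := by
  have h1 : ∀ k j, k ≤ i → Subsingleton (ExtM Rᵐᵒᵖ L (ExtDual R (F.P j) 0) k) := fun k j hk =>
    ExtM.subsingleton_of_finite_projective (hL k (by omega)) _
  -- The dual of `X j` sits inside that of `P j`, which receives no nonzero map from `L`.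
  have h0 : ∀ j, ∀ t : L →ₗ[Rᵐᵒᵖ] ExtDual R (F.X j) 0, t = 0 := by
    intro j t
    have := h1 0 j (Nat.zero_le _)
    have e : ExtDual.pre 0 (F.p j) ∘ₗ t = 0 := by
      apply (ExtM.homEquiv (R := Rᵐᵒᵖ) (N := L) (B := ExtDual R (F.P j) 0)).symm.injective
      exact Subsingleton.elim _ _
    ext x : 1
    exact ExtDual.pre_injective_of_surjective (F.hp j)
      ((LinearMap.congr_fun e x).trans (map_zero _).symm)
  cases i with
  | zero => exact h0 0 f
  | succ i =>
    -- Below the grade of `X 0` the dual complex is exact, so the duals of the `X j` are linked by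
    -- short exact sequences with middle terms the duals of the `P j`. Vanishing then propagates
    -- from the zero dual of `X 0`, each step costing one degree.
    have h2 : ∀ j k, j ≤ i → k + j ≤ i + 2 →
        Subsingleton (ExtM Rᵐᵒᵖ L (ExtDual R (F.X j) 0) k) := by
      intro j
      induction j with
      | zero =>
        intro k _ _
        have := hY 0 (by omega)
        refine subsingleton_of_forall_eq 0 fun y => ?_
        rw [← ExtM.post_id k y]
        have : (LinearMap.id : ExtDual R (F.X 0) 0 →ₗ[Rᵐᵒᵖ] _) = 0 :=
          LinearMap.ext fun x => Subsingleton.elim _ _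
        rw [this, ExtM.post_zero]
      | succ j ih =>
        intro k hj hk
        have s₁ := h1 k j (by omega)
        have s₂ := ih (k + 1) (by omega) (by omega)
        have s₃ : Subsingleton (ExtDual R (F.X j) 1) := by
          obtain ⟨e⟩ := F.nonempty_shift j 0 j (by omega)
          have := hY (j + 1) (by omega)
          exact e.toEquiv.subsingleton
        have hs : Function.Surjective (ExtDual.pre 0 (F.i j)) := fun y =>
          (ExtDual.exact_pre_δ (F.hi j) (F.hp j) (F.hip j) 0 y).1 (Subsingleton.elim _ _)
        exact (ExtM.exact_post_δ' (ExtDual.pre_injective_of_surjective (F.hp j)) hs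
          (ExtDual.exact_pre_pre (F.hi j) (F.hp j) (F.hip j) 0) k).subsingleton
    obtain ⟨e⟩ := F.nonempty_shift i 0 i (by omega)
    let D := ExtDual.pre 0 (F.i i)
    have s₁ : Subsingleton (ExtM Rᵐᵒᵖ L (LinearMap.range D) 1) := by
      have s₁ := h1 1 i (by omega)
      have s₂ := h2 i 2 le_rfl (by omega)
      refine (ExtM.exact_post_δ' (ExtDual.pre_injective_of_surjective (F.hp i))
        D.surjective_rangeRestrict ?_ 1).subsingleton
      intro x
      rw [← ExtDual.exact_pre_pre (F.hi i) (F.hp i) (F.hip i) 0 x, ← Subtype.coe_inj]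
      rfl
    let δ := ExtDual.δ (F.hi i) (F.hp i) (F.hip i) 0
    have hδ : Function.Surjective δ := ExtDual.δ_surjective_of_projective _ _ _ 0
    have hex : Function.Exact (LinearMap.range D).subtype δ := by
      intro x
      rw [ExtDual.exact_pre_δ (F.hi i) (F.hp i) (F.hip i) 0 x]
      simp [D]
    -- Since `Ext^1(L, range D) = 0`, the map `f` lifts to the dual of `X (i + 1)`, where `h0` kills
    -- it.
    have := ExtM.exact_post_δ' (N := L) (Submodule.injective_subtype _) hδ hex 0
      (ExtM.homEquiv.symm (e.symm.toLinearMap ∘ₗ f))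
    obtain ⟨y, hy⟩ := this.1 (Subsingleton.elim _ _)
    have hy' := congrArg ExtM.homEquiv hy
    rw [ExtM.homEquiv_post, h0 (i + 1) (ExtM.homEquiv y), LinearMap.comp_zero,
      AddEquiv.apply_symm_apply] at hy'
    ext x : 1
    have := LinearMap.congr_fun hy' x
    exact e.symm.injective (this.symm.trans (map_zero _).symm)

end FinRes

theorem ExtDual.hom_eq_zero {R : Type u} [Ring R] [IsNoetherianRing R] {Y : Type u}
    [AddCommGroup Y] [Module R Y] [Module.Finite R Y] (i : ℕ) (hY : GradeGE R Y i) {L : Type u}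
    [AddCommGroup L] [Module Rᵐᵒᵖ L] (hL : GradeGE Rᵐᵒᵖ L (i + 1))
    (f : L →ₗ[Rᵐᵒᵖ] ExtDual R Y i) : f = 0 := by
  obtain ⟨F, ⟨e⟩⟩ := exists_finRes (R := R) Y
  have := F.hom_eq_zero i (hY.congr e.symm) hL ((ExtDual.congr i e).toLinearMap ∘ₗ f)
  ext x : 1
  exact (ExtDual.congr i e).injective ((LinearMap.congr_fun this x).trans (map_zero _).symm)

/-! ### The dual filtration of a finite module -/

namespace FinRes

variable {R : Type u} [Ring R] (F : FinRes R)

/-- The differential of the dual complex. -/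
abbrev D (k : ℕ) : ExtDual R (F.P k) 0 →ₗ[Rᵐᵒᵖ] ExtDual R (F.P (k + 1)) 0 :=
  ExtDual.pre 0 (F.i k ∘ₗ F.p (k + 1))

theorem D_apply (k : ℕ) (x : ExtDual R (F.P k) 0) :
    F.D k x = ExtDual.pre 0 (F.p (k + 1)) (ExtDual.pre 0 (F.i k) x) :=
  ExtDual.pre_comp 0 _ _ x

/-- The cokernel of a differential of the dual complex. -/
abbrev C (k : ℕ) : Type u := ExtDual R (F.P (k + 1)) 0 ⧸ LinearMap.range (F.D k)

theorem pre_i_pre_p (k : ℕ) (x : ExtDual R (F.X k) 0) :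
    ExtDual.pre 0 (F.i k) (ExtDual.pre 0 (F.p k) x) = 0 := by
  rw [← ExtDual.pre_comp, (F.hip k).linearMap_comp_eq_zero, ExtDual.pre_zero]

theorem D_D (k : ℕ) (x : ExtDual R (F.P k) 0) : F.D (k + 1) (F.D k x) = 0 := by
  rw [D_apply, D_apply, pre_i_pre_p, map_zero]

theorem pre_p_injective (k : ℕ) : Function.Injective (ExtDual.pre 0 (F.p k)) :=
  ExtDual.pre_injective_of_surjective (F.hp k)

/-- The differential, as a surjection from the cokernel of the previous one onto its image. -/
def b (k : ℕ) : F.C k →ₗ[Rᵐᵒᵖ] LinearMap.range (F.D (k + 1)) :=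
  (LinearMap.range (F.D k)).liftQ (F.D (k + 1)).rangeRestrict (by
    rintro _ ⟨x, rfl⟩
    exact Subtype.ext (F.D_D k x))

theorem b_mk (k : ℕ) (x : ExtDual R (F.P (k + 1)) 0) :
    (F.b k (Submodule.Quotient.mk x) : ExtDual R (F.P (k + 2)) 0) = F.D (k + 1) x := rfl

theorem b_surjective (k : ℕ) : Function.Surjective (F.b k) := by
  rintro ⟨_, x, rfl⟩
  exact ⟨Submodule.Quotient.mk x, rfl⟩

/-- `Ext^1(X k, R)` is the cohomology of the dual complex at the dual of `P (k + 1)`: the kernel of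
the outgoing differential is the dual of `X (k + 1)`, and `δ` divides it by the image of the dual of
`P k`. -/
theorem exists_a (k : ℕ) : ∃ a : ExtDual R (F.X k) 1 →ₗ[Rᵐᵒᵖ] F.C k,
    Function.Injective a ∧ Function.Exact a (F.b k) := by
  let δ := ExtDual.δ (F.hi k) (F.hp k) (F.hip k) 0
  have hδ : Function.Surjective δ := ExtDual.δ_surjective_of_projective _ _ _ 0
  have hex := ExtDual.exact_pre_δ (F.hi k) (F.hp k) (F.hip k) 0
  obtain ⟨a, ha⟩ := LinearMap.exists_factor (f := (LinearMap.range (F.D k)).mkQ ∘ₗ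
    ExtDual.pre 0 (F.p (k + 1))) hδ (by
      intro x hx
      obtain ⟨y, rfl⟩ := (hex x).1 hx
      exact (Submodule.Quotient.mk_eq_zero _).2 ⟨y, F.D_apply k y⟩)
  refine ⟨a, (injective_iff_map_eq_zero _).2 fun x hx => ?_, fun x => ⟨fun hx => ?_, ?_⟩⟩
  · obtain ⟨y, rfl⟩ := hδ x
    rw [ha] at hx
    obtain ⟨z, hz⟩ := (Submodule.Quotient.mk_eq_zero _).1 hx
    rw [D_apply] at hz
    exact (hex y).2 ⟨z, F.pre_p_injective _ hz⟩
  · obtain ⟨y, rfl⟩ := Submodule.Quotient.mk_surjective _ x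
    have h1 := congrArg Subtype.val hx
    rw [b_mk, D_apply] at h1
    have h2 := F.pre_p_injective (k + 2) (h1.trans (map_zero _).symm)
    obtain ⟨z, rfl⟩ := (ExtDual.exact_pre_pre (F.hi _) (F.hp _) (F.hip (k + 1)) 0 y).1 h2
    exact ⟨δ z, ha z⟩
  · rintro ⟨y, rfl⟩
    obtain ⟨z, rfl⟩ := hδ y
    rw [ha]
    apply Subtype.ext
    refine (F.b_mk k _).trans ?_
    rw [D_apply, pre_i_pre_p, map_zero]
    rfl

theorem exact_subtype_mkQ (k : ℕ) :
    Function.Exact (LinearMap.range (F.D k)).subtype (LinearMap.range (F.D k)).mkQ :=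
  LinearMap.exact_subtype_mkQ _

/-- `Ext^{l+1}` of the image of a differential is `Ext^{l+2}` of the cokernel. -/
def shiftC (k l : ℕ) : ExtDual Rᵐᵒᵖ (LinearMap.range (F.D k)) (l + 1) ≃ₗ[Rᵐᵒᵖᵐᵒᵖ]
    ExtDual Rᵐᵒᵖ (F.C k) (l + 2) :=
  ExtDual.shift (Submodule.injective_subtype _) (Submodule.mkQ_surjective _)
    (F.exact_subtype_mkQ k) l

/-- This is the long exact sequence of `0 → Ext^{k+1}(X 0, R) → C k → range (D (k + 1)) → 0`, with
the first term rewritten by dimension shifting and `Ext` of the range rewritten by `shiftC`. The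
hypothesis `hE` is what makes `g` injective; over an Auslander regular ring it is a grade bound. -/
theorem exists_succ_step (k : ℕ)
    (hE : Subsingleton (ExtDual Rᵐᵒᵖ (ExtDual R (F.X 0) (k + 1)) k)) :
    ∃ (g : ExtDual Rᵐᵒᵖ (F.C (k + 1)) (k + 2) →ₗ[Rᵐᵒᵖᵐᵒᵖ] ExtDual Rᵐᵒᵖ (F.C k) (k + 1))
      (q : ExtDual Rᵐᵒᵖ (F.C k) (k + 1) →ₗ[Rᵐᵒᵖᵐᵒᵖ] ExtExt R (F.X 0) (k + 1))
      (t : ExtExt R (F.X 0) (k + 1) →ₗ[Rᵐᵒᵖᵐᵒᵖ] ExtDual Rᵐᵒᵖ (F.C (k + 1)) (k + 3)),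
      Function.Injective g ∧ Function.Exact g q ∧ Function.Exact q t := by
  obtain ⟨a₀, ha₀, hab₀⟩ := F.exists_a k
  obtain ⟨e⟩ := F.nonempty_shift k 0 k (by omega)
  let a := a₀ ∘ₗ e.symm.toLinearMap
  have ha : Function.Injective a := ha₀.comp e.symm.injective
  have hab : Function.Exact a (F.b k) := by
    intro x
    rw [hab₀ x]
    constructor
    · rintro ⟨y, rfl⟩
      exact ⟨e y, by simp [a]⟩
    · rintro ⟨y, rfl⟩
      exact ⟨e.symm y, rfl⟩
  have hb := F.b_surjective k
  let s := F.shiftC (k + 1) k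
  let s' := F.shiftC (k + 1) (k + 1)
  refine ⟨ExtDual.pre (k + 1) (F.b k) ∘ₗ s.symm.toLinearMap, ExtDual.pre (k + 1) a,
    s'.toLinearMap ∘ₗ ExtDual.δ ha hb hab (k + 1), ?_, ?_, ?_⟩
  · change Function.Injective (⇑(ExtDual.pre (k + 1) (F.b k)) ∘ ⇑s.symm)
    refine Function.Injective.comp ?_ s.symm.injective
    refine (injective_iff_map_eq_zero _).2 fun x hx => ?_
    obtain ⟨y, rfl⟩ := (ExtDual.exact_δ_pre ha hb hab k x).1 hx
    rw [Subsingleton.elim y 0, map_zero]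
  · intro x
    rw [ExtDual.exact_pre_pre ha hb hab (k + 1) x]
    constructor
    · rintro ⟨y, rfl⟩
      exact ⟨s y, by simp⟩
    · rintro ⟨y, rfl⟩
      exact ⟨s.symm y, rfl⟩
  · intro x
    rw [← ExtDual.exact_pre_δ ha hb hab (k + 1) x]
    exact s'.map_eq_zero_iff

end FinRes

variable (R : Type u) [Ring R] in
/-- The isomorphism of the double opposite of `R` with `R`. -/
abbrev opOpSymm : Rᵐᵒᵖᵐᵒᵖ →+* R := ((RingEquiv.opOp R).symm : Rᵐᵒᵖᵐᵒᵖ →+* R)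

/-- The biduality map, linear over the double opposite. -/
def bidualOp {R : Type u} [Ring R] (N : Type u) [AddCommGroup N] [Module R N] :
    Rest (opOpSymm R) N →ₗ[Rᵐᵒᵖᵐᵒᵖ] ExtExt R N 0 where
  toFun := bidual N
  map_add' := map_add (bidual N)
  map_smul' r := (bidual N).map_smulₛₗ r.unop.unop

/-- The Auslander-Bridger sequence: kernel and cokernel of the biduality map are controlled by
`Ext^1` and `Ext^2` of the transpose `C 0`, since `P 0` and `P 1` are reflexive. -/
theorem FinRes.exists_zero_step {R : Type u} [Ring R] (F : FinRes R) :
    ∃ (g : ExtDual Rᵐᵒᵖ (F.C 0) 1 →ₗ[Rᵐᵒᵖᵐᵒᵖ] Rest (opOpSymm R) (F.X 0))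
      (t : ExtExt R (F.X 0) 0 →ₗ[Rᵐᵒᵖᵐᵒᵖ] ExtDual Rᵐᵒᵖ (F.C 0) 2),
      Function.Injective g ∧ Function.Exact g (bidualOp (F.X 0)) ∧
        Function.Exact (bidualOp (F.X 0)) t := by
  -- `0 → X₀* → P₀* → B → 0` and `0 → B → P₁* → C₀ → 0`
  let r := (F.D 0).rangeRestrict
  have hr : Function.Surjective r := (F.D 0).surjective_rangeRestrict
  have hpi := F.pre_p_injective 0
  have hex : Function.Exact (ExtDual.pre 0 (F.p 0)) r := by
    intro x
    rw [← ExtDual.exact_pre_pre (F.hi 0) (F.hp 0) (F.hip 0) 0 x, ← Subtype.coe_inj]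
    change F.D 0 x = 0 ↔ _
    rw [F.D_apply]
    exact map_eq_zero_iff _ (F.pre_p_injective 1)
  have hs := Submodule.injective_subtype (LinearMap.range (F.D 0))
  have hm := Submodule.mkQ_surjective (LinearMap.range (F.D 0))
  have hsm := F.exact_subtype_mkQ 0
  let δ := ExtDual.δ hs hm hsm 0
  have hδ : Function.Surjective δ := ExtDual.δ_surjective_of_projective hs hm hsm 0
  have hδex := ExtDual.exact_pre_δ hs hm hsm 0
  let bP (k : ℕ) : Rest (opOpSymm R) (F.P k) ≃ₗ[Rᵐᵒᵖᵐᵒᵖ] ExtExt R (F.P k) 0 :=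
    LinearEquiv.ofBijective (bidualOp (F.P k)) (bidual_bijective (F.P k))
  have hbP (k : ℕ) (x : F.P k) : bP k x = bidual (F.P k) x := rfl
  -- The dual of the image of `D 0` lies in the bidual of `P 0`, that is in `P 0`, and is projected
  -- to `X 0`. Elements coming from `P 1` die, so `h` descends to `Ext^1(C 0, R)`.
  let h : ExtDual Rᵐᵒᵖ (LinearMap.range (F.D 0)) 0 →ₗ[Rᵐᵒᵖᵐᵒᵖ] Rest (opOpSymm R) (F.X 0) :=
    Rest.map (opOpSymm R) (F.p 0) ∘ₗ (bP 0).symm.toLinearMap ∘ₗ ExtDual.pre 0 r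
  have hh (x : ExtDual Rᵐᵒᵖ (LinearMap.range (F.D 0)) 0) (y : F.P 0)
      (e : ExtDual.pre 0 r x = bidual (F.P 0) y) : h x = F.p 0 y := by
    have : (bP 0).symm (ExtDual.pre 0 r x) = y :=
      (congrArg (bP 0).symm (e.trans (hbP 0 y).symm)).trans ((bP 0).symm_apply_apply _)
    exact congrArg (F.p 0) this
  have hlift (x : ExtExt R (F.P 0) 0) : ∃ y : F.P 0, x = bidual (F.P 0) y :=
    ⟨(bP 0).symm x, ((bP 0).apply_symm_apply x).symm⟩
  have hz (y : F.P 1) : ExtDual.pre 0 r (ExtDual.pre 0 (LinearMap.range (F.D 0)).subtype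
      (bidual (F.P 1) y)) = bidual (F.P 0) ((F.i 0 ∘ₗ F.p 1) y) := by
    rw [← ExtDual.pre_comp, ← bidual_natural]
    rfl
  have hr0 := ExtDual.pre_injective_of_surjective hr
  have hpp := ExtDual.exact_pre_pre hpi hr hex 0
  obtain ⟨g, hg⟩ := LinearMap.exists_factor (f := h) hδ (by
    intro x hx
    obtain ⟨y, rfl⟩ := (hδex x).1 hx
    obtain ⟨z, rfl⟩ := (bidual_bijective (F.P 1)).2 y
    exact (hh _ _ (hz z)).trans ((F.hip 0).apply_apply_eq_zero _))
  have hb0 (y : F.P 0) : bidual (F.X 0) (F.p 0 y) =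
      ExtDual.pre 0 (ExtDual.pre 0 (F.p 0)) (bidual (F.P 0) y) := (bidual_natural _ _).symm
  let δ' := ExtDual.δ hpi hr hex 0
  have hδ' := ExtDual.exact_pre_δ hpi hr hex 0
  refine ⟨g, (F.shiftC 0 0).toLinearMap ∘ₗ δ', ?_, ?_, ?_⟩
  · refine (injective_iff_map_eq_zero _).2 fun x hx => ?_
    obtain ⟨y, rfl⟩ := hδ x
    rw [hg] at hx
    obtain ⟨z, hz'⟩ := hlift (ExtDual.pre 0 r y)
    rw [hh y z hz'] at hx
    obtain ⟨w, rfl⟩ := (F.hip 0 z).1 hx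
    obtain ⟨v, rfl⟩ := F.hp 1 w
    refine (hδex y).2 ⟨bidual (F.P 1) v, hr0 ?_⟩
    rw [hz, hz']
    rfl
  · intro (x : F.X 0)
    obtain ⟨y, rfl⟩ := F.hp 0 x
    change bidual (F.X 0) (F.p 0 y) = 0 ↔ _
    rw [hb0, hpp]
    constructor
    · rintro ⟨z, hz'⟩
      exact ⟨δ z, (hg z).trans (hh z y hz')⟩
    · rintro ⟨z, hz'⟩
      obtain ⟨w, rfl⟩ := hδ z
      obtain ⟨v, hv⟩ := hlift (ExtDual.pre 0 r w)
      rw [hg, hh w v hv] at hz'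
      have h1 : F.p 0 (y - v) = 0 := by rw [map_sub]; exact sub_eq_zero.2 hz'.symm
      obtain ⟨a, ha⟩ := (F.hip 0 _).1 h1
      obtain ⟨c, rfl⟩ := F.hp 1 a
      refine ⟨w + ExtDual.pre 0 (LinearMap.range (F.D 0)).subtype (bidual (F.P 1) c), ?_⟩
      rw [map_add, hz, hv, ← map_add]
      congr 1
      rw [LinearMap.comp_apply, ha]
      abel
  · intro x
    rw [LinearMap.comp_apply]
    refine ((F.shiftC 0 0).map_eq_zero_iff).trans ((hδ' x).trans ?_)
    constructor
    · rintro ⟨y, rfl⟩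
      obtain ⟨z, rfl⟩ := hlift y
      exact ⟨F.p 0 z, hb0 z⟩
    · rintro ⟨y, rfl⟩
      obtain ⟨z, rfl⟩ := F.hp 0 y
      exact ⟨bidual (F.P 0) z, (hb0 z).symm⟩

/-! ### Modules over Auslander regular rings -/

section AuslanderRegular

variable {R : Type u} [Ring R]

theorem ExtDual.subsingleton_of_subsingleton {N : Type u} [AddCommGroup N] [Module R N]
    [Subsingleton N] (l : ℕ) : Subsingleton (ExtDual R N l) :=
  gradeGE_of_subsingleton (R := R) (N := N) (l + 1) l (Nat.lt_succ_self l)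

theorem GlobalDimensionLE.op {d : ℕ} (h : GlobalDimensionLE R d) {l : ℕ} (hl : d < l)
    (N : Type u) [AddCommGroup N] [Module Rᵐᵒᵖ N] : Subsingleton (ExtDual Rᵐᵒᵖ N l) :=
  ExtM.subsingleton_of_projectiveDimensionLE (h.2 _) hl

namespace IsAuslanderRegular

variable (hR : IsAuslanderRegular R)
include hR

theorem gradeGE_of_injective_extDual {N : Type u} [AddCommGroup N] [Module R N]
    [Module.Finite R N] {l : ℕ} {L : Type u} [AddCommGroup L] [Module Rᵐᵒᵖ L]
    (f : L →ₗ[Rᵐᵒᵖ] ExtDual R N l) (hf : Function.Injective f) : GradeGE Rᵐᵒᵖ L l :=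
  (le_moduleGrade_iff.1 ((hR.regular_left N).2 l (LinearMap.range f))).congr
    (LinearEquiv.ofInjective f hf).symm

theorem gradeGE_of_injective_extDual_op {N : Type u} [AddCommGroup N] [Module Rᵐᵒᵖ N]
    [Module.Finite Rᵐᵒᵖ N] {l : ℕ} {L : Type u} [AddCommGroup L] [Module Rᵐᵒᵖᵐᵒᵖ L]
    (f : L →ₗ[Rᵐᵒᵖᵐᵒᵖ] ExtDual Rᵐᵒᵖ N l) (hf : Function.Injective f) : GradeGE Rᵐᵒᵖᵐᵒᵖ L l :=
  (le_moduleGrade_iff.1 ((hR.regular_right N).2 l (LinearMap.range f))).congr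
    (LinearEquiv.ofInjective f hf).symm

theorem gradeGE_extDual (N : Type u) [AddCommGroup N] [Module R N] [Module.Finite R N] (l : ℕ) :
    GradeGE Rᵐᵒᵖ (ExtDual R N l) l :=
  hR.gradeGE_of_injective_extDual LinearMap.id Function.injective_id

/-- Descends through the chain of the `Ext^{k+1}(C k, R)` inside `X 0`: at each step the map from
`L` to the next double `Ext` module vanishes, so `L` falls into the next term. -/
theorem exists_injective_extDual (F : FinRes R) {L : Type u} [AddCommGroup L]
    [Module Rᵐᵒᵖᵐᵒᵖ L] (f : L →ₗ[Rᵐᵒᵖᵐᵒᵖ] Rest (opOpSymm R) (F.X 0)) (hf : Function.Injective f)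
    (k : ℕ) (H : ∀ i ≤ k, ∀ t : L →ₗ[Rᵐᵒᵖᵐᵒᵖ] ExtExt R (F.X 0) i, t = 0) :
    ∃ s : L →ₗ[Rᵐᵒᵖᵐᵒᵖ] ExtDual Rᵐᵒᵖ (F.C k) (k + 1), Function.Injective s := by
  have lift : ∀ {G G' E : Type u} [AddCommGroup G] [Module Rᵐᵒᵖᵐᵒᵖ G] [AddCommGroup G']
      [Module Rᵐᵒᵖᵐᵒᵖ G'] [AddCommGroup E] [Module Rᵐᵒᵖᵐᵒᵖ E] (g : G' →ₗ[Rᵐᵒᵖᵐᵒᵖ] G)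
      (q : G →ₗ[Rᵐᵒᵖᵐᵒᵖ] E) (_ : Function.Injective g) (_ : Function.Exact g q)
      (s : L →ₗ[Rᵐᵒᵖᵐᵒᵖ] G) (_ : Function.Injective s) (_ : q ∘ₗ s = 0),
      ∃ s' : L →ₗ[Rᵐᵒᵖᵐᵒᵖ] G', Function.Injective s' := by
    intro G G' E _ _ _ _ _ _ g q hg hgq s hs h0
    have hr : ∀ x, s x ∈ LinearMap.range g := fun x => (hgq _).1 (LinearMap.congr_fun h0 x)
    refine ⟨(LinearEquiv.ofInjective g hg).symm.toLinearMap ∘ₗ s.codRestrict _ hr, ?_⟩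
    have hc : Function.Injective (s.codRestrict _ hr) :=
      fun x y h => hs (congrArg (fun z : LinearMap.range g => (z : G)) h)
    exact (LinearEquiv.ofInjective g hg).symm.injective.comp hc
  induction k with
  | zero =>
    obtain ⟨g, -, hg, hgq, -⟩ := F.exists_zero_step
    exact lift g _ hg hgq f hf (H 0 le_rfl _)
  | succ k ih =>
    obtain ⟨s, hs⟩ := ih fun i hi => H i (by omega)
    obtain ⟨g, q, -, hg, hgq, -⟩ := F.exists_succ_step k
      (hR.gradeGE_extDual (F.X 0) (k + 1) k (by omega))
    exact lift g q hg hgq s hs (H (k + 1) le_rfl _)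

/-- Composes the inclusions of the chain, so that each term becomes a submodule of `X 0`. -/
theorem exists_injective_rest (F : FinRes R) (k : ℕ) :
    ∃ s : ExtDual Rᵐᵒᵖ (F.C k) (k + 1) →ₗ[Rᵐᵒᵖᵐᵒᵖ] Rest (opOpSymm R) (F.X 0),
      Function.Injective s := by
  induction k with
  | zero =>
    obtain ⟨g, -, hg, -⟩ := F.exists_zero_step
    exact ⟨g, hg⟩
  | succ k ih =>
    obtain ⟨s, hs⟩ := ih
    obtain ⟨g, q, -, hg, hgq, -⟩ := F.exists_succ_step k
      (hR.gradeGE_extDual (F.X 0) (k + 1) k (by omega))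
    exact ⟨s ∘ₗ g, hs.comp hg⟩

variable {N N' N'' : Type u} [AddCommGroup N] [Module R N] [AddCommGroup N'] [Module R N']
  [AddCommGroup N''] [Module R N'']

/-- If `N` has grade at least `k + 1`, its double `Ext` modules vanish up to `k`. Hence `N'` embeds
into `Ext^{k+1}(C k, R)`, and the Auslander condition for the opposite ring bounds its grade. -/
theorem gradeGE_of_injective [Module.Finite R N] {l : ℕ} (h : GradeGE R N l) (f : N' →ₗ[R] N)
    (hf : Function.Injective f) : GradeGE R N' l := by
  cases l with
  | zero => exact fun i hi => absurd hi (Nat.not_lt_zero i)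
  | succ k =>
    have := hR.noetherian_left
    have := hR.noetherian_right
    obtain ⟨F, ⟨e⟩⟩ := exists_finRes (R := R) N
    have hX := h.congr e.symm
    rw [← gradeGE_rest_iff (RingEquiv.opOp R).symm N']
    obtain ⟨s, hs⟩ := hR.exists_injective_extDual F
      (L := Rest (opOpSymm R) N') (Rest.map (opOpSymm R) (e.symm.toLinearMap ∘ₗ f))
      (e.symm.injective.comp hf) k fun i hi t => by
        have := hX i (by omega)
        have := ExtDual.subsingleton_of_subsingleton (R := Rᵐᵒᵖ) (N := ExtDual R (F.X 0) i) i
        exact LinearMap.ext fun x => Subsingleton.elim _ _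
    exact hR.gradeGE_of_injective_extDual_op s hs

theorem gradeGE_of_surjective [Module.Finite R N] {l : ℕ} (h : GradeGE R N l) (f : N →ₗ[R] N')
    (hf : Function.Surjective f) : GradeGE R N' l :=
  (hR.gradeGE_of_injective h _ (LinearMap.ker f).injective_subtype).quotient
    (LinearMap.ker f).injective_subtype hf (LinearMap.exact_subtype_ker_map f) h

/-- A submodule of grade at least `l` has no nonzero map to `Ext^i(Ext^i(N, R), R)`: for `i ≥ l` the
target is zero, for `i < l` grades forbid it. It therefore embeds into `Ext^{d+1}(C d, R)`, which is
zero. -/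
theorem subsingleton_of_extExt {d : ℕ} (hd : GlobalDimensionLE R d) [Module.Finite R N] {l : ℕ}
    (hN : ∀ i, l ≤ i → Subsingleton (ExtExt R N i)) (f : N' →ₗ[R] N) (hf : Function.Injective f)
    (h : GradeGE R N' l) : Subsingleton N' := by
  have := hR.noetherian_left
  have := hR.noetherian_right
  obtain ⟨F, ⟨e⟩⟩ := exists_finRes (R := R) N
  obtain ⟨s, hs⟩ := hR.exists_injective_extDual F
    (L := Rest (opOpSymm R) N') (Rest.map (opOpSymm R) (e.symm.toLinearMap ∘ₗ f))
    (e.symm.injective.comp hf) d fun i hi t => by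
      by_cases hil : l ≤ i
      · have := hN i hil
        have := (ExtDual.congr i (ExtDual.congr i e)).toEquiv.subsingleton_congr.2 this
        exact LinearMap.ext fun x => Subsingleton.elim _ _
      · refine ExtDual.hom_eq_zero i (hR.gradeGE_extDual (F.X 0) i) ?_ t
        exact ((gradeGE_rest_iff (RingEquiv.opOp R).symm N' l).2 h).mono (by omega)
  have := hd.op (Nat.lt_succ_self d) (F.C d)
  exact hs.subsingleton

/-- The converse of `subsingleton_of_extExt`. The term `Ext^{i+1}(C i, R)` is a submodule of `N` of
large grade, hence zero, and the double `Ext` embeds into `Ext^{i+3}(C (i + 1), R)`. Its grade is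
then too large for its identity map to be nonzero. -/
theorem extExt_subsingleton [Module.Finite R N] {l : ℕ}
    (hN : ∀ (L : Type u) [AddCommGroup L] [Module R L] (f : L →ₗ[R] N), Function.Injective f →
      GradeGE R L l → Subsingleton L) (i : ℕ) (hi : l ≤ i) : Subsingleton (ExtExt R N i) := by
  have := hR.noetherian_left
  have := hR.noetherian_right
  cases i with
  | zero =>
    have := hN N LinearMap.id Function.injective_id fun i hi' => by omega
    have := ExtDual.subsingleton_of_subsingleton (R := R) (N := N) 0
    exact ExtDual.subsingleton_of_subsingleton 0
  | succ i =>
    obtain ⟨F, ⟨e⟩⟩ := exists_finRes (R := R) N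
    obtain ⟨s, hs⟩ := hR.exists_injective_rest F i
    let G := ExtDual Rᵐᵒᵖ (F.C i) (i + 1)
    let s' : Rest (opOpHom R) G →ₗ[R] F.X 0 :=
      { toFun := s, map_add' := map_add s, map_smul' := fun r x => s.map_smul (opOpHom R r) x }
    have hG : Subsingleton G := by
      refine hN (Rest (opOpHom R) G) (e.toLinearMap ∘ₗ s') (e.injective.comp hs) ?_
      refine GradeGE.mono ((gradeGE_rest_iff (RingEquiv.opOp R) G _).2 ?_) hi
      exact hR.gradeGE_of_injective_extDual_op LinearMap.id Function.injective_id
    obtain ⟨g, q, t, -, -, hqt⟩ := F.exists_succ_step i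
      (hR.gradeGE_extDual (F.X 0) (i + 1) i (by omega))
    have ht : Function.Injective t := (injective_iff_map_eq_zero _).2 fun x hx => by
      obtain ⟨y, rfl⟩ := (hqt x).1 hx
      exact (congrArg q (hG.elim y 0)).trans (map_zero q)
    have hid := ExtDual.hom_eq_zero (i + 1) (hR.gradeGE_extDual (F.X 0) (i + 1))
      ((hR.gradeGE_of_injective_extDual_op t ht).mono (Nat.le_succ _)) LinearMap.id
    have : Subsingleton (ExtExt R (F.X 0) (i + 1)) :=
      subsingleton_of_forall_eq 0 fun x => LinearMap.congr_fun hid x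
    exact (ExtDual.congr _ (ExtDual.congr _ e)).toEquiv.subsingleton_congr.1 this

theorem gradeGE_sup [Module.Finite R N] {l : ℕ} {L L' : Submodule R N} (h : GradeGE R L l)
    (h' : GradeGE R L' l) : GradeGE R (L ⊔ L' : Submodule R N) l := by
  have := hR.noetherian_left
  have hp : GradeGE R (L × L') l := GradeGE.extension LinearMap.inl_injective
    LinearMap.snd_surjective Function.Exact.inl_snd h h'
  have hr : LinearMap.range (L.subtype.coprod L'.subtype) = L ⊔ L' := by
    rw [LinearMap.range_coprod, Submodule.range_subtype, Submodule.range_subtype]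
  have := hR.gradeGE_of_surjective hp (L.subtype.coprod L'.subtype).rangeRestrict
    (LinearMap.surjective_rangeRestrict _)
  rw [hr] at this
  exact this

/-- Submodules of grade at least `l` are closed under finite sums, and in a noetherian module the
supremum of such a family belongs to it. -/
theorem gradeGE_dimFiltration [Module.Finite R N] (l : ℕ) :
    GradeGE R (dimFiltration R N l) l := by
  have := hR.noetherian_left
  have key := CompleteLattice.WellFoundedGT.isSupClosedCompact (Submodule R N) inferInstance
    {L : Submodule R N | (l : ℕ∞) ≤ moduleGrade R L}
    ⟨⊥, le_moduleGrade_iff.2 (gradeGE_of_subsingleton l)⟩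
    fun L hL L' hL' => le_moduleGrade_iff.2
      (hR.gradeGE_sup (le_moduleGrade_iff.1 hL) (le_moduleGrade_iff.1 hL'))
  exact le_moduleGrade_iff.1 key

omit hR in
theorem le_dimFiltration {l : ℕ} {L : Submodule R N} (h : GradeGE R L l) :
    L ≤ dimFiltration R N l :=
  le_sSup (le_moduleGrade_iff.2 h)

theorem gradeGE_iff_le_dimFiltration [Module.Finite R N] {l : ℕ} {L : Submodule R N} :
    GradeGE R L l ↔ L ≤ dimFiltration R N l := by
  have := hR.noetherian_left
  exact ⟨le_dimFiltration, fun h => hR.gradeGE_of_injective (hR.gradeGE_dimFiltration l)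
    (Submodule.inclusion h) (Submodule.inclusion_injective h)⟩

theorem dimFiltration_succ_le [Module.Finite R N] (l : ℕ) :
    dimFiltration R N (l + 1) ≤ dimFiltration R N l :=
  le_dimFiltration ((hR.gradeGE_dimFiltration (l + 1)).mono (Nat.le_succ l))

/-- The preimage in `N` of such a submodule is an extension of modules of grade at least `l`, hence
already contained in `Δ^l(N)`. -/
theorem subsingleton_of_injective_quotient [Module.Finite R N] {l : ℕ}
    (f : N' →ₗ[R] N ⧸ dimFiltration R N l) (hf : Function.Injective f) (h : GradeGE R N' l) :
    Subsingleton N' := by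
  have := hR.noetherian_left
  let p := (dimFiltration R N l).mkQ
  let P := (LinearMap.range f).comap p
  have hle : dimFiltration R N l ≤ P := fun x hx => by
    change p x ∈ LinearMap.range f
    have : p x = 0 := (Submodule.Quotient.mk_eq_zero _).2 hx
    rw [this]
    exact zero_mem _
  let g : P →ₗ[R] LinearMap.range f := p.restrict fun x hx => hx
  have hg : Function.Surjective g := by
    rintro ⟨y, hy⟩
    obtain ⟨x, rfl⟩ := Submodule.mkQ_surjective _ y
    exact ⟨⟨x, hy⟩, rfl⟩
  have hex : Function.Exact (Submodule.inclusion hle) g := by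
    intro x
    rw [← Subtype.coe_inj]
    refine (Submodule.Quotient.mk_eq_zero _).trans ⟨fun hx => ⟨⟨x, hx⟩, rfl⟩, ?_⟩
    rintro ⟨y, rfl⟩
    exact y.2
  have hP := GradeGE.extension (Submodule.inclusion_injective hle) hg hex
    (hR.gradeGE_dimFiltration l) (h.congr (LinearEquiv.ofInjective f hf))
  have hP' := le_dimFiltration hP
  refine subsingleton_of_forall_eq 0 fun x => hf ?_
  obtain ⟨y, hy⟩ := Submodule.mkQ_surjective _ (f x)
  have : y ∈ P := ⟨x, hy.symm⟩
  rw [map_zero, ← hy]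
  exact (Submodule.Quotient.mk_eq_zero _).2 (hP' this)

theorem extExt_quotient_subsingleton [Module.Finite R N] {l i : ℕ} (hi : l ≤ i) :
    Subsingleton (ExtExt R (N ⧸ dimFiltration R N l) i) :=
  hR.extExt_subsingleton (fun _ _ _ f hf h => hR.subsingleton_of_injective_quotient f hf h) i hi

end IsAuslanderRegular

/-! ### Flat base change -/

variable {S : Type u} [Ring S] (φ : R →+* S) (hφ : FlatAsRightModule φ) (hφ' : FlatAsLeftModule φ)
  {N : Type u} [AddCommGroup N] [Module R N] [Module.Finite R N]
include hφ hφ'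

theorem BaseChange.gradeGE [IsNoetherianRing R] {l : ℕ} (h : GradeGE R N l) :
    GradeGE S (BaseChange φ N) l := fun i hi => by
  have := h i hi
  exact (ExtB.baseChangeEquiv φ hφ hφ' N i).toEquiv.symm.subsingleton

/-- Base change is applied twice, the second time along `φ.op`. This is why flatness on both sides
is needed. -/
theorem BaseChange.extExt_subsingleton [IsNoetherianRing R] [IsNoetherianRing Rᵐᵒᵖ] {i : ℕ}
    (h : Subsingleton (ExtExt R N i)) : Subsingleton (ExtExt S (BaseChange φ N) i) := by
  have e₁ := ExtDual.congr i (ExtB.baseChangeEquiv φ hφ hφ' N i)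
  have e₂ := ExtB.baseChangeEquiv (RingHom.op φ) hφ' (BaseChange.flat_op_op φ hφ)
    (ExtDual R N i) i
  exact (e₁.trans e₂.symm).toEquiv.subsingleton

/-- Base change preserves grade bounds, giving one inclusion. For the other, `Δ^l(S ⊗ N)` maps to `S
⊗ (N / Δ^l(N))`, whose double `Ext` modules vanish from degree `l` on because those of `N / Δ^l(N)`
do. Its image has grade at least `l`, so it is zero. -/
theorem range_baseChange_dimFiltration (hR : IsAuslanderRegular R) (hS : IsAuslanderRegular S)
    {d : ℕ} (hd : GlobalDimensionLE S d) (l : ℕ) :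
    LinearMap.range (BaseChange.map φ (dimFiltration R N l).subtype) =
      dimFiltration S (BaseChange φ N) l := by
  have := hR.noetherian_left
  have := hR.noetherian_right
  have := hS.noetherian_left
  apply le_antisymm
  · refine IsAuslanderRegular.le_dimFiltration (hS.gradeGE_of_surjective
      (BaseChange.gradeGE φ hφ hφ' (hR.gradeGE_dimFiltration l)) _
      (LinearMap.surjective_rangeRestrict _))
  · let p := BaseChange.map φ (dimFiltration R N l).mkQ
    have hex := BaseChange.map_exact φ (LinearMap.exact_subtype_mkQ (dimFiltration R N l))
      (Submodule.mkQ_surjective _)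
    let D := dimFiltration S (BaseChange φ N) l
    let f : D →ₗ[S] BaseChange φ (N ⧸ dimFiltration R N l) := p ∘ₗ D.subtype
    have hr := hS.gradeGE_of_surjective (hS.gradeGE_dimFiltration l) f.rangeRestrict
      (LinearMap.surjective_rangeRestrict _)
    have := hS.subsingleton_of_extExt hd (fun i hi => BaseChange.extExt_subsingleton φ hφ hφ'
      (hR.extExt_quotient_subsingleton (N := N) hi)) (LinearMap.range f).subtype
      (Submodule.injective_subtype _) hr
    intro x hx
    refine (hex x).1 ?_
    exact congrArg Subtype.val (Subsingleton.elim (f.rangeRestrict ⟨x, hx⟩) 0)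

end AuslanderRegular

/-! ### Inverse systems of Banach modules -/

section MittagLeffler

/-- The shift operator of an inverse system. -/
def invShift {F : ℕ → Type*} [∀ n, AddCommGroup (F n)] (ρ : ∀ n, F (n + 1) →+ F n)
    (x : ∀ n, F n) : ∀ n, F n := fun n => ρ n (x (n + 1))

variable {F : ℕ → Type*} [∀ n, NormedAddCommGroup (F n)] (ρ : ∀ n, F (n + 1) →+ F n)

/-- A function on `F n` which dominates the norms of all images in the inverse system. -/
def pushNorm : ∀ n, F n → ℝ
  | 0, y => ‖y‖
  | n + 1, y => ‖y‖ + pushNorm n (ρ n y)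

theorem pushNorm_nonneg (n : ℕ) (y : F n) : 0 ≤ pushNorm ρ n y := by
  induction n with
  | zero => exact norm_nonneg y
  | succ n ih => exact add_nonneg (norm_nonneg y) (ih _)

theorem norm_le_pushNorm (n : ℕ) (y : F n) : ‖y‖ ≤ pushNorm ρ n y := by
  cases n with
  | zero => exact le_rfl
  | succ n => exact le_add_of_nonneg_right (pushNorm_nonneg ρ n _)

theorem pushNorm_map_le (n : ℕ) (y : F (n + 1)) : pushNorm ρ n (ρ n y) ≤ pushNorm ρ (n + 1) y :=
  le_add_of_nonneg_left (norm_nonneg y)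

theorem pushNorm_zero (n : ℕ) : pushNorm ρ n 0 = 0 := by
  induction n with
  | zero => exact norm_zero
  | succ n ih => rw [pushNorm, map_zero, ih, norm_zero, add_zero]

variable {ρ} in
theorem continuous_pushNorm (hρ : ∀ n, Continuous (ρ n)) (n : ℕ) : Continuous (pushNorm ρ n) := by
  induction n with
  | zero => exact continuous_norm
  | succ n ih => exact continuous_norm.add (ih.comp (hρ n))

theorem pushNorm_iterate_le {b : ℕ → ℝ} {e : ∀ n, F n} (he : ∀ n, pushNorm ρ n (e n) ≤ b n)
    (k n : ℕ) : pushNorm ρ n ((invShift ρ)^[k] e n) ≤ b (n + k) := by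
  induction k generalizing n with
  | zero => exact he n
  | succ k ih =>
    rw [Function.iterate_succ_apply']
    refine (pushNorm_map_le ρ n _).trans ((ih (n + 1)).trans ?_)
    rw [Nat.add_right_comm, Nat.add_assoc]

/-- The Mittag-Leffler argument for an inverse system of complete groups, modulo subgroups. -/
theorem exists_approx_section [∀ n, CompleteSpace (F n)] (hρ : ∀ n, Continuous (ρ n))
    (N : ∀ n, AddSubgroup (F n))
    (hd : ∀ n, closure ((AddMonoidHom.range (ρ n) ⊔ N n : AddSubgroup (F n)) : Set (F n)) =
      Set.univ) (d : ∀ n, F n) (v : F 0) {ε : ℝ} (hε : 0 < ε) :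
    ∃ x : ∀ n, F n, (∀ n, x n - ρ n (x (n + 1)) - d n ∈ N n) ∧ ‖x 0 - v‖ ≤ ε := by
  -- Error allowances with sum exactly `ε`.
  let b : ℕ → ℝ := fun n => ε / 2 / 2 ^ n
  have hb : ∀ n, 0 < b n := fun n => by positivity
  have hbs : HasSum b ε := hasSum_geometric_two' ε
  -- Measuring errors by `pushNorm` bounds all their images at lower levels at once. The subgroups
  -- `N n` need not be closed, as they are only used for this approximation.
  have step : ∀ n (y : F n), ∃ w : F (n + 1), ∃ ν ∈ N n, pushNorm ρ n (y + ρ n w - ν) ≤ b n := by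
    intro n y
    have ho : IsOpen {z : F n | pushNorm ρ n (y - z) < b n} :=
      isOpen_lt ((continuous_pushNorm hρ n).comp (continuous_const.sub continuous_id))
        continuous_const
    have hy : y ∈ closure ((AddMonoidHom.range (ρ n) ⊔ N n : AddSubgroup (F n)) : Set (F n)) := by
      rw [hd n]; trivial
    obtain ⟨z, hz, hz'⟩ := mem_closure_iff.1 hy _ ho (by
      simp only [Set.mem_ofPred_eq, sub_self, pushNorm_zero, hb n])
    obtain ⟨_, ⟨w, rfl⟩, ν, hν, rfl⟩ := AddSubgroup.mem_sup.1 hz'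
    refine ⟨-w, ν, hν, le_of_lt ?_⟩
    have : y + ρ n (-w) - ν = y - (ρ n w + ν) := by rw [map_neg]; abel
    rw [this]
    exact hz
  choose W V hV hW using step
  -- Starting from `v`, each new term corrects the defect at the previous level, up to `N n` and an
  -- error `e n` of size at most `b n`.
  let w : ∀ n, F n := fun n => Nat.rec v (fun n z => W n (d n - z)) n
  have hw : ∀ n, w (n + 1) = W n (d n - w n) := fun n => rfl
  let e : ∀ n, F n := fun n => d n - w n + ρ n (w (n + 1)) - V n (d n - w n)
  have he : ∀ n, pushNorm ρ n (e n) ≤ b n := fun n => hW n (d n - w n)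
  have hle : ∀ n k, ‖(invShift ρ)^[k] e n‖ ≤ b (n + k) := fun n k =>
    (norm_le_pushNorm ρ n _).trans (pushNorm_iterate_le ρ he k n)
  have hsb : ∀ n, Summable fun k => b (n + k) := fun n =>
    hbs.summable.comp_injective (add_right_injective n)
  have hs : ∀ n, Summable fun k => (invShift ρ)^[k] e n := fun n =>
    Summable.of_norm_bounded (hsb n) (hle n)
  -- Summing the images of all higher errors gives `y n - ρ n (y (n + 1)) = e n`, so adding `y`
  -- removes the errors.
  let y : ∀ n, F n := fun n => ∑' k, (invShift ρ)^[k] e n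
  have hy : ∀ n, y n = e n + ρ n (y (n + 1)) := by
    intro n
    refine ((hs n).tsum_eq_zero_add).trans ?_
    have h1 : ρ n (y (n + 1)) = ∑' k, ρ n ((invShift ρ)^[k] e (n + 1)) :=
      (((hs (n + 1)).hasSum.map (ρ n) (hρ n)).tsum_eq).symm
    rw [h1]
    congr 1
    refine tsum_congr fun k => ?_
    rw [Function.iterate_succ_apply']
    rfl
  refine ⟨fun n => w n + y n, fun n => ?_, ?_⟩
  · have : w n + y n - ρ n (w (n + 1) + y (n + 1)) - d n = - V n (d n - w n) := by
      rw [hy n, map_add]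
      simp only [e]
      abel
    rw [this]
    exact neg_mem (hV n _)
  · have h0 : w 0 + y 0 - v = y 0 := add_sub_cancel_left v (y 0)
    rw [h0]
    have h1 : ∀ k, ‖(invShift ρ)^[k] e 0‖ ≤ b k := fun k => (hle 0 k).trans (by rw [zero_add])
    exact (tsum_of_norm_bounded hbs h1)

end MittagLeffler

/-- A dense submodule of a finite free module over a complete normed ring is the whole module. -/
theorem eq_top_of_dense {R : Type*} [NormedRing R] [CompleteSpace R] {r : ℕ}
    (P : Submodule R (Fin r → R)) (hP : Dense (P : Set (Fin r → R))) : P = ⊤ := by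
  -- Chosen so that `r` such errors add up to at most `1 / 2`.
  have hδ : (0 : ℝ) < 1 / (2 * (r + 1)) := by positivity
  choose p hp hpe using fun i : Fin r => hP.exists_dist_lt (Pi.single i 1 : Fin r → R) hδ
  let g : (Fin r → R) → (Fin r → R) := fun x => ∑ i, x i • p i
  have hg : ∀ x, g x ∈ P := fun x => sum_mem fun i _ => P.smul_mem _ (hp i)
  have hgs : ∀ x y, g (x - y) = g x - g y := fun x y => by
    simp only [g, Pi.sub_apply, sub_smul, Finset.sum_sub_distrib]
  have hb : ∀ x : Fin r → R, ‖x - g x‖ ≤ (1 / 2) * ‖x‖ := by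
    intro x
    have h1 : x - g x = ∑ i, x i • ((Pi.single i 1 : Fin r → R) - p i) := by
      simp only [smul_sub, Finset.sum_sub_distrib, g]
      congr 1
      refine funext fun j => ?_
      simp [Finset.sum_apply, Pi.single_apply]
    rw [h1]
    refine (norm_sum_le _ _).trans ?_
    have h2 : ∀ i ∈ Finset.univ, ‖x i • ((Pi.single i 1 : Fin r → R) - p i)‖ ≤
        ‖x‖ * (1 / (2 * (r + 1))) := fun i _ => by
      refine (norm_smul_le _ _).trans ?_
      have := (hpe i).le
      rw [dist_eq_norm] at this
      gcongr
      exact norm_le_pi_norm x i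
    refine (Finset.sum_le_sum h2).trans ?_
    rw [Finset.sum_const, Finset.card_univ, Fintype.card_fin, nsmul_eq_mul]
    have h3 : (r : ℝ) * (1 / (2 * (r + 1))) ≤ 1 / 2 := by
      rw [mul_one_div, div_le_div_iff₀ (by positivity) (by positivity)]
      nlinarith
    calc (r : ℝ) * (‖x‖ * (1 / (2 * (r + 1)))) = (r : ℝ) * (1 / (2 * (r + 1))) * ‖x‖ := by ring
      _ ≤ 1 / 2 * ‖x‖ := by gcongr
  rw [eq_top_iff]
  intro y _
  -- A fixed point `x` of this contraction satisfies `g x = y`, and all values of `g` lie in `P`.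
  have hc : ContractingWith (1 / 2) fun x => y + (x - g x) := by
    refine ⟨by norm_num, LipschitzWith.of_dist_le_mul fun x z => ?_⟩
    rw [dist_eq_norm, dist_eq_norm]
    have : y + (x - g x) - (y + (z - g z)) = (x - z) - g (x - z) := by rw [hgs]; abel
    rw [this]
    exact (hb _).trans (by norm_num)
  have hfix : y + (hc.fixedPoint - g hc.fixedPoint) = hc.fixedPoint := hc.fixedPoint_isFixedPt
  have : g hc.fixedPoint = y := by
    rw [add_sub, sub_eq_iff_eq_add, add_comm, add_right_inj] at hfix
    exact hfix.symm
  rw [← this]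
  exact hg _

/-! ### Theorems A and B for towers of Banach algebras -/

section CoherentSystem

/-- The conclusions of Theorems A and B for the inverse systems of finite modules over an inverse
system of rings: the first derived limit vanishes, and each module is generated by the global
sections. -/
def TheoremsAB {R : ℕ → Type u} [∀ n, Ring (R n)] (φ : ∀ n, R (n + 1) →+* R n) : Prop :=
  ∀ (M : ℕ → Type u) [∀ n, AddCommGroup (M n)] [∀ n, Module (R n) (M n)]
    [∀ n, Module.Finite (R n) (M n)] (res : ∀ n, M (n + 1) →ₛₗ[φ n] M n),
    (∀ n, Submodule.span (R n) (Set.range (res n)) = ⊤) →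
    (∀ d : ∀ n, M n, ∃ x : ∀ n, M n, ∀ n, x n - res n (x (n + 1)) = d n) ∧
      ∀ n, Submodule.span (R n)
        {y | ∃ x : ∀ n, M n, (∀ k, res k (x (k + 1)) = x k) ∧ x n = y} = ⊤

variable {R : ℕ → Type u} [∀ n, NormedRing (R n)] [∀ n, CompleteSpace (R n)]
  {φ : ∀ n, R (n + 1) →+* R n} (hc : ∀ n, Continuous (φ n)) (hφ : ∀ n, DenseRange (φ n))
  {M : ℕ → Type u} [∀ n, AddCommGroup (M n)] [∀ n, Module (R n) (M n)]
  [∀ n, Module.Finite (R n) (M n)] (res : ∀ n, M (n + 1) →ₛₗ[φ n] M n)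
  (hres : ∀ n, Submodule.span (R n) (Set.range (res n)) = ⊤)

-- Lifting the transition maps to free covers allows all convergence arguments to take place in
-- finite free modules, so that no topology on `M n` is needed.
omit [∀ n, CompleteSpace (R n)] [∀ n, Module.Finite (R n) (M n)] in
theorem exists_free_lift (k : ℕ → ℕ) (π : ∀ n, (Fin (k n) → R n) →ₗ[R n] M n)
    (hπ : ∀ n, Function.Surjective (π n)) (hc : ∀ n, Continuous (φ n)) (n : ℕ) :
    ∃ ρ : (Fin (k (n + 1)) → R (n + 1)) →+ (Fin (k n) → R n), Continuous ρ ∧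
      (∀ s x, ρ (s • x) = φ n s • ρ x) ∧ ∀ x, π n (ρ x) = res n (π (n + 1) x) := by
  choose a ha using fun i : Fin (k (n + 1)) => hπ n (res n (π (n + 1) (Pi.single i 1)))
  let ρ : (Fin (k (n + 1)) → R (n + 1)) →+ (Fin (k n) → R n) :=
    AddMonoidHom.mk' (fun x => ∑ i, φ n (x i) • a i) fun x y => by
      simp only [Pi.add_apply, map_add, add_smul, Finset.sum_add_distrib]
  have hρ : ∀ x, ρ x = ∑ i, φ n (x i) • a i := fun x => rfl
  refine ⟨ρ, ?_, fun s x => ?_, fun x => ?_⟩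
  · change Continuous fun x : Fin (k (n + 1)) → R (n + 1) => ∑ i, φ n (x i) • a i
    exact continuous_finsetSum _ fun i _ =>
      ((hc n).comp (continuous_apply i)).smul continuous_const
  · rw [hρ, hρ, Finset.smul_sum]
    refine Finset.sum_congr rfl fun i _ => ?_
    rw [Pi.smul_apply, smul_eq_mul, map_mul, mul_smul]
  · have hx : x = ∑ i, x i • (Pi.single i 1 : Fin (k (n + 1)) → R (n + 1)) := by
      refine funext fun j => ?_
      simp [Finset.sum_apply, Pi.single_apply]
    rw [hρ, map_sum]
    conv_rhs => rw [hx, map_sum, map_sum]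
    refine Finset.sum_congr rfl fun i _ => ?_
    rw [map_smul, ha, map_smul, (res n).map_smulₛₗ]

-- By density of `φ n`, the closure of the image plus the kernel is an `R n`-submodule. It contains
-- the kernel of `π n` and maps onto the generators of `M n`, so it is everything.
omit [∀ n, CompleteSpace (R n)] [∀ n, Module.Finite (R n) (M n)] in
include hφ hres in
theorem closure_range_sup_ker {k : ℕ → ℕ} {π : ∀ n, (Fin (k n) → R n) →ₗ[R n] M n}
    (hπ : ∀ n, Function.Surjective (π n)) {n : ℕ}
    {ρ : (Fin (k (n + 1)) → R (n + 1)) →+ (Fin (k n) → R n)}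
    (hρs : ∀ s x, ρ (s • x) = φ n s • ρ x) (hρπ : ∀ x, π n (ρ x) = res n (π (n + 1) x)) :
    closure ((AddMonoidHom.range ρ ⊔ (LinearMap.ker (π n)).toAddSubgroup : AddSubgroup _) :
      Set (Fin (k n) → R n)) = Set.univ := by
  let H : AddSubgroup (Fin (k n) → R n) :=
    AddMonoidHom.range ρ ⊔ (LinearMap.ker (π n)).toAddSubgroup
  have hsmul : ∀ (s : R n) (y : Fin (k n) → R n), y ∈ H.topologicalClosure →
      s • y ∈ H.topologicalClosure := fun s y hy => by
    refine map_mem_closure₂ continuous_smul (hφ n s) hy ?_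
    rintro _ ⟨t, rfl⟩ b hb
    obtain ⟨_, ⟨w, rfl⟩, ν, hν, rfl⟩ := AddSubgroup.mem_sup.1 hb
    rw [smul_add, ← hρs]
    exact add_mem (AddSubgroup.mem_sup_left ⟨_, rfl⟩)
      (AddSubgroup.mem_sup_right (Submodule.smul_mem (LinearMap.ker (π n)) _ hν))
  let C : Submodule (R n) (Fin (k n) → R n) :=
    { H.topologicalClosure with smul_mem' := fun s y hy => hsmul s y hy }
  have hHC : ∀ y ∈ H, y ∈ C := fun y hy => subset_closure hy
  have hker : LinearMap.ker (π n) ≤ C := fun y hy =>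
    hHC y (AddSubgroup.mem_sup_right (S := AddMonoidHom.range ρ) hy)
  have hmap : C.map (π n) = ⊤ := by
    rw [eq_top_iff, ← hres n, Submodule.span_le]
    rintro _ ⟨m, rfl⟩
    obtain ⟨x, rfl⟩ := hπ (n + 1) m
    exact ⟨ρ x, hHC _ (AddSubgroup.mem_sup_left ⟨x, rfl⟩), hρπ x⟩
  have hC : C = ⊤ := by
    have := Submodule.comap_map_eq (π n) C
    rw [hmap, Submodule.comap_top, sup_eq_left.2 hker] at this
    exact this.symm
  exact Set.eq_univ_of_forall fun y => by
    have : y ∈ C := by rw [hC]; trivial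
    exact this

-- The Mittag-Leffler argument on free covers modulo the kernels. Solvability gives Theorem B; with
-- `d = 0`, closeness to `v` gives the density behind Theorem A.
omit [∀ n, Module.Finite (R n) (M n)] in
include hc hφ hres in
theorem exists_section_near {k : ℕ → ℕ} {π : ∀ n, (Fin (k n) → R n) →ₗ[R n] M n}
    (hπ : ∀ n, Function.Surjective (π n)) (d : ∀ n, M n) (v : Fin (k 0) → R 0) {ε : ℝ}
    (hε : 0 < ε) :
    ∃ x : ∀ n, M n, (∀ n, x n - res n (x (n + 1)) = d n) ∧ ∃ u, π 0 u = x 0 ∧ ‖u - v‖ ≤ ε := by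
  choose ρ hρc hρs hρπ using exists_free_lift res k π hπ hc
  choose d' hd' using fun n => hπ n (d n)
  obtain ⟨x, hx, hx0⟩ := exists_approx_section ρ hρc (fun n => (LinearMap.ker (π n)).toAddSubgroup)
    (fun n => closure_range_sup_ker hφ res hres hπ (hρs n) (hρπ n)) d' v hε
  refine ⟨fun n => π n (x n), fun n => ?_, x 0, rfl, hx0⟩
  have h2 : π n (x n - ρ n (x (n + 1)) - d' n) = 0 := hx n
  rw [map_sub, map_sub, hρπ, hd'] at h2
  exact sub_eq_zero.1 h2

include hc hφ in
theorem theoremsAB_of_denseRange : TheoremsAB φ := by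
  intro M _ _ _ res hres
  constructor
  · intro d
    choose k π hπ using fun n => Module.Finite.exists_fin' (R n) (M n)
    obtain ⟨x, hx, -⟩ := exists_section_near hc hφ res hres hπ d 0 one_pos
    exact ⟨x, hx⟩
  · intro n
    induction n generalizing R M with
    | zero =>
      choose k π hπ using fun n => Module.Finite.exists_fin' (R n) (M n)
      let P := Submodule.span (R 0)
        {y | ∃ x : ∀ n, M n, (∀ k, res k (x (k + 1)) = x k) ∧ x 0 = y}
      -- Global sections approximate every vector of the free cover, and a dense submodule of it is
      -- the whole module.
      have hP : P.comap (π 0) = ⊤ := by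
        refine eq_top_of_dense _ fun v => Metric.mem_closure_iff.2 fun ε hε => ?_
        obtain ⟨x, hx, u, hu, huv⟩ := exists_section_near hc hφ res hres hπ (fun _ => 0) v
          (half_pos hε)
        refine ⟨u, ?_, ?_⟩
        · change π 0 u ∈ P
          exact Submodule.subset_span ⟨x, fun k => (sub_eq_zero.1 (hx k)).symm, hu.symm⟩
        · rw [dist_comm, dist_eq_norm]
          exact huv.trans_lt (half_lt_self hε)
      rw [eq_top_iff]
      intro y _
      obtain ⟨z, rfl⟩ := hπ 0 y
      have : z ∈ P.comap (π 0) := by rw [hP]; trivial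
      exact this
    | succ n ih =>
      -- Remove the bottom of the tower; a section of the truncated system extends down by `res 0`.
      have := ih (R := fun n => R (n + 1)) (φ := fun n => φ (n + 1)) (fun n => hc (n + 1))
        (fun n => hφ (n + 1)) (fun n => M (n + 1)) (fun n => res (n + 1)) (fun n => hres (n + 1))
      rw [eq_top_iff, ← this]
      refine Submodule.span_mono ?_
      rintro _ ⟨x, hx, rfl⟩
      refine ⟨fun k => Nat.casesOn (motive := M) k (res 0 (x 0)) x, fun k => ?_, rfl⟩
      cases k with
      | zero => rfl
      | succ k => exact hx k

end CoherentSystem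

/-! ### Inverse systems of Fréchet–Stein type -/

/-- The formal properties of the system of Banach algebras attached to a Fréchet–Stein algebra. -/
structure IsSteinSystem {A : Type u} [Ring A] {R : ℕ → Type u} [∀ n, Ring (R n)]
    (φ : ∀ n, R (n + 1) →+* R n) (ι : ∀ n, A →+* R n) : Prop where
  comp : ∀ n a, φ n (ι (n + 1) a) = ι n a
  noeth : ∀ n, IsNoetherianRing (R n)
  flat : ∀ n, FlatAsRightModule (φ n)
  lim : ∀ x : ∀ n, R n, (∀ n, φ n (x (n + 1)) = x n) → ∃! a, ∀ n, ι n a = x n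
  ab : TheoremsAB φ

/-- Every module is the cokernel of a map to a module embedded into a product of copies of the
ring. -/
theorem exists_presentation_with_coordinates (A : Type u) [Ring A] (G : Type u) [AddCommGroup G]
    [Module A G] : ∃ (K F X : Type u) (_ : AddCommGroup K) (_ : Module A K) (_ : AddCommGroup F)
      (_ : Module A F) (e : K →ₗ[A] F) (π : F →ₗ[A] G) (c : X → F →ₗ[A] A),
      (∀ f, (∀ x, c x f = 0) → f = 0) ∧ Function.Surjective π ∧ Function.Exact e π :=
  ⟨LinearMap.ker (Finsupp.linearCombination A (id : G → G)), G →₀ A, G, inferInstance,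
    inferInstance, inferInstance, inferInstance, Submodule.subtype _,
    Finsupp.linearCombination A (id : G → G), fun x => Finsupp.lapply x,
    fun _ hf => Finsupp.ext hf, Finsupp.linearCombination_id_surjective A G,
    LinearMap.exact_subtype_ker_map _⟩

section SteinSystem

variable {A : Type u} [Ring A] {R : ℕ → Type u} [∀ n, Ring (R n)]
  {φ : ∀ n, R (n + 1) →+* R n} {ι : ∀ n, A →+* R n}
variable {M : ℕ → Type u} [∀ n, AddCommGroup (M n)] [∀ n, Module (R n) (M n)]
variable {G : Type u} [AddCommGroup G] [Module A G]

/-- `G` is the inverse limit of the modules `M n`. -/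
structure IsLimitModule (res : ∀ n, M (n + 1) →ₛₗ[φ n] M n) (p : ∀ n, G →ₛₗ[ι n] M n) :
    Prop where
  comp : ∀ n g, res n (p (n + 1) g) = p n g
  lim : ∀ x : ∀ n, M n, (∀ n, res n (x (n + 1)) = x n) → ∃! g, ∀ n, p n g = x n

theorem IsLimitModule.eq_zero {res : ∀ n, M (n + 1) →ₛₗ[φ n] M n} {p : ∀ n, G →ₛₗ[ι n] M n}
    (h : IsLimitModule res p) {g : G} (hg : ∀ n, p n g = 0) : g = 0 :=
  (h.lim (fun _ => 0) fun _ => map_zero _).unique hg fun _ => map_zero _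

open BaseChange

/-- The easy half of the equational criterion for flatness; `mem_span_of_sum_tmul` is the converse.
-/
theorem BaseChange.sum_tmul_eq_zero {S : Type u} [Ring S] (ψ : A →+* S) {r : ℕ} (m : Fin r → G)
    {s : Fin r → S} (hs : s ∈ Submodule.span S
      {t | ∃ a : Fin r → A, ∑ i, a i • m i = 0 ∧ t = fun i => ψ (a i)}) :
    ∑ i, tmul ψ (s i) (m i) = 0 := by
  have key : Submodule.span S {t | ∃ a : Fin r → A, ∑ i, a i • m i = 0 ∧ t = fun i => ψ (a i)} ≤
      LinearMap.ker (Fintype.linearCombination S fun i => mk ψ G (m i)) := by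
    rw [Submodule.span_le]
    rintro _ ⟨a, ha, rfl⟩
    rw [SetLike.mem_coe, LinearMap.mem_ker, Fintype.linearCombination_apply]
    simp only [← LinearMap.map_smulₛₗ, ← map_sum]
    rw [ha, _root_.map_zero]
  have := key hs
  rw [LinearMap.mem_ker, Fintype.linearCombination_apply] at this
  simpa only [smul_mk] using this

namespace IsSteinSystem

variable (h : IsSteinSystem φ ι)
include h

/-- The relations between sections of a sheaf are generated by global relations. -/
theorem mem_span_relations (res : ∀ n, M (n + 1) →ₛₗ[φ n] M n)
    (hres : ∀ n, Function.Injective (lift (res n))) {r : ℕ} (y : Fin r → ∀ n, M n)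
    (hy : ∀ i n, res n (y i (n + 1)) = y i n) (n : ℕ) (s : Fin r → R n)
    (hs : ∑ i, s i • y i n = 0) :
    s ∈ Submodule.span (R n) {t | ∃ a : Fin r → A, (∀ k, ∑ i, ι k (a i) • y i k = 0) ∧
      t = fun i => ι n (a i)} := by
  have := h.noeth
  let α : ∀ k, (Fin r → R k) →ₗ[R k] M k := fun k =>
    Fintype.linearCombination (R k) fun i => y i k
  have hα : ∀ k x, α k x = ∑ i, x i • y i k := fun k x => rfl
  let c : ∀ k, (Fin r → R (k + 1)) →ₛₗ[φ k] (Fin r → R k) := fun k =>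
    { toFun := fun x i => φ k (x i)
      map_add' := fun x z => funext fun i => map_add _ _ _
      map_smul' := fun t x => funext fun i => map_mul _ _ _ }
  have hc : ∀ k x, α k (c k x) = res k (α (k + 1) x) := fun k x => by
    rw [hα, hα, map_sum]
    refine Finset.sum_congr rfl fun i _ => ?_
    rw [(res k).map_smulₛₗ, hy]
    rfl
  let ρ : ∀ k, LinearMap.ker (α (k + 1)) →ₛₗ[φ k] LinearMap.ker (α k) := fun k =>
    { toFun := fun x => ⟨c k x, by
        rw [LinearMap.mem_ker, hc, LinearMap.mem_ker.1 x.2, _root_.map_zero]⟩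
      map_add' := fun x z => Subtype.ext (map_add (c k) _ _)
      map_smul' := fun t x => Subtype.ext ((c k).map_smulₛₗ t _) }
  -- The kernels form a system satisfying the hypothesis of Theorem A: base change along the flat `φ
  -- k` commutes with kernels, and injectivity of `lift (res k)` identifies relations at level `k`
  -- with base-changed ones.
  have hspan : ∀ k, Submodule.span (R k) (Set.range (ρ k)) = ⊤ := by
    intro k
    rw [← range_lift, LinearMap.range_eq_top]
    rintro ⟨x, hx⟩
    let X : BaseChange (φ k) (Fin r → R (k + 1)) := ∑ i, tmul (φ k) (x i) (Pi.single i 1)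
    have hX : map (φ k) (α (k + 1)) X = 0 := by
      apply hres k
      rw [map_sum, map_sum, _root_.map_zero, ← LinearMap.mem_ker.1 hx, hα]
      refine Finset.sum_congr rfl fun i _ => ?_
      rw [map_tmul, lift_tmul, ← hy i k]
      congr 2
      rw [hα, Finset.sum_eq_single i (fun j _ hj => by rw [Pi.single_eq_of_ne hj, zero_smul])
        (fun hi => absurd (Finset.mem_univ i) hi), Pi.single_eq_same, one_smul]
    obtain ⟨Z, hZ⟩ := (map_exact_of_flat (φ k) (h.flat k)
      (LinearMap.exact_subtype_ker_map (α (k + 1))) X).1 hX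
    refine ⟨Z, Subtype.ext ?_⟩
    have h1 : (LinearMap.ker (α k)).subtype ∘ₗ lift (ρ k) =
        lift (c k) ∘ₗ map (φ k) (LinearMap.ker (α (k + 1))).subtype := hom_ext fun z => by
      rw [LinearMap.comp_apply, LinearMap.comp_apply, lift_mk, map_mk, lift_mk]
      rfl
    refine (LinearMap.congr_fun h1 Z).trans ?_
    rw [LinearMap.comp_apply, hZ, map_sum]
    funext j
    rw [Finset.sum_apply, Finset.sum_eq_single j]
    · simp [lift_tmul, c]
    · intro i _ hi
      simp [lift_tmul, c, Pi.single_eq_of_ne' hi]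
    · exact fun hj => absurd (Finset.mem_univ j) hj
  have hgen := (h.ab (fun k => LinearMap.ker (α k)) ρ hspan).2 n
  have hmem : s ∈ (⊤ : Submodule (R n) (LinearMap.ker (α n))).map
      (LinearMap.ker (α n)).subtype := ⟨⟨s, hs⟩, trivial, rfl⟩
  rw [← hgen, Submodule.map_span] at hmem
  refine Submodule.span_mono ?_ hmem
  rintro _ ⟨_, ⟨x, hx, rfl⟩, rfl⟩
  -- A global section of the kernels is a compatible family of vectors, so its coordinates are
  -- elements of `A`.
  choose a ha using fun i : Fin r => (h.lim (fun k => (x k).1 i)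
    fun k => congrFun (congrArg Subtype.val (hx k)) i).exists
  refine ⟨a, fun k => ?_, funext fun i => (ha i n).symm⟩
  simp only [ha]
  exact (x k).2

/-- The modules of a coherent sheaf are recovered from its global sections. -/
theorem lift_bijective [∀ n, Module.Finite (R n) (M n)] {res : ∀ n, M (n + 1) →ₛₗ[φ n] M n}
    (hres : ∀ n, Function.Bijective (lift (res n))) {p : ∀ n, G →ₛₗ[ι n] M n}
    (hG : IsLimitModule res p) (n : ℕ) : Function.Bijective (lift (p n)) := by
  constructor
  · refine (injective_iff_map_eq_zero _).2 fun x hx => ?_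
    obtain ⟨r, s, g, rfl⟩ := exists_sum (φ := ι n) x
    rw [map_sum] at hx
    refine sum_tmul_eq_zero (ι n) g (Submodule.span_mono ?_ (h.mem_span_relations res
      (fun k => (hres k).1) (fun i k => p k (g i)) (fun i k => hG.comp k _) n s hx))
    rintro _ ⟨a, ha, rfl⟩
    refine ⟨a, hG.eq_zero fun k => ?_, rfl⟩
    rw [← ha k, map_sum]
    simp only [LinearMap.map_smulₛₗ]
  · have hspan : ∀ k, Submodule.span (R k) (Set.range (res k)) = ⊤ := fun k => by
      rw [← range_lift, LinearMap.range_eq_top]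
      exact (hres k).2
    rw [← LinearMap.range_eq_top, range_lift, eq_top_iff, ← (h.ab M res hspan).2 n]
    refine Submodule.span_mono ?_
    rintro _ ⟨x, hx, rfl⟩
    obtain ⟨g, hg⟩ := (hG.lim x hx).exists
    exact ⟨g, hg n⟩

/-- Applies `mem_span_relations` to the system `R k ⊗ G`. The injectivity hypothesis turns relations
valid at all levels into relations in `G`. -/
theorem mem_span_of_mk_injective (hinj : ∀ g : G, (∀ k, BaseChange.mk (ι k) G g = 0) → g = 0)
    {r : ℕ} (z : Fin r → G) (n : ℕ) (s : Fin r → R n)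
    (hs : ∑ i, tmul (ι n) (s i) (z i) = 0) :
    s ∈ Submodule.span (R n) {t | ∃ a : Fin r → A, ∑ i, a i • z i = 0 ∧
      t = fun i => ι n (a i)} := by
  have := h.mem_span_relations (M := fun k => BaseChange (ι k) G) (fun k => trans (h.comp k) G)
    (fun k => (lift_trans_bijective (h.comp k) _).1) (fun i k => BaseChange.mk (ι k) G (z i))
    (fun i k => trans_mk (h.comp k) _ _) n s (by simpa only [smul_mk] using hs)
  refine Submodule.span_mono ?_ this
  rintro _ ⟨a, ha, rfl⟩
  refine ⟨a, hinj _ fun k => ?_, rfl⟩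
  rw [← ha k, map_sum]
  simp only [LinearMap.map_smulₛₗ]

/-- Coordinates with values in `A` extend to `R k ⊗ G`, and `A` embeds into the product of the `R
k`. -/
theorem mk_injective_of_coordinates {X : Type u} (c : X → G →ₗ[A] A)
    (hc : ∀ g, (∀ x, c x g = 0) → g = 0) (g : G) (hg : ∀ k, BaseChange.mk (ι k) G g = 0) :
    g = 0 := by
  refine hc g fun x => (h.lim (fun _ => 0) fun _ => _root_.map_zero _).unique (fun k => ?_)
    fun k => _root_.map_zero _
  let e : G →ₛₗ[ι k] R k :=
    { toFun := fun f => ι k (c x f), map_add' := by simp, map_smul' := by simp }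
  exact (lift_mk e g).symm.trans (by rw [hg k, _root_.map_zero])

/-- An arbitrary `G` need not embed into the limit of its base changes, so the relation is lifted to
a free module `F` mapping onto `G`. There it becomes one also involving elements `e (v j)` of the
kernel, which disappear again under `π`. -/
theorem mem_span_of_sum_tmul {r : ℕ} (w : Fin r → G) (n : ℕ) (s : Fin r → R n)
    (hs : ∑ i, tmul (ι n) (s i) (w i) = 0) :
    s ∈ Submodule.span (R n) {t | ∃ a : Fin r → A, ∑ i, a i • w i = 0 ∧
      t = fun i => ι n (a i)} := by
  obtain ⟨K, F, X, _, _, _, _, e, π, c, hc, hπ, hex⟩ := exists_presentation_with_coordinates A G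
  choose z hz using fun i => hπ (w i)
  obtain ⟨Z, hZ⟩ := (map_exact (ι n) hex hπ
    (∑ i, tmul (ι n) (s i) (z i))).1 (by simpa only [map_sum, map_tmul, hz] using hs)
  obtain ⟨k, t, v, rfl⟩ := exists_sum (φ := ι n) Z
  have h1 := h.mem_span_of_mk_injective (h.mk_injective_of_coordinates c hc)
    (Fin.append z fun j => e (v j)) n
    (Fin.append s fun j => -t j) (by
      simp only [Fin.sum_univ_add, Fin.append_left, Fin.append_right, ← smul_mk, neg_smul,
        Finset.sum_neg_distrib]
      simp only [smul_mk]
      rw [← hZ, map_sum]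
      exact add_neg_cancel _)
  have h2 := Submodule.mem_map_of_mem (f := LinearMap.funLeft (R n) (R n) (Fin.castAdd k)) h1
  rw [Submodule.map_span] at h2
  have h3 : LinearMap.funLeft (R n) (R n) (Fin.castAdd k) (Fin.append s fun j => -t j) = s :=
    funext fun i => Fin.append_left s (fun j => -t j) i
  rw [h3] at h2
  refine Submodule.span_mono ?_ h2
  rintro _ ⟨_, ⟨a, ha, rfl⟩, rfl⟩
  refine ⟨fun i => a (Fin.castAdd k i), ?_, rfl⟩
  have h4 := congrArg π ha
  have h5 : ∀ j, π (e (v j)) = 0 := fun j => hex.apply_apply_eq_zero _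
  simpa only [Fin.sum_univ_add, Fin.append_left, Fin.append_right, map_add, map_sum, map_smul,
    hz, h5, smul_zero, Finset.sum_const_zero, add_zero, _root_.map_zero] using h4

/-- The Banach algebras are flat over the Fréchet–Stein algebra. -/
theorem flat_ι (n : ℕ) : FlatAsRightModule (ι n) := by
  intro N N' _ _ _ _ f hf
  refine (injective_iff_map_eq_zero _).2 fun x hx => ?_
  obtain ⟨r, s, m, rfl⟩ := exists_sum (φ := ι n) x
  -- Relations among the `f (m i)` come from relations over `A`, and these hold among the `m i`
  -- because `f` is injective.
  refine sum_tmul_eq_zero (ι n) m (Submodule.span_mono ?_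
    (h.mem_span_of_sum_tmul (fun i => f (m i)) n s (by simpa only [map_sum, map_tmul] using hx)))
  rintro _ ⟨a, ha, rfl⟩
  refine ⟨a, hf ?_, rfl⟩
  simpa using ha

end IsSteinSystem

end SteinSystem

/-! ### Coadmissible modules over Stein systems -/

section Coadmissible

variable {A : Type u} [Ring A] {R : ℕ → Type u} [∀ n, Ring (R n)]
  {φ : ∀ n, R (n + 1) →+* R n} {ι : ∀ n, A →+* R n}

open BaseChange

/-- `N` is coadmissible: the modules `R n ⊗_A N` are finite and their limit is `N`. -/
structure IsCoadm (hc : ∀ n a, φ n (ι (n + 1) a) = ι n a) (N : Type u) [AddCommGroup N]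
    [Module A N] : Prop where
  finite : ∀ n, Module.Finite (R n) (BaseChange (ι n) N)
  limit : IsLimitModule (M := fun n => BaseChange (ι n) N) (fun n => trans (hc n) N)
    (fun n => BaseChange.mk (ι n) N)

variable {G : Type u} [AddCommGroup G] [Module A G]

theorem IsCoadm.subsingleton_iff {hc : ∀ n a, φ n (ι (n + 1) a) = ι n a} (hG : IsCoadm hc G) :
    Subsingleton G ↔ ∀ n, Subsingleton (BaseChange (ι n) G) :=
  ⟨fun _ _ => inferInstance, fun _ => subsingleton_of_forall_eq 0 fun _ =>
    hG.limit.eq_zero fun _ => Subsingleton.elim _ _⟩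

namespace IsSteinSystem

variable (h : IsSteinSystem φ ι)
include h

/-- Since `R n ⊗ G` is identified with `M n`, the chosen sheaf may be replaced by the base changes
of `G`, which makes coadmissibility intrinsic. -/
theorem isCoadm_of_isLimit {M : ℕ → Type u} [∀ n, AddCommGroup (M n)] [∀ n, Module (R n) (M n)]
    [∀ n, Module.Finite (R n) (M n)] {res : ∀ n, M (n + 1) →ₛₗ[φ n] M n}
    (hres : ∀ n, Function.Bijective (lift (res n))) {p : ∀ n, G →ₛₗ[ι n] M n}
    (hG : IsLimitModule res p) : IsCoadm h.comp G := by
  let e : ∀ n, BaseChange (ι n) G ≃ₗ[R n] M n := fun n =>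
    LinearEquiv.ofBijective (lift (p n)) (h.lift_bijective hres hG n)
  have he : ∀ n g, e n (BaseChange.mk (ι n) G g) = p n g := fun n g => lift_mk (p n) g
  have het : ∀ n x, e n (trans (h.comp n) G x) = res n (e (n + 1) x) := fun n x => by
    induction x using induction with
    | tmul s g =>
      rw [← smul_mk, (trans (h.comp n) G).map_smulₛₗ, map_smul, trans_mk, map_smul,
        (res n).map_smulₛₗ, he, he, hG.comp]
    | add x y hx hy => simp only [map_add, hx, hy]
  refine ⟨fun n => Module.Finite.equiv (e n).symm, fun n g => trans_mk (h.comp n) G g,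
    fun x hx => ?_⟩
  obtain ⟨g, hg, hu⟩ := hG.lim (fun n => e n (x n)) fun n => by rw [← het, hx]
  refine ⟨g, fun n => (e n).injective ((he n g).trans (hg n)), fun g' hg' => hu g' fun n => ?_⟩
  rw [← he]
  exact congrArg (e n) (hg' n)

section Sub

variable (ι) in
omit h in
/-- The submodule of `G` cut out by submodules of the modules `R n ⊗_A G`. -/
def subLimit (G : Type u) [AddCommGroup G] [Module A G]
    (L : ∀ n, Submodule (R n) (BaseChange (ι n) G)) : Submodule A G where
  carrier := {g | ∀ n, BaseChange.mk (ι n) G g ∈ L n}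
  zero_mem' n := by rw [_root_.map_zero]; exact zero_mem _
  add_mem' hx hy n := by rw [map_add]; exact add_mem (hx n) (hy n)
  smul_mem' a x hx n := by rw [(BaseChange.mk (ι n) G).map_smulₛₗ]; exact Submodule.smul_mem _ _ (hx n)

variable (hG : IsCoadm h.comp G) (L : ∀ n, Submodule (R n) (BaseChange (ι n) G))
  (hL : ∀ n, Submodule.span (R n) (trans (h.comp n) G '' L (n + 1)) = L n)

include hL in
theorem trans_mem {n : ℕ} {x : BaseChange (ι (n + 1)) G} (hx : x ∈ L (n + 1)) :
    trans (h.comp n) G x ∈ L n := by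
  rw [← hL n]
  exact Submodule.subset_span ⟨x, hx, rfl⟩

/-- The transition maps between the submodules `L n`. -/
def subRes (n : ℕ) : L (n + 1) →ₛₗ[φ n] L n where
  toFun x := ⟨trans (h.comp n) G x, h.trans_mem L hL x.2⟩
  map_add' _ _ := Subtype.ext (map_add _ _ _)
  map_smul' r x := Subtype.ext ((trans (h.comp n) G).map_smulₛₗ r x)

theorem span_range_subRes (n : ℕ) : Submodule.span (R n) (Set.range (h.subRes L hL n)) = ⊤ := by
  apply Submodule.map_injective_of_injective (L n).injective_subtype
  rw [Submodule.map_span, Submodule.map_top, Submodule.range_subtype, ← Set.range_comp]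
  conv_rhs => rw [← hL n]
  congr 1
  ext x
  constructor
  · rintro ⟨y, rfl⟩
    exact ⟨y, y.2, rfl⟩
  · rintro ⟨y, hy, rfl⟩
    exact ⟨⟨y, hy⟩, rfl⟩

/-- Injectivity follows from flatness of `φ n` and transitivity of base change; surjectivity is the
spanning hypothesis `hL`. -/
theorem subRes_bijective (n : ℕ) : Function.Bijective (lift (h.subRes L hL n)) := by
  constructor
  · have key : (L n).subtype ∘ₗ lift (h.subRes L hL n) =
        lift (trans (h.comp n) G) ∘ₗ map (φ n) (L (n + 1)).subtype := hom_ext fun x => by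
      rw [LinearMap.comp_apply, LinearMap.comp_apply, lift_mk, map_mk, lift_mk]
      rfl
    have hinj : Function.Injective (lift (trans (h.comp n) G) ∘ₗ map (φ n) (L (n + 1)).subtype) :=
      (lift_trans_bijective (h.comp n) G).1.comp
        ((h.flat n).map_injective (L (n + 1)).injective_subtype)
    rw [← key, LinearMap.coe_comp] at hinj
    exact hinj.of_comp
  · rw [← LinearMap.range_eq_top, range_lift, h.span_range_subRes L hL n]

omit h in
/-- The maps from the limit to the submodules `L n`. -/
def subProj (n : ℕ) : subLimit ι G L →ₛₗ[ι n] L n where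
  toFun x := ⟨BaseChange.mk (ι n) G x, x.2 n⟩
  map_add' _ _ := Subtype.ext (map_add _ _ _)
  map_smul' r x := Subtype.ext ((BaseChange.mk (ι n) G).map_smulₛₗ r (x : G))

include hG in
theorem subLimit_isLimit : IsLimitModule (h.subRes L hL) (subProj (ι := ι) L) := by
  refine ⟨fun n g => Subtype.ext (trans_mk (h.comp n) G _), fun x hx => ?_⟩
  obtain ⟨g, hg, hu⟩ := hG.limit.lim (fun n => x n) fun n => congrArg Subtype.val (hx n)
  have hgL : g ∈ subLimit ι G L := fun n => by
    have : BaseChange.mk (ι n) G g = x n := hg n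
    rw [this]
    exact (x n).2
  refine ⟨⟨g, hgL⟩, fun n => Subtype.ext (hg n), fun g' hg' => Subtype.ext (hu g' fun n => ?_)⟩
  exact congrArg Subtype.val (hg' n)

include hG in
theorem finite_submodule (n : ℕ) : Module.Finite (R n) (L n) := by
  have := h.noeth n
  have := hG.finite n
  infer_instance

include hG hL in
theorem isCoadm_subLimit : IsCoadm h.comp (subLimit ι G L) :=
  have := h.finite_submodule hG L
  h.isCoadm_of_isLimit (h.subRes_bijective L hL) (h.subLimit_isLimit hG L hL)

include hG hL in
theorem range_map_subLimit (n : ℕ) :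
    LinearMap.range (map (ι n) (subLimit ι G L).subtype) = L n := by
  have := h.finite_submodule hG L
  have hb := h.lift_bijective (h.subRes_bijective L hL) (h.subLimit_isLimit hG L hL) n
  have key : (L n).subtype ∘ₗ lift (subProj (ι := ι) L n) =
      map (ι n) (subLimit ι G L).subtype := hom_ext fun x => by
    rw [LinearMap.comp_apply, lift_mk, map_mk]
    rfl
  rw [← key, LinearMap.range_comp, LinearMap.range_eq_top.2 hb.2, Submodule.map_top,
    Submodule.range_subtype]

include hG hL in
/-- The quotient by a coadmissible submodule is coadmissible. -/
theorem isCoadm_quotient : IsCoadm h.comp (G ⧸ subLimit ι G L) := by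
  have hfin := hG.finite
  have hfin' := h.finite_submodule hG L
  let q := (subLimit ι G L).mkQ
  have hq : Function.Surjective q := Submodule.mkQ_surjective _
  have hqs : ∀ n, Function.Surjective (map (ι n) q) := fun n => map_surjective (ι n) hq
  have hker : ∀ n (x : BaseChange (ι n) G), map (ι n) q x = 0 ↔ x ∈ L n := fun n x => by
    rw [map_exact (ι n) (LinearMap.exact_subtype_mkQ (subLimit ι G L)) hq x]
    conv_rhs => rw [← h.range_map_subLimit hG L hL n]
    rfl
  refine ⟨fun n => Module.Finite.of_surjective _ (hqs n), fun n g => trans_mk (h.comp n) _ g,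
    fun x hx => ?_⟩
  choose y hy using fun n => hqs n (x n)
  have hd : ∀ n, y n - trans (h.comp n) G (y (n + 1)) ∈ L n := fun n => by
    rw [← hker, map_sub, ← trans_map, hy, hy, hx, sub_self]
  -- The lifts `y n` are compatible only modulo `L n`; Theorem B for the `L n` absorbs the defect.
  obtain ⟨l, hl⟩ := (h.ab (fun n => L n) (h.subRes L hL) (h.span_range_subRes L hL)).1
    fun n => ⟨_, hd n⟩
  obtain ⟨g, hg⟩ := (hG.limit.lim (fun n => y n - l n) fun n => by
    have h1 : (l n : BaseChange (ι n) G) - trans (h.comp n) G (l (n + 1)) =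
      y n - trans (h.comp n) G (y (n + 1)) := congrArg Subtype.val (hl n)
    rw [map_sub, ← sub_eq_zero]
    rw [← sub_eq_zero] at h1
    rw [← h1]
    abel).exists
  have hgx : ∀ n, BaseChange.mk (ι n) _ (q g) = x n := fun n => by
    have h1 : BaseChange.mk (ι n) G g = y n - l n := hg n
    rw [← map_mk, h1, map_sub, (hker n (l n)).2 (l n).2, sub_zero, hy]
  refine ⟨q g, hgx, fun z hz => ?_⟩
  obtain ⟨g', rfl⟩ := hq z
  rw [← sub_eq_zero, ← map_sub]
  refine (Submodule.Quotient.mk_eq_zero _).2 fun n => ?_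
  rw [← hker, map_mk, map_sub, map_sub, sub_eq_zero]
  exact (hz n).trans (hgx n).symm

end Sub

end IsSteinSystem

/-! ### `Ext` groups of coadmissible modules -/

theorem ExtM.post_sub {A : Type u} [Ring A] {N B B' : Type u} [AddCommGroup N] [Module A N]
    [AddCommGroup B] [Module A B] [AddCommGroup B'] [Module A B'] (l : ℕ) (f g : B →ₗ[A] B')
    (x : ExtM A N B l) : ExtM.post N l (f - g) x = ExtM.post N l f x - ExtM.post N l g x := by
  rw [eq_sub_iff_add_eq, ← ExtM.post_add, sub_add_cancel]

namespace IsSteinSystem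

variable (h : IsSteinSystem φ ι)
include h

omit h in
/-- The product of the rings `R n`, as an `A`-module. -/
abbrev Prod (_ : IsSteinSystem φ ι) : Type u := ∀ n, Rest (ι n) (R n)

/-- The embedding of `A` into the product of the rings `R n`. -/
def toProd : A →ₗ[A] h.Prod := LinearMap.pi fun n => ExtB.restHom (ι n)

/-- The difference of the identity and the shift on the product of the rings `R n`. -/
def shiftProd : h.Prod →ₗ[A] h.Prod :=
  LinearMap.pi fun n => LinearMap.proj (R := A) (φ := fun n => Rest (ι n) (R n)) n -
    ExtB.transHom (h.comp n) ∘ₗ LinearMap.proj (R := A) (φ := fun n => Rest (ι n) (R n)) (n + 1)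

theorem toProd_injective : Function.Injective h.toProd := by
  refine (injective_iff_map_eq_zero _).2 fun a ha => ?_
  exact (h.lim (fun _ => 0) fun _ => _root_.map_zero _).unique (fun n => congrFun ha n)
    fun n => _root_.map_zero _

/-- This is Theorem B for the tower of rings itself. -/
theorem shiftProd_surjective : Function.Surjective h.shiftProd := by
  intro d
  obtain ⟨x, hx⟩ := (h.ab R (fun n => (φ n).toSemilinearMap) fun n => by
    rw [eq_top_iff, ← Ideal.span_singleton_one]
    exact Submodule.span_mono (Set.singleton_subset_iff.2 ⟨1, (φ n).map_one⟩)).1 d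
  exact ⟨x, funext hx⟩

theorem exact_toProd_shiftProd : Function.Exact h.toProd h.shiftProd := by
  intro x
  constructor
  · intro hx
    obtain ⟨a, ha⟩ := (h.lim x fun n => (sub_eq_zero.1 (congrFun hx n)).symm).exists
    exact ⟨a, funext ha⟩
  · rintro ⟨a, rfl⟩
    exact funext fun n => sub_eq_zero.2 (h.comp n a).symm

end IsSteinSystem

end Coadmissible

section ExtCoadmissible

variable {A : Type u} [Ring A] {R : ℕ → Type u} [∀ n, Ring (R n)]
  {φ : ∀ n, R (n + 1) →+* R n} {ι : ∀ n, A →+* R n}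

open BaseChange

namespace IsSteinSystem

variable (h : IsSteinSystem φ ι)
  (h' : IsSteinSystem (fun n => RingHom.op (φ n)) (fun n => RingHom.op (ι n)))
variable {N : Type u} [AddCommGroup N] [Module A N] (hN : IsCoadm h.comp N) (l : ℕ)

theorem piMap_post_toProd (x : ExtDual A N l) (n : ℕ) :
    ExtM.piMap (R := A) (fun n => Rest (ι n) (R n)) N l (ExtM.post N l h.toProd x) n =
      ExtB.ofDual (ι n) N l x :=
  (ExtM.post_comp l _ _ x).symm

theorem piMap_post_shiftProd (x : ExtM A N h.Prod l) (n : ℕ) :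
    ExtM.piMap (R := A) (fun n => Rest (ι n) (R n)) N l (ExtM.post N l h.shiftProd x) n =
      ExtM.piMap (R := A) (fun n => Rest (ι n) (R n)) N l x n -
      ExtM.post N l (ExtB.transHom (h.comp n))
        (ExtM.piMap (R := A) (fun n => Rest (ι n) (R n)) N l x (n + 1)) := by
  refine (ExtM.post_comp l _ _ x).symm.trans ?_
  have e : LinearMap.proj (R := A) (φ := fun n => Rest (ι n) (R n)) n ∘ₗ h.shiftProd =
      LinearMap.proj (R := A) (φ := fun n => Rest (ι n) (R n)) n - ExtB.transHom (h.comp n) ∘ₗ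
        LinearMap.proj (R := A) (φ := fun n => Rest (ι n) (R n)) (n + 1) :=
    LinearMap.ext fun _ => rfl
  refine (congrArg (fun f => ExtM.post N l f x) e).trans ((ExtM.post_sub l _ _ x).trans ?_)
  exact congrArg (_ - ·) (ExtM.post_comp l _ _ x)

include h' hN in
theorem finite_extB (n : ℕ) : Module.Finite (R n)ᵐᵒᵖ (ExtB (ι n) N l) := by
  have := h.noeth n
  have := h'.noeth n
  have := hN.finite n
  exact Module.Finite.equiv (ExtB.adjEquiv (ι n) N (h.flat_ι n) l)

include h' hN in
theorem lift_extB_trans_bijective (n : ℕ) :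
    Function.Bijective (lift (ExtB.trans (h.comp n) N l)) :=
  have := h.noeth (n + 1)
  have := hN.finite (n + 1)
  ExtB.lift_trans_bijective (h.comp n) N (h.flat_ι (n + 1)) (h'.flat n) l

-- After commuting `Ext` with the product, this is Theorem B for the right modules `Ext^l_A(N, R
-- n)`, finite over the opposite rings. This is where the opposite tower enters.
include h' hN in
theorem post_shiftProd_surjective : Function.Surjective (ExtM.post N l h.shiftProd) := by
  have := h.finite_extB h' hN l
  intro y
  obtain ⟨z, hz⟩ := (h'.ab (fun n => ExtB (ι n) N l) (fun n => ExtB.trans (h.comp n) N l)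
    fun n => by
      rw [← range_lift, LinearMap.range_eq_top]
      exact (h.lift_extB_trans_bijective h' hN l n).2).1
    (ExtM.piMap (R := A) (fun n => Rest (ι n) (R n)) N l y)
  obtain ⟨x, rfl⟩ := (ExtM.piMap_bijective (R := A) (fun n => Rest (ι n) (R n)) l N).2 z
  refine ⟨x, (ExtM.piMap_bijective (R := A) (fun n => Rest (ι n) (R n)) l N).1 (funext fun n => ?_)⟩
  exact (h.piMap_post_shiftProd l x n).trans (hz n)

-- The kernel in degree `l + 1` is the image of the connecting map from degree `l`, which vanishes
-- because the map preceding it is surjective.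
include h' hN in
theorem post_toProd_injective : Function.Injective (ExtM.post N l h.toProd) := by
  cases l with
  | zero => exact ExtM.post_injective_of_injective h.toProd_injective
  | succ l =>
    refine (injective_iff_map_eq_zero _).2 fun x hx => ?_
    obtain ⟨y, rfl⟩ := (ExtM.exact_δ'_post h.toProd_injective h.shiftProd_surjective
      h.exact_toProd_shiftProd l x).1 hx
    obtain ⟨z, rfl⟩ := h.post_shiftProd_surjective h' hN l y
    exact (ExtM.exact_post_δ' h.toProd_injective h.shiftProd_surjective
      h.exact_toProd_shiftProd l _).2 ⟨z, rfl⟩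

include h' hN in
/-- `Ext^l_A(N, A)` is the limit of the modules `Ext^l_A(N, R n)`. -/
theorem extDual_isLimit : IsLimitModule (ι := fun n => RingHom.op (ι n))
    (M := fun n => ExtB (ι n) N l) (fun n => ExtB.trans (h.comp n) N l)
    (fun n => ExtB.ofDual (ι n) N l) := by
  refine ⟨fun n g => ?_, fun x hx => ?_⟩
  · refine (ExtM.post_comp l _ _ g).symm.trans ?_
    have e : ExtB.transHom (h.comp n) ∘ₗ ExtB.restHom (ι (n + 1)) = ExtB.restHom (ι n) :=
      LinearMap.ext fun a => h.comp n a
    exact congrArg (fun f => ExtM.post N l f g) e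
  · have hp := ExtM.piMap_bijective (R := A) (fun n => Rest (ι n) (R n)) l N
    obtain ⟨y, hy⟩ := hp.2 x
    have h0 : ExtM.post N l h.shiftProd y = 0 := hp.1 (funext fun n => by
      refine (h.piMap_post_shiftProd l y n).trans ?_
      rw [hy]
      exact (sub_eq_zero.2 (hx n).symm).trans (congrFun (_root_.map_zero
        (ExtM.piMap (R := A) (fun n => Rest (ι n) (R n)) N l)) n).symm)
    obtain ⟨g, rfl⟩ := (ExtM.exact_post_post h.toProd_injective h.shiftProd_surjective
      h.exact_toProd_shiftProd l y).1 h0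
    refine ⟨g, fun n => ?_, fun g' hg' => ?_⟩
    · exact (h.piMap_post_toProd l g n).symm.trans (congrFun hy n)
    · refine h.post_toProd_injective h' hN l (hp.1 (hy.symm ▸ funext fun n => ?_))
      exact (h.piMap_post_toProd l g' n).trans (hg' n)

include hN in
/-- `Ext^l_A(N, A)` is coadmissible. -/
theorem isCoadm_extDual : IsCoadm (φ := fun n => RingHom.op (φ n))
    (ι := fun n => RingHom.op (ι n)) h'.comp (ExtDual A N l) :=
  have := h.finite_extB h' hN l
  h'.isCoadm_of_isLimit (M := fun n => ExtB (ι n) N l) (h.lift_extB_trans_bijective h' hN l) (h.extDual_isLimit h' hN l)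

include h' hN in
/-- `Ext^l_A(N, A) ⊗_A R n = Ext^l_{R n}(R n ⊗_A N, R n)`. -/
theorem nonempty_baseChange_extDual (n : ℕ) :
    Nonempty (BaseChange (RingHom.op (ι n)) (ExtDual A N l) ≃ₗ[(R n)ᵐᵒᵖ]
      ExtDual (R n) (BaseChange (ι n) N) l) :=
  have := h.finite_extB h' hN l
  ⟨(LinearEquiv.ofBijective _ (h'.lift_bijective
    (M := fun n => ExtB (ι n) N l) (h.lift_extB_trans_bijective h' hN l)
    (h.extDual_isLimit h' hN l) n)).trans (ExtB.adjEquiv (ι n) N (h.flat_ι n) l).symm⟩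

-- `Ext^l_A(N, A)` is coadmissible, so it is zero as soon as all its base changes are.
include h' hN in
theorem subsingleton_extDual_iff : Subsingleton (ExtDual A N l) ↔
    ∀ n, Subsingleton (ExtDual (R n) (BaseChange (ι n) N) l) := by
  rw [(h.isCoadm_extDual h' hN l).subsingleton_iff]
  exact forall_congr' fun n =>
    (h.nonempty_baseChange_extDual h' hN l n).some.toEquiv.subsingleton_congr

include h' hN in
theorem gradeGE_iff : GradeGE A N l ↔ ∀ n, GradeGE (R n) (BaseChange (ι n) N) l := by
  simp only [GradeGE, h.subsingleton_extDual_iff h' hN]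
  exact ⟨fun H n i hi => H i hi n, fun H i hi n => H n i hi⟩

-- The criterion for single `Ext` is used once more, for the coadmissible module `Ext^l_A(N, A)`
-- over the opposite tower.
include h' hN in
theorem subsingleton_extExt_iff (h'' : IsSteinSystem (fun n => RingHom.op (RingHom.op (φ n)))
    (fun n => RingHom.op (RingHom.op (ι n)))) : Subsingleton (ExtExt A N l) ↔
    ∀ n, Subsingleton (ExtExt (R n) (BaseChange (ι n) N) l) := by
  refine (h'.subsingleton_extDual_iff h'' (h.isCoadm_extDual h' hN l) l).trans
    (forall_congr' fun n => ?_)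
  obtain ⟨e⟩ := h.nonempty_baseChange_extDual h' hN l n
  exact (ExtDual.congr l e).toEquiv.subsingleton_congr.symm

end IsSteinSystem

end ExtCoadmissible

/-! ### Functoriality of the dimension filtration -/

namespace IsAuslanderRegular

variable {R : Type u} [Ring R] (hR : IsAuslanderRegular R)
  {N N' : Type u} [AddCommGroup N] [Module R N] [AddCommGroup N'] [Module R N']
  [Module.Finite R N] [Module.Finite R N']

-- Both sides are largest submodules of grade at least `l`: grade bounds pass to submodules, and `f`
-- identifies submodules of `N` with their images.
include hR in
theorem comap_dimFiltration {f : N →ₗ[R] N'} (hf : Function.Injective f) (l : ℕ) :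
    (dimFiltration R N' l).comap f = dimFiltration R N l := by
  have := hR.noetherian_left
  apply le_antisymm
  · refine le_dimFiltration (hR.gradeGE_of_injective (hR.gradeGE_dimFiltration (N := N') l)
      (f.restrict (p := (dimFiltration R N' l).comap f) fun x hx => hx) fun x y hxy => ?_)
    exact Subtype.ext (hf (congrArg (fun z : dimFiltration R N' l => (z : N')) hxy))
  · rw [← Submodule.map_le_iff_le_comap]
    exact le_dimFiltration ((hR.gradeGE_dimFiltration (N := N) l).congr
      (Submodule.equivMapOfInjective f hf _))

include hR in
theorem map_dimFiltration (e : N ≃ₗ[R] N') (l : ℕ) :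
    (dimFiltration R N l).map e.toLinearMap = dimFiltration R N' l := by
  rw [← hR.comap_dimFiltration e.injective l]
  exact Submodule.map_comap_eq_of_surjective e.surjective _

omit [Module.Finite R N] in
theorem dimFiltration_zero : dimFiltration R N 0 = ⊤ :=
  top_le_iff.1 (le_dimFiltration fun _ hi => absurd hi (Nat.not_lt_zero _))

include hR in
theorem dimFiltration_eq_top_iff {l : ℕ} : dimFiltration R N l = ⊤ ↔ GradeGE R N l := by
  rw [← top_le_iff, ← hR.gradeGE_iff_le_dimFiltration]
  exact ⟨fun h => h.congr Submodule.topEquiv, fun h => h.congr Submodule.topEquiv.symm⟩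

include hR in
theorem dimFiltration_eq_bot {d : ℕ} (hd : GlobalDimensionLE R d) {l : ℕ}
    (hN : ∀ i, l ≤ i → Subsingleton (ExtExt R N i)) : dimFiltration R N l = ⊥ :=
  (Submodule.subsingleton_iff_eq_bot).1 (hR.subsingleton_of_extExt hd hN
    (dimFiltration R N l).subtype (Submodule.injective_subtype _) (hR.gradeGE_dimFiltration l))

end IsAuslanderRegular

theorem BaseChange.range_map {R S : Type u} [Ring R] [Ring S] (φ : R →+* S) {N N' : Type u}
    [AddCommGroup N] [Module R N] [AddCommGroup N'] [Module R N'] (f : N →ₗ[R] N') :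
    LinearMap.range (BaseChange.map φ f) =
      Submodule.span S (BaseChange.mk φ N' '' Set.range f) := by
  rw [LinearMap.range_eq_map, ← span_range_mk, Submodule.map_span, ← Set.range_comp,
    ← Set.range_comp]
  rfl

/-! ### The dimension filtration of a coadmissible module -/

section DimensionFiltration

variable {A : Type u} [Ring A] {R : ℕ → Type u} [∀ n, Ring (R n)]
  {φ : ∀ n, R (n + 1) →+* R n} {ι : ∀ n, A →+* R n}

open BaseChange

namespace IsSteinSystem

variable (ι) in
/-- The dimension filtration of `G`. -/
def dimSub (G : Type u) [AddCommGroup G] [Module A G] (l : ℕ) : Submodule A G :=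
  subLimit ι G fun n => dimFiltration (R n) (BaseChange (ι n) G) l

theorem mem_dimSub {G : Type u} [AddCommGroup G] [Module A G] {l : ℕ} {x : G} :
    x ∈ dimSub ι G l ↔
      ∀ n, BaseChange.mk (ι n) G x ∈ dimFiltration (R n) (BaseChange (ι n) G) l :=
  Iff.rfl

variable (h : IsSteinSystem φ ι)
  (h' : IsSteinSystem (fun n => RingHom.op (φ n)) (fun n => RingHom.op (ι n)))
  (h'' : IsSteinSystem (fun n => RingHom.op (RingHom.op (φ n)))
    (fun n => RingHom.op (RingHom.op (ι n))))
  (hR : ∀ n, IsAuslanderRegular (R n)) {d : ℕ} (hd : ∀ n, GlobalDimensionLE (R n) d)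
variable {G : Type u} [AddCommGroup G] [Module A G] (hG : IsCoadm h.comp G) (l : ℕ)

-- Since `Δ^l` commutes with flat base change, the steps at all levels form a coherent subsheaf.
-- This is the gluing datum for `Δ^l(G)`.
include h' hR hd hG in
theorem span_trans_dimFiltration (n : ℕ) :
    Submodule.span (R n) (trans (h.comp n) G ''
      dimFiltration (R (n + 1)) (BaseChange (ι (n + 1)) G) l) =
    dimFiltration (R n) (BaseChange (ι n) G) l := by
  have := hG.finite
  let e : BaseChange (φ n) (BaseChange (ι (n + 1)) G) ≃ₗ[R n] BaseChange (ι n) G :=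
    LinearEquiv.ofBijective _ (lift_trans_bijective (h.comp n) G)
  rw [← (hR n).map_dimFiltration e, ← range_baseChange_dimFiltration (φ n) (h.flat n) (h'.flat n)
    (hR (n + 1)) (hR n) (hd n), BaseChange.range_map, Submodule.map_span, ← Set.image_comp]
  congr 1
  ext x
  constructor
  · rintro ⟨y, hy, rfl⟩
    exact ⟨y, ⟨⟨y, hy⟩, rfl⟩, lift_mk _ _⟩
  · rintro ⟨_, ⟨y, rfl⟩, rfl⟩
    exact ⟨y, y.2, (lift_mk _ _).symm⟩

include h' hR hd hG in
theorem isCoadm_dimSub : IsCoadm h.comp (dimSub ι G l) :=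
  h.isCoadm_subLimit hG (fun n => dimFiltration (R n) (BaseChange (ι n) G) l)
    (h.span_trans_dimFiltration h' hR hd hG l)

include h' hR hd hG in
theorem range_map_dimSub (n : ℕ) : LinearMap.range (map (ι n) (dimSub ι G l).subtype) =
    dimFiltration (R n) (BaseChange (ι n) G) l :=
  h.range_map_subLimit hG (fun n => dimFiltration (R n) (BaseChange (ι n) G) l)
    (h.span_trans_dimFiltration h' hR hd hG l) n

theorem dimSub_zero : dimSub ι G 0 = ⊤ :=
  top_le_iff.1 fun x _ => mem_dimSub.2 fun n => by rw [IsAuslanderRegular.dimFiltration_zero]; trivial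

include hR hG in
theorem dimSub_succ_le : dimSub ι G (l + 1) ≤ dimSub ι G l := fun _ hx n =>
  have := hG.finite
  (hR n).dimFiltration_succ_le l (hx n)

include hG in
theorem dimSub_eq_bot {l : ℕ} (H : ∀ n, dimFiltration (R n) (BaseChange (ι n) G) l = ⊥) :
    dimSub ι G l = ⊥ := by
  rw [eq_bot_iff]
  refine fun x hx => hG.limit.eq_zero fun n => ?_
  have := mem_dimSub.1 hx n
  rw [H n] at this
  exact this

-- Beyond degree `d` every double `Ext` group at each level vanishes, so there is no submodule of
-- such grade.
include hR hd hG in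
theorem dimSub_eq_bot_of_lt {l : ℕ} (hl : d < l) : dimSub ι G l = ⊥ :=
  h.dimSub_eq_bot hG fun n =>
    have := hG.finite
    (hR n).dimFiltration_eq_bot (hd n) fun _ hi => (hd n).op (hl.trans_le hi) _

-- Flatness embeds `R n ⊗ N` into `R n ⊗ G`, so the grade bound at level `n` becomes containment in
-- `Δ^l(R n ⊗ G)`, which can be tested on the generators coming from `N`.
include h' hR hG in
theorem gradeGE_iff_le_dimSub (N : Submodule A G) (hN : IsCoadm h.comp N) :
    GradeGE A N l ↔ N ≤ dimSub ι G l := by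
  have := hG.finite
  rw [h.gradeGE_iff h' hN]
  have key : ∀ n, GradeGE (R n) (BaseChange (ι n) N) l ↔
      ∀ x ∈ N, BaseChange.mk (ι n) G x ∈ dimFiltration (R n) (BaseChange (ι n) G) l := by
    intro n
    have hinj := (h.flat_ι n).map_injective N.injective_subtype
    have e := LinearEquiv.ofInjective _ hinj
    trans GradeGE (R n) (LinearMap.range (map (ι n) N.subtype)) l
    · exact ⟨fun H => H.congr e, fun H => H.congr e.symm⟩
    · rw [(hR n).gradeGE_iff_le_dimFiltration, BaseChange.range_map, Submodule.span_le,
        Submodule.coe_subtype, Subtype.range_coe, Set.image_subset_iff]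
      rfl
  simp only [key]
  exact ⟨fun H x hx n => H n x hx, fun H n x hx => H hx n⟩

include h' hR hG in
theorem gradeGE_iff_dimSub_eq_top : GradeGE A G l ↔ dimSub ι G l = ⊤ := by
  have := hG.finite
  rw [h.gradeGE_iff h' hG]
  simp only [← fun n => (hR n).dimFiltration_eq_top_iff (N := BaseChange (ι n) G) (l := l)]
  constructor
  · exact fun H => top_le_iff.1 fun x _ => mem_dimSub.2 fun n => by rw [H n]; trivial
  · intro H n
    rw [← top_le_iff, ← span_range_mk, Submodule.span_le]
    rintro _ ⟨x, rfl⟩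
    have : x ∈ dimSub ι G l := by rw [H]; trivial
    exact this n

include h' hR hG in
theorem moduleGrade_eq_iSup : moduleGrade A G = ⨆ (l : ℕ) (_ : dimSub ι G l = ⊤), (l : ℕ∞) := by
  simp only [← h.gradeGE_iff_dimSub_eq_top h' hR hG, ← le_moduleGrade_iff]
  refine le_antisymm (ENat.forall_natCast_le_iff_le.1 fun a ha => ?_)
    (iSup₂_le fun _ hl => hl)
  exact le_iSup₂ (f := fun (l : ℕ) (_ : (l : ℕ∞) ≤ moduleGrade A G) => (l : ℕ∞)) a ha

-- Purity kills the double `Ext` modules in degrees above `j`, over `A` and hence at every level;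
-- this forces `Δ^{j+1}` to be zero.
include h' h'' hR hd hG in
theorem dimSub_of_isPure (hp : IsPureModule A G) {j : ℕ} (hj : moduleGrade A G = j) :
    dimSub ι G j = ⊤ ∧ dimSub ι G (j + 1) = ⊥ := by
  have := hG.finite
  refine ⟨(h.gradeGE_iff_dimSub_eq_top h' hR hG j).1 (le_moduleGrade_iff.1 hj.ge),
    h.dimSub_eq_bot hG fun n => (hR n).dimFiltration_eq_bot (hd n) fun i hi => ?_⟩
  refine (h.subsingleton_extExt_iff h' hG i h'').1 (hp i ?_) n
  rw [hj]
  exact fun hij => by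
    have := Nat.cast_injective hij
    omega

include hG in
theorem nonempty_baseChange_quotient (L : ∀ n, Submodule (R n) (BaseChange (ι n) G))
    (hL : ∀ n, Submodule.span (R n) (trans (h.comp n) G '' L (n + 1)) = L n) (n : ℕ) :
    Nonempty (BaseChange (ι n) (G ⧸ subLimit ι G L) ≃ₗ[R n] BaseChange (ι n) G ⧸ L n) := by
  have hs := map_surjective (ι n) (Submodule.mkQ_surjective (subLimit ι G L))
  have hk : LinearMap.ker (map (ι n) (subLimit ι G L).mkQ) = L n := by
    rw [← h.range_map_subLimit hG L hL n]
    exact LinearMap.exact_iff.1 (map_exact (ι n) (LinearMap.exact_subtype_mkQ (subLimit ι G L))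
      (Submodule.mkQ_surjective _))
  exact ⟨(LinearMap.quotKerEquivOfSurjective _ hs).symm.trans (Submodule.quotEquivOfEq _ _ hk)⟩

include h' h'' hR hd hG in
/-- The quotient of a module of grade at least `l` by the next step of its dimension filtration is
zero or pure of grade `l`. -/
theorem isPure_quotient_dimSub {l : ℕ} (hl : GradeGE A G l) :
    Subsingleton (G ⧸ dimSub ι G (l + 1)) ∨ (IsPureModule A (G ⧸ dimSub ι G (l + 1)) ∧
      moduleGrade A (G ⧸ dimSub ι G (l + 1)) = l) := by
  have := hG.finite
  have hL := h.span_trans_dimFiltration h' hR hd hG (l + 1)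
  have hQ : IsCoadm h.comp (G ⧸ dimSub ι G (l + 1)) := h.isCoadm_quotient hG
    (fun n => dimFiltration (R n) (BaseChange (ι n) G) (l + 1)) hL
  have := hQ.finite
  have e := fun n => (h.nonempty_baseChange_quotient hG
    (fun n => dimFiltration (R n) (BaseChange (ι n) G) (l + 1)) hL n).some
  rw [or_iff_not_imp_left]
  intro hns
  have hge : GradeGE A (G ⧸ dimSub ι G (l + 1)) l := (h.gradeGE_iff h' hQ l).2 fun n =>
    (hR n).gradeGE_of_surjective ((h.gradeGE_iff h' hG l).1 hl n) _
      (map_surjective (ι n) (Submodule.mkQ_surjective _))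
  -- A larger grade would give each `R n ⊗ G / Δ^{l+1}` grade at least `l + 1`, and such a quotient
  -- is zero.
  have hgr : moduleGrade A (G ⧸ dimSub ι G (l + 1)) = l := by
    refine le_antisymm (not_lt.1 fun hlt => hns ?_) (le_moduleGrade_iff.2 hge)
    have h1 : ((l + 1 : ℕ) : ℕ∞) ≤ moduleGrade A (G ⧸ dimSub ι G (l + 1)) := by
      rw [Nat.cast_add, Nat.cast_one]
      exact Order.add_one_le_of_lt hlt
    refine hQ.subsingleton_iff.2 fun n => (hR n).subsingleton_of_injective_quotient
      (e n).toLinearMap (e n).injective ((h.gradeGE_iff h' hQ (l + 1)).1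
        (le_moduleGrade_iff.1 h1) n)
  refine ⟨fun i hi => ?_, hgr⟩
  rw [hgr] at hi
  rcases lt_or_gt_of_ne (fun hil => hi (congrArg _ hil) : i ≠ l) with hil | hil
  -- Below `l` the inner `Ext` already vanishes; above `l` double `Ext` vanishes because the step of
  -- index `l + 1` has been divided out.
  · have := hge i hil
    exact ExtDual.subsingleton_of_subsingleton i
  · refine (h.subsingleton_extExt_iff h' hQ i h'').2 fun n => ?_
    have := (hR n).extExt_quotient_subsingleton (N := BaseChange (ι n) G) (l := l + 1) hil
    exact (ExtDual.congr i (ExtDual.congr i (e n))).toEquiv.subsingleton_congr.2 this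

-- Grade does not depend on the ambient module, so the filtration induced on a coadmissible
-- submodule is its own. In (iv) this permits replacing `G` by `Δ^l(G)`.
include h hR hG in
theorem submoduleOf_dimSub (N : Submodule A G) (hN : IsCoadm h.comp N) (l : ℕ) :
    (dimSub ι G l).submoduleOf N = dimSub ι N l := by
  have := hG.finite
  have := hN.finite
  ext x
  rw [mem_dimSub]
  refine forall_congr' fun n => ?_
  rw [← (hR n).comap_dimFiltration ((h.flat_ι n).map_injective N.injective_subtype) l]
  rfl

end IsSteinSystem

end DimensionFiltration

/-! ### The Banach algebras of a Fréchet–Stein algebra -/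

section Banach

variable {K : Type w} [NontriviallyNormedField K] {A : Type u} [Ring A] [Algebra K A]

namespace AlgSeminorm

variable (q : AlgSeminorm K A)

/-- A constant for the submultiplicativity of an algebra seminorm. -/
def mulConst : ℝ := q.exists_mul_le.choose

theorem mulConst_pos : 0 < q.mulConst := q.exists_mul_le.choose_spec.1

theorem norm_mul_le_compl (x y : q.Compl) : ‖x * y‖ ≤ q.mulConst * (‖x‖ * ‖y‖) := by
  induction x, y using UniformSpace.Completion.induction_on₂ with
  | hp =>
    exact isClosed_le (continuous_norm.comp (continuous_fst.mul continuous_snd))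
      (continuous_const.mul ((continuous_norm.comp continuous_fst).mul
        (continuous_norm.comp continuous_snd)))
  | ih a b =>
    rw [← UniformSpace.Completion.coe_mul, UniformSpace.Completion.norm_coe,
      UniformSpace.Completion.norm_coe, UniformSpace.Completion.norm_coe]
    exact q.exists_mul_le.choose_spec.2 a b

/-- The completion for an algebra seminorm, with a rescaled submultiplicative norm. -/
def Banach (q : AlgSeminorm K A) : Type u := q.Compl

instance : Ring q.Banach := inferInstanceAs (Ring q.Compl)

/-- The identity from the completion to its rescaled version. -/
def toBanach (x : q.Compl) : q.Banach := x

/-- The identity from the rescaled version of the completion. -/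
def ofBanach (x : q.Banach) : q.Compl := x

/-- The rescaled norm. -/
def ringNorm : RingNorm q.Banach where
  -- Scaling by the constant `c` turns `‖xy‖ ≤ c ‖x‖ ‖y‖` into genuine submultiplicativity.
  toFun x := q.mulConst * ‖q.ofBanach x‖
  map_zero' := by
    have : ‖q.ofBanach 0‖ = 0 := norm_zero (E := q.Compl)
    rw [this, mul_zero]
  add_le' x y := by
    rw [← mul_add]
    exact mul_le_mul_of_nonneg_left (norm_add_le (q.ofBanach x) (q.ofBanach y)) q.mulConst_pos.le
  neg' x := congrArg (q.mulConst * ·) (norm_neg (q.ofBanach x))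
  mul_le' x y := by
    rw [mul_mul_mul_comm, mul_assoc]
    exact mul_le_mul_of_nonneg_left (q.norm_mul_le_compl (q.ofBanach x) (q.ofBanach y))
      q.mulConst_pos.le
  eq_zero_of_map_eq_zero' x hx :=
    (norm_eq_zero (a := q.ofBanach x)).1 ((mul_eq_zero.1 hx).resolve_left q.mulConst_pos.ne')

instance : NormedRing q.Banach := q.ringNorm.toNormedRing

theorem dist_toBanach (x y : q.Compl) :
    dist (q.toBanach x) (q.toBanach y) = q.mulConst * dist x y := by
  rw [dist_eq_norm, dist_eq_norm]
  rfl

theorem lipschitz_toBanach : LipschitzWith (NNReal.mk q.mulConst q.mulConst_pos.le) q.toBanach :=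
  LipschitzWith.of_dist_le_mul fun x y => (q.dist_toBanach x y).le

theorem antilipschitz_toBanach :
    AntilipschitzWith (NNReal.mk q.mulConst⁻¹ (inv_pos.2 q.mulConst_pos).le) q.toBanach :=
  AntilipschitzWith.of_le_mul_dist fun x y => by
    rw [q.dist_toBanach, NNReal.coe_mk, inv_mul_cancel_left₀ q.mulConst_pos.ne']

theorem continuous_toBanach : Continuous q.toBanach := q.lipschitz_toBanach.continuous

theorem continuous_ofBanach : Continuous q.ofBanach :=
  (q.antilipschitz_toBanach.to_rightInverse (g := q.ofBanach) fun _ => rfl).continuous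

instance : CompleteSpace q.Banach :=
  ((q.antilipschitz_toBanach.isUniformInducing
    q.lipschitz_toBanach.uniformContinuous).completeSpace_congr fun x => ⟨x, rfl⟩).1 inferInstance

end AlgSeminorm

namespace AlgSeminormSeq

variable (Q : AlgSeminormSeq K A)

theorem continuous_φ (n : ℕ) : Continuous (Q.φ n) := UniformSpace.Completion.continuous_map

theorem denseRange_ι (n : ℕ) : DenseRange (Q.ι n) :=
  UniformSpace.Completion.denseRange_coe (α := (Q.q n).Source)

theorem denseRange_φ (n : ℕ) : DenseRange (Q.φ n) :=
  (Q.denseRange_ι n).mono (by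
    rintro _ ⟨a, rfl⟩
    exact ⟨Q.ι (n + 1) a, φ_ι n a⟩)

/-- The transition maps of the rescaled Banach algebras. -/
def φB (n : ℕ) : (Q.q (n + 1)).Banach →+* (Q.q n).Banach := Q.φ n

theorem continuous_φB (n : ℕ) : Continuous (Q.φB n) :=
  ((Q.q n).continuous_toBanach.comp (Q.continuous_φ n)).comp (Q.q (n + 1)).continuous_ofBanach

theorem denseRange_φB (n : ℕ) : DenseRange (Q.φB n) :=
  (Function.Surjective.denseRange (f := (Q.q n).toBanach) fun x => ⟨x, rfl⟩).comp
    (Q.denseRange_φ n) (Q.q n).continuous_toBanach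

/-- The conclusion mentions no norm and the rescaled algebras are the same rings, so it transfers
unchanged. -/
theorem theoremsAB : TheoremsAB Q.φ :=
  theoremsAB_of_denseRange (R := fun n => (Q.q n).Banach) (φ := Q.φB) Q.continuous_φB
    Q.denseRange_φB

end AlgSeminormSeq

theorem continuous_ringHom_op {R S : Type*} [NormedRing R] [NormedRing S] {f : R →+* S}
    (hf : Continuous f) : Continuous (RingHom.op f) :=
  MulOpposite.continuous_op.comp (hf.comp MulOpposite.continuous_unop)

theorem denseRange_ringHom_op {R S : Type*} [NormedRing R] [NormedRing S] {f : R →+* S}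
    (hf : DenseRange f) : DenseRange (RingHom.op f) :=
  ((MulOpposite.op_surjective.denseRange (f := (MulOpposite.op : S → Sᵐᵒᵖ))).comp hf
    MulOpposite.continuous_op).mono (by
      rintro _ ⟨a, rfl⟩
      exact ⟨MulOpposite.op a, rfl⟩)

namespace AlgSeminormSeq

variable (Q : AlgSeminormSeq K A)

theorem theoremsAB_op : TheoremsAB (R := fun n => (Q.alg n)ᵐᵒᵖ) fun n => RingHom.op (Q.φ n) :=
  theoremsAB_of_denseRange (R := fun n => (Q.q n).Banachᵐᵒᵖ) (φ := fun n => RingHom.op (Q.φB n))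
    (fun n => continuous_ringHom_op (Q.continuous_φB n))
    fun n => denseRange_ringHom_op (Q.denseRange_φB n)

theorem theoremsAB_op_op : TheoremsAB (R := fun n => (Q.alg n)ᵐᵒᵖᵐᵒᵖ) fun n =>
    RingHom.op (RingHom.op (Q.φ n)) :=
  theoremsAB_of_denseRange (R := fun n => (Q.q n).Banachᵐᵒᵖᵐᵒᵖ)
    (φ := fun n => RingHom.op (RingHom.op (Q.φB n)))
    (fun n => continuous_ringHom_op (continuous_ringHom_op (Q.continuous_φB n)))
    fun n => denseRange_ringHom_op (denseRange_ringHom_op (Q.denseRange_φB n))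

theorem norm_ι (n : ℕ) (a : A) : ‖Q.ι n a‖ = (Q.q n).toSeminorm a :=
  UniformSpace.Completion.norm_coe (E := (Q.q n).Source) a

theorem norm_φ_le (n : ℕ) (x : Q.alg (n + 1)) : ‖Q.φ n x‖ ≤ ‖x‖ := by
  induction x using UniformSpace.Completion.induction_on with
  | hp => exact isClosed_le (continuous_norm.comp (Q.continuous_φ n)) continuous_norm
  | ih a =>
    have h : ∀ b : A, ‖Q.φ n (Q.ι (n + 1) b)‖ ≤ ‖Q.ι (n + 1) b‖ := fun b => by
      rw [φ_ι, norm_ι, norm_ι]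
      exact Q.le_succ n b
    exact h a

/-- The transition maps do not increase norms, so an approximation at level `n` is as good at every
lower level. -/
theorem norm_ι_sub_le {x : ∀ n, Q.alg n} (hx : ∀ n, Q.φ n (x (n + 1)) = x n) (a : A) {m n : ℕ}
    (hmn : m ≤ n) : ‖Q.ι m a - x m‖ ≤ ‖Q.ι n a - x n‖ := by
  induction n, hmn using Nat.le_induction with
  | base => exact le_rfl
  | succ n _ ih =>
    refine ih.trans ?_
    rw [← hx n, ← φ_ι, ← map_sub]
    exact Q.norm_φ_le n _

variable [UniformSpace A] [IsUniformAddGroup A] {Q} (hQ : Q.IsTwoSidedFrechetStein)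
include hQ

omit [IsUniformAddGroup A] in
theorem IsTwoSidedFrechetStein.ι_injective {a b : A} (h : ∀ n, Q.ι n a = Q.ι n b) : a = b := by
  have := hQ.t2
  by_contra hab
  obtain ⟨n, hn⟩ := hQ.withSeminorms.separating_of_T1 (a - b) (sub_ne_zero.2 hab)
  refine hn ?_
  rw [← Q.norm_ι n, map_sub, h n, sub_self, norm_zero]

/-- Approximates `x n` by elements `a n` of `A` up to `2^{-n}`; this sequence is Cauchy for every
`q_m`, and its limit in `A` has the required images. -/
theorem IsTwoSidedFrechetStein.exists_limit (x : ∀ n, Q.alg n)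
    (hx : ∀ n, Q.φ n (x (n + 1)) = x n) : ∃ a, ∀ n, Q.ι n a = x n := by
  have := hQ.complete
  have hε : ∀ n : ℕ, (0 : ℝ) < (1 / 2) ^ n := fun n => by positivity
  choose a ha using fun n => (Q.denseRange_ι n).exists_dist_lt (x n) (hε n)
  have hlim : ∀ m, Filter.Tendsto (fun n => Q.ι m (a n)) Filter.atTop (nhds (x m)) := fun m => by
    rw [tendsto_iff_norm_sub_tendsto_zero]
    refine squeeze_zero' (Filter.Eventually.of_forall fun _ => norm_nonneg _) ?_
      (tendsto_pow_atTop_nhds_zero_of_lt_one (r := (1 / 2 : ℝ)) (by norm_num) (by norm_num))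
    filter_upwards [Filter.eventually_ge_atTop m] with n hn
    refine (Q.norm_ι_sub_le hx (a n) hn).trans ?_
    have := (ha n).le
    rwa [dist_comm, dist_eq_norm] at this
  have hc : CauchySeq a := by
    have hu := (SeminormFamily.withSeminorms_iff_uniformSpace_eq_iInf _).1 hQ.withSeminorms
    have hm : ∀ m, CauchySeq (α := (Q.q m).Source) a := fun m =>
      ((UniformSpace.Completion.isUniformInducing_coe (Q.q m).Source).cauchy_map_iff
        (F := @Filter.map ℕ (Q.q m).Source a Filter.atTop)).1 (hlim m).cauchySeq
    refine ⟨inferInstance, ?_⟩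
    -- The uniformity of `A` is the infimum of those of the `q_m`, so the Cauchy condition can be
    -- checked one seminorm at a time.
    rw [congrArg (fun u => @uniformity A u) hu, iInf_uniformity]
    exact le_iInf fun m => (hm m).2
  obtain ⟨b, hb⟩ := cauchySeq_tendsto_of_complete hc
  refine ⟨b, fun m => tendsto_nhds_unique ?_ (hlim m)⟩
  rw [tendsto_iff_norm_sub_tendsto_zero]
  have := (hQ.withSeminorms.continuous_seminorm m).tendsto 0
  have h1 : Filter.Tendsto (fun n => a n - b) Filter.atTop (nhds 0) := by
    rw [← sub_self b]
    exact hb.sub_const b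
  refine ((this.comp h1).congr fun n => ?_).trans (by rw [map_zero])
  rw [← map_sub, Q.norm_ι]
  rfl

theorem IsTwoSidedFrechetStein.isSteinSystem : IsSteinSystem Q.φ Q.ι where
  comp := φ_ι
  noeth := hQ.noetherian_left
  flat := hQ.flat_right
  lim x hx := by
    obtain ⟨a, ha⟩ := hQ.exists_limit x hx
    exact ⟨a, ha, fun b hb => hQ.ι_injective fun n => (hb n).trans (ha n).symm⟩
  ab := Q.theoremsAB

omit [UniformSpace A] [IsUniformAddGroup A] hQ in
theorem _root_.IsSteinSystem.op {R : ℕ → Type u} [∀ n, Ring (R n)] {φ : ∀ n, R (n + 1) →+* R n}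
    {ι : ∀ n, A →+* R n} (h : IsSteinSystem φ ι) (hn : ∀ n, IsNoetherianRing (R n)ᵐᵒᵖ)
    (hf : ∀ n, FlatAsRightModule (RingHom.op (φ n))) (hab : TheoremsAB (R := fun n => (R n)ᵐᵒᵖ) fun n => RingHom.op (φ n)) :
    IsSteinSystem (fun n => RingHom.op (φ n)) (fun n => RingHom.op (ι n)) where
  comp n a := congrArg MulOpposite.op (h.comp n a.unop)
  noeth := hn
  flat := hf
  lim x hx := by
    obtain ⟨a, ha, hu⟩ := h.lim (fun n => (x n).unop) fun n => congrArg MulOpposite.unop (hx n)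
    exact ⟨MulOpposite.op a, fun n => congrArg MulOpposite.op (ha n),
      fun b hb => congrArg MulOpposite.op (hu b.unop fun n => congrArg MulOpposite.unop (hb n))⟩
  ab := hab

theorem IsTwoSidedFrechetStein.isSteinSystem_op :
    IsSteinSystem (fun n => RingHom.op (Q.φ n)) (fun n => RingHom.op (Q.ι n)) :=
  hQ.isSteinSystem.op hQ.noetherian_right hQ.flat_left Q.theoremsAB_op

theorem IsTwoSidedFrechetStein.isSteinSystem_op_op :
    IsSteinSystem (fun n => RingHom.op (RingHom.op (Q.φ n)))
      (fun n => RingHom.op (RingHom.op (Q.ι n))) :=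
  hQ.isSteinSystem_op.op (fun n =>
      have := hQ.noetherian_left n
      isNoetherianRing_of_ringEquiv _ (RingEquiv.opOp (Q.alg n)))
    (fun n => BaseChange.flat_op_op (Q.φ n) (hQ.flat_right n)) Q.theoremsAB_op_op

end AlgSeminormSeq

end Banach

/-! ### Coherent sheaves and the intrinsic form of coadmissibility -/

section Coadmissible

variable {K : Type w} [NontriviallyNormedField K] {A : Type u} [Ring A] [Algebra K A]

namespace AlgSeminormSeq

open BaseChange

variable {Q : AlgSeminormSeq K A}

/-- The transition maps of a coherent sheaf, as semilinear maps. -/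
def CoherentSheaf.resHom (F : Q.CoherentSheaf) (n : ℕ) : F.obj (n + 1) →ₛₗ[Q.φ n] F.obj n where
  toFun := F.res n
  map_add' x y := by simp only [res, tmul_add, map_add]
  map_smul' r x := by
    simp only [res]
    rw [tmul_smul, one_mul, ← map_smul, smul_tmul, mul_one]

theorem CoherentSheaf.lift_resHom_bijective (F : Q.CoherentSheaf) (n : ℕ) :
    Function.Bijective (lift (F.resHom n)) := by
  have : lift (F.resHom n) = (F.iso n).toLinearMap := hom_ext fun x => lift_mk _ x
  rw [this]
  exact (F.iso n).bijective

variable (h : IsSteinSystem Q.φ Q.ι) {M : Type u} [AddCommGroup M] [Module A M]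
include h

theorem isCoadm_of_isCoadmissible (hM : Q.IsCoadmissible M) : IsCoadm h.comp M := by
  obtain ⟨F, ⟨e⟩⟩ := hM
  let p : ∀ n, M →ₛₗ[Q.ι n] F.obj n := fun n =>
    { toFun := fun m => (e m).1 n
      map_add' := fun x y => by rw [map_add]; rfl
      map_smul' := fun a x => by rw [map_smul]; rfl }
  refine h.isCoadm_of_isLimit (M := F.obj) F.lift_resHom_bijective (p := p)
    ⟨fun n m => (e m).2 n, fun x hx => ⟨e.symm ⟨x, hx⟩, fun n => ?_, fun m hm => ?_⟩⟩
  · exact congrFun (congrArg Subtype.val (e.apply_symm_apply ⟨x, hx⟩)) n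
  · rw [← LinearEquiv.symm_apply_apply e m]
    exact congrArg e.symm (Subtype.ext (funext hm))

/-- The base changes `R n ⊗ M`, linked by transitivity of base change, are the required coherent
sheaf. -/
theorem isCoadmissible_of_isCoadm (hM : IsCoadm h.comp M) : Q.IsCoadmissible M := by
  have := hM.finite
  let F : Q.CoherentSheaf :=
    { obj := fun n => BaseChange (Q.ι n) M
      iso := fun n => LinearEquiv.ofBijective _ (lift_trans_bijective (h.comp n) M) }
  have hres : ∀ n x, F.res n x = trans (h.comp n) M x := fun n x =>
    lift_mk (trans (h.comp n) M) x
  let f : M →ₗ[A] F.globalSections :=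
    { toFun := fun m => ⟨fun n => BaseChange.mk (Q.ι n) M m, fun n => (hres n _).trans (hM.limit.comp n m)⟩
      map_add' := fun x y => Subtype.ext (funext fun n => map_add _ _ _)
      map_smul' := fun a x => Subtype.ext (funext fun n => (BaseChange.mk (Q.ι n) M).map_smulₛₗ a x) }
  refine ⟨F, ⟨LinearEquiv.ofBijective f ⟨(injective_iff_map_eq_zero f).2 fun m hm => ?_,
    fun x => ?_⟩⟩⟩
  · exact hM.limit.eq_zero fun n => congrFun (congrArg Subtype.val hm) n
  · obtain ⟨m, hm⟩ := (hM.limit.lim x.1 fun n => (hres n _).symm.trans (x.2 n)).exists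
    exact ⟨m, Subtype.ext (funext hm)⟩

omit h in
theorem dimFil_eq_dimSub : Q.dimFil M = IsSteinSystem.dimSub Q.ι M := rfl

end AlgSeminormSeq

end Coadmissible

end

theorem proposition8p7
    (K : Type w) [NontriviallyNormedField K] [IsUltrametricDist K] [CompleteSpace K]
    (A : Type u) [Ring A] [Algebra K A] [UniformSpace A] [IsUniformAddGroup A]
    (Q : AlgSeminormSeq K A) (hQ : Q.IsTwoSidedFrechetStein)
    (d : ℕ) (hreg : ∀ n, IsAuslanderRegular (Q.alg n))
    (hdim : ∀ n, GlobalDimensionLE (Q.alg n) d)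
    (M : Type u) [AddCommGroup M] [Module A M] (hM : Q.IsCoadmissible M) :
    -- the `Δ^l(M)` form a finite decreasing filtration of `M` by coadmissible submodules
    -- which induces the dimension filtration on each `A_{q_n} ⊗_A M`
    (Q.dimFil M 0 = ⊤ ∧ (∀ l, Q.dimFil M (l + 1) ≤ Q.dimFil M l) ∧ Q.dimFil M (d + 1) = ⊥ ∧
      (∀ l, Q.IsCoadmissible (Q.dimFil M l)) ∧
      ∀ l n, Function.Injective (BaseChange.map (Q.ι n) (Q.dimFil M l).subtype) ∧
        LinearMap.range (BaseChange.map (Q.ι n) (Q.dimFil M l).subtype) =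
          dimFiltration (Q.alg n) (BaseChange (Q.ι n) M) l) ∧
    -- i
    (∀ N : Submodule A M, Q.IsCoadmissible N →
      ∀ l : ℕ, (l : ℕ∞) ≤ moduleGrade A N ↔ N ≤ Q.dimFil M l) ∧
    -- ii
    (moduleGrade A M = ⨆ (l : ℕ) (_ : Q.dimFil M l = ⊤), (l : ℕ∞)) ∧
    -- iii
    (IsPureModule A M → ∀ j : ℕ, moduleGrade A M = j →
      Q.dimFil M j = ⊤ ∧ Q.dimFil M (j + 1) = ⊥) ∧
    -- iv
    (∀ l : ℕ,
      Subsingleton (Q.dimFil M l ⧸ (Q.dimFil M (l + 1)).submoduleOf (Q.dimFil M l)) ∨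
      (IsPureModule A (Q.dimFil M l ⧸ (Q.dimFil M (l + 1)).submoduleOf (Q.dimFil M l)) ∧
        moduleGrade A (Q.dimFil M l ⧸ (Q.dimFil M (l + 1)).submoduleOf (Q.dimFil M l)) = l)) := by
  have h := hQ.isSteinSystem
  have h' := hQ.isSteinSystem_op
  have h'' := hQ.isSteinSystem_op_op
  have hG := AlgSeminormSeq.isCoadm_of_isCoadmissible h hM
  have hD := h.isCoadm_dimSub h' hreg hdim hG
  have hF := AlgSeminormSeq.dimFil_eq_dimSub (Q := Q) (M := M)
  -- Replaces `dimFil` throughout by the definitionally equal `dimSub`.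
  generalize Q.dimFil M = D at hF ⊢
  subst hF
  refine ⟨⟨IsSteinSystem.dimSub_zero, h.dimSub_succ_le hreg hG,
    h.dimSub_eq_bot_of_lt hreg hdim hG (Nat.lt_succ_self d),
    fun l => AlgSeminormSeq.isCoadmissible_of_isCoadm h (hD l),
    fun l n => ⟨(h.flat_ι n).map_injective (Submodule.injective_subtype _),
      h.range_map_dimSub h' hreg hdim hG l n⟩⟩, fun N hN l => ?_,
    h.moduleGrade_eq_iSup h' hreg hG, fun hp j hj => h.dimSub_of_isPure h' h'' hreg hdim hG hp hj,
    fun l => ?_⟩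
  · rw [le_moduleGrade_iff]
    exact h.gradeGE_iff_le_dimSub h' hreg hG l N
      (AlgSeminormSeq.isCoadm_of_isCoadmissible h hN)
  -- `Δ^l(M)` is coadmissible of grade at least `l`, and `Δ^{l+1}(M)` is step `l + 1` of its own
  -- filtration. The statement on quotients thus applies to `Δ^l(M)` itself.
  · rw [h.submoduleOf_dimSub hreg hG _ (hD l)]
    exact h.isPure_quotient_dimSub h' h'' hreg hdim (hD l)
      ((h.gradeGE_iff_le_dimSub h' hreg hG l _ (hD l)).2 le_rfl)
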